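/- **Cubes.** Let $A\subseteq\{0,1\}$. The cube category $\Box_A$ has as objects the posets $[1]^n$ ($n\ge 0$), and as morphisms the maps generated under composition by the faces $\partial_{i,\varepsilon}$ (insert the constant $\varepsilon\in\{0,1\}$ as $i$-th coordinate), the degeneracies $\sigma_i$ (omit the $i$-th coordinate) and, for $\varepsilon\in A$, the connections $\gamma_{i,\varepsilon}$ (replace the coordinates $x_i,x_{i+1}$ by $\max(x_i,x_{i+1})$ if $\varepsilon=0$ and by $\min(x_i,x_{i+1})$ if $\varepsilon=1$). A cubical set is a presheaf on $\Box_A$, with structure maps acting on the right; a cube is degenerate if it is in the image of some $\sigma_i$ or $\gamma_{i,\varepsilon}$. A marked cubical set is a cubical set with a set of marked cubes of positive dimension containing all degenerate cubes; morphisms preserve marked cubes. This gives a category $\mathsf{cSet}_A^+$. Let $\Box_A^n$ be the representable cubical set with only its degenerate cubes marked, and $\partial\Box_A^n\subseteq\Box_A^n$ the union of its faces $\partial_{i,\varepsilon}$, with the markings of $\Box^n_A$. **Comical maps.** For $n\ge1$, $1\le i\le n$, $\varepsilon\in\{0,1\}$, a monomorphism $\delta\colon[1]^m\to[1]^n$,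 written as $\partial_{c_1,\varepsilon_1}\cdots\partial_{c_r,\varepsilon_r}$ with $c_1>\dots>c_r$, is critical with respect to $\partial_{i,\varepsilon}$ if this expression contains neither $\partial_{i,0}$ nor $\partial_{i,1}$; for no $j>i$ contains $\partial_{j,\varepsilon}$ together with $\partial_{k,1-\varepsilon}$ for all $i<k<j$; and for no $j<i$ contains $\partial_{j,\varepsilon}$ together with $\partial_{k,1-\varepsilon}$ for all $j<k<i$. The comical cube $\Box^n_{A,i,\varepsilon}$ is $\Box_A^n$ with all critical faces of positive dimension marked as well. The comical open box inclusion is the inclusion of the union of all faces $\partial_{j,\varepsilon'}$ with $(j,\varepsilon')\ne(i,\varepsilon)$, with the induced markings, into $\Box^n_{A,i,\varepsilon}$. For $n\ge2$, let $(\Box^n_{A,i,\varepsilon})'$ be $\Box^n_{A,i,\varepsilon}$ with all $(n-1)$-dimensional faces except $\partial_{i,\varepsilon}$ also marked, and $\tau_{n-2}\Box^n_{A,i,\varepsilon}$ be $\Box^n_{A,i,\varepsilon}$ with all cubes of dimension greater than $n-2$ and positive also marked; the comical marking extension is the map $(\Box^n_{A,i,\varepsilon})'\to\tau_{n-2}\Box^n_{A,i,\varepsilon}$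 which is the identity on cubes. A map of $\mathsf{cSet}_A^+$ is comical if it is in the saturation of the set of all comical open box inclusions and comical marking extensions (the smallest class of maps containing them and closed under pushouts, transfinite composition and retracts), and a comical fibration if it has the right lifting property with respect to them. **Connections.** Let $i^*\colon\mathsf{cSet}_A^+\to\mathsf{cSet}_\varnothing^+$ be the functor that restricts the structure maps along $\Box_\varnothing\subseteq\Box_A$ and keeps the marked cubes. It has a left adjoint $i_!$; let $\eta\colon X\to i^*i_!X$ be the unit. A weak connection structure on a map $f\colon X\to Y$ in $\mathsf{cSet}_\varnothing^+$ is a map $\Gamma_f\colon i^*i_!X\to Y$ with $\Gamma_f\,\eta_X=f$. For $g\colon Y\to Z$ and $k\colon W\to X$ it induces the weak connection structures $g\,\Gamma_f$ on $gf$ and $\Gamma_f\circ i^*i_!k$ on $fk$. **Proposition.** Let $A\subseteq\{0,1\}$ and $n\ge0$. 1. The inclusion $\Box_\varnothing^n\cup_{\partial\Box_\varnothing^n}i^*\partial\Box_A^n\hookrightarrow i^*\Box_A^n$, whose domain is the pushout of $\Box_\varnothing^n\leftarrow\partial\Box_\varnothing^n\to i^*\partial\Box_A^n$ in $\mathsf{cSet}_\varnothing^+$,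 is comical. 2. Weak connection structures on $n$-cubes lift along comical fibrations, relative to the boundary. That is, let $f\colon X\to Y$ be a comical fibration in $\mathsf{cSet}_\varnothing^+$, let $x\colon\Box_\varnothing^n\to X$ with $\partial x=x|_{\partial\Box_\varnothing^n}$, and let $\Gamma_{\partial x}$ and $\Gamma_{fx}$ be weak connection structures on $\partial x$ and on $fx$ such that $\Gamma_{fx}$ restricts to $f\,\Gamma_{\partial x}$ on $\partial\Box_\varnothing^n$. Then there is a weak connection structure $\Gamma_x$ on $x$ which restricts to $\Gamma_{\partial x}$ and satisfies $f\,\Gamma_x=\Gamma_{fx}$. -/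

import Mathlib

open CategoryTheory CategoryTheory.Limits Opposite

attribute [local instance 2000] CategoryTheory.CategoryStruct.toQuiver

/-! ### Cube categories -/

/-- The face map `∂_{i,ε} : [1]^n → [1]^{n+1}`, inserting the constant `ε` at position `i`.
Vertices of `[1]^n` are functions `Fin n → Bool`, with `false` for `0` and `true` for `1`;
coordinates are numbered from `0`. -/
def cubeFace {n : ℕ} (i : Fin (n + 1)) (ε : Bool) (x : Fin n → Bool) : Fin (n + 1) → Bool :=
  i.insertNth (α := fun _ => Bool) ε x

/-- The degeneracy map `σ_i : [1]^{n+1} → [1]^n`, forgetting the coordinate `i`. -/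
def cubeDegen {n : ℕ} (i : Fin (n + 1)) (x : Fin (n + 1) → Bool) : Fin n → Bool :=
  fun j => x (i.succAbove j)

/-- The connection map `γ_{i,ε} : [1]^{n+2} → [1]^{n+1}`, replacing the two coordinates
`i, i + 1` by their maximum if `ε = 0`, and by their minimum if `ε = 1`. -/
def cubeConn {n : ℕ} (i : Fin (n + 1)) (ε : Bool) (x : Fin (n + 2) → Bool) :
    Fin (n + 1) → Bool :=
  fun j =>
    if j < i then x j.castSucc
    else if j = i then
      (if ε then min (x i.castSucc) (x i.succ) else max (x i.castSucc) (x i.succ))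
    else x j.succ

/-- The maps `[1]^m → [1]^n` generated under composition by faces, degeneracies, and the
connections `γ_{i,ε}` with `ε ∈ A`. -/
inductive IsCubeMap (A : Set Bool) : ∀ {m n : ℕ}, ((Fin m → Bool) → (Fin n → Bool)) → Prop
  | id (n : ℕ) : IsCubeMap A (fun x : Fin n → Bool => x)
  | face {n : ℕ} (i : Fin (n + 1)) (ε : Bool) : IsCubeMap A (cubeFace i ε)
  | degen {n : ℕ} (i : Fin (n + 1)) : IsCubeMap A (cubeDegen i)
  | conn {n : ℕ} (i : Fin (n + 1)) (ε : Bool) (hε : ε ∈ A) : IsCubeMap A (cubeConn i ε)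
  | comp {k m n : ℕ} {f : (Fin k → Bool) → (Fin m → Bool)} {g : (Fin m → Bool) → (Fin n → Bool)} :
      IsCubeMap A f → IsCubeMap A g → IsCubeMap A (fun x => g (f x))

theorem IsCubeMap.mono {A B : Set Bool} (h : A ⊆ B) {m n : ℕ}
    {f : (Fin m → Bool) → (Fin n → Bool)} (hf : IsCubeMap A f) : IsCubeMap B f := by
  induction hf with
  | id n => exact .id n
  | face i ε => exact .face i ε
  | degen i => exact .degen i
  | conn i ε hε => exact .conn i ε (h hε)
  | comp _ _ h₁ h₂ => exact .comp h₁ h₂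

/-- The cube category `□_A`; the object `⟨n⟩` is `[1]^n`. -/
structure CubeCat (A : Set Bool) where
  /-- the dimension of the cube -/
  dim : ℕ

namespace CubeCat

variable {A : Set Bool}

instance : Category (CubeCat A) where
  Hom c d := {f : (Fin c.dim → Bool) → (Fin d.dim → Bool) // IsCubeMap A f}
  id c := ⟨fun x => x, .id _⟩
  comp f g := ⟨fun x => g.1 (f.1 x), f.2.comp g.2⟩

/-- The face map as a morphism of `□_A`. -/
def face {n : ℕ} (i : Fin (n + 1)) (ε : Bool) : (⟨n⟩ : CubeCat A) ⟶ ⟨n + 1⟩ :=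
  ⟨cubeFace i ε, .face i ε⟩

/-- The degeneracy map as a morphism of `□_A`. -/
def degen {n : ℕ} (i : Fin (n + 1)) : (⟨n + 1⟩ : CubeCat A) ⟶ ⟨n⟩ :=
  ⟨cubeDegen i, .degen i⟩

/-- The connection map as a morphism of `□_A`, for `ε ∈ A`. -/
def conn {n : ℕ} (i : Fin (n + 1)) (ε : Bool) (hε : ε ∈ A) :
    (⟨n + 2⟩ : CubeCat A) ⟶ ⟨n + 1⟩ :=
  ⟨cubeConn i ε, .conn i ε hε⟩

/-- The inclusion `i : □_A ⥤ □_B` for `A ⊆ B`. -/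
def incl {A B : Set Bool} (h : A ⊆ B) : CubeCat A ⥤ CubeCat B where
  obj c := ⟨c.dim⟩
  map f := ⟨f.1, f.2.mono h⟩

/-- `IsFace j ε φ` says that `φ` is the face map `∂_{j,ε}`. -/
inductive IsFace {n : ℕ} (j : Fin (n + 1)) (ε : Bool) :
    ∀ {c : CubeCat A}, (c ⟶ ⟨n + 1⟩) → Prop
  | intro : IsFace j ε (face j ε)

/-- The `j`-th coordinate of `δ` is constant with value `ε`. If `δ` is a monomorphism, i.e. a
composite `∂_{c₁,ε₁} ⋯ ∂_{c_r,ε_r}` with `c₁ > ⋯ > c_r` (its standard form), this says exactly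
that the face map `∂_{j,ε}` occurs in the standard form of `δ`: as the indices decrease, the
constant inserted by `∂_{c_s,ε_s}` ends up at position `c_s`. -/
def HasFace {c d : CubeCat A} (δ : c ⟶ d) (j : Fin d.dim) (ε : Bool) : Prop :=
  ∀ x, δ.1 x j = ε

/-- `δ` defines a critical face of the `n`-cube with respect to the face `∂_{i,ε}`. -/
structure IsCritical {c d : CubeCat A} (i : Fin d.dim) (ε : Bool) (δ : c ⟶ d) : Prop where
  mono : Mono δ
  middle : ¬ (HasFace δ i ε ∨ HasFace δ i (!ε))
  high : ¬ ∃ j, i < j ∧ HasFace δ j ε ∧ ∀ k, i < k → k < j → HasFace δ k (!ε)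
  low : ¬ ∃ j, j < i ∧ HasFace δ j ε ∧ ∀ k, j < k → k < i → HasFace δ k (!ε)

end CubeCat

/-! ### Marked cubical sets -/

/-- Cubical sets: presheaves on `□_A`. -/
abbrev CubicalSet (A : Set Bool) := (CubeCat A)ᵒᵖ ⥤ Type

/-- A cube is degenerate if it is in the image of a degeneracy or of a connection. -/
inductive CubicalSet.IsDegenerate {A : Set Bool} (X : CubicalSet A) :
    ∀ {c : CubeCat A}, X.obj (op c) → Prop
  | degen {n : ℕ} (i : Fin (n + 1)) (y : X.obj (op ⟨n⟩)) :
      IsDegenerate X (X.map (CubeCat.degen i).op y)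
  | conn {n : ℕ} (i : Fin (n + 1)) (ε : Bool) (hε : ε ∈ A) (y : X.obj (op ⟨n + 1⟩)) :
      IsDegenerate X (X.map (CubeCat.conn i ε hε).op y)

theorem CubicalSet.IsDegenerate.pos {A : Set Bool} {X : CubicalSet A} {c : CubeCat A}
    {x : X.obj (op c)} (h : X.IsDegenerate x) : 0 < c.dim := by
  cases h <;> exact Nat.succ_pos _

theorem CubicalSet.IsDegenerate.app {A : Set Bool} {X Y : CubicalSet A} (f : X ⟶ Y)
    {c : CubeCat A} {x : X.obj (op c)} (h : X.IsDegenerate x) :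
    Y.IsDegenerate (f.app (op c) x) := by
  cases h with
  | degen i y => rw [NatTrans.naturality_apply]; exact .degen i _
  | conn i ε hε y => rw [NatTrans.naturality_apply]; exact .conn i ε hε _

/-- A marked cubical set: a cubical set with a set of marked cubes of positive dimension which
contains all degenerate cubes. -/
structure MarkedCubicalSet (A : Set Bool) where
  /-- the underlying cubical set -/
  cubes : CubicalSet A
  /-- the marked cubes -/
  marked : ∀ c : CubeCat A, Set (cubes.obj (op c))
  pos : ∀ {c : CubeCat A} {x : cubes.obj (op c)}, x ∈ marked c → 0 < c.dim
  degenerate : ∀ {c : CubeCat A} {x : cubes.obj (op c)}, cubes.IsDegenerate x → x ∈ marked c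

namespace MarkedCubicalSet

variable {A B : Set Bool}

/-- Morphisms of marked cubical sets: maps of cubical sets preserving marked cubes. -/
@[ext]
structure Hom (X Y : MarkedCubicalSet A) where
  /-- the underlying map of cubical sets -/
  map : X.cubes ⟶ Y.cubes
  marked : ∀ {c : CubeCat A} {x : X.cubes.obj (op c)},
    x ∈ X.marked c → map.app (op c) x ∈ Y.marked c

instance : Category (MarkedCubicalSet A) where
  Hom := Hom
  id X := ⟨𝟙 _, fun h => by simpa using h⟩
  comp f g := ⟨f.map ≫ g.map, fun h => by simpa using g.marked (f.marked h)⟩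

@[ext]
theorem hom_ext {X Y : MarkedCubicalSet A} {f g : X ⟶ Y} (h : f.map = g.map) : f = g :=
  Hom.ext h

@[simp] theorem id_map (X : MarkedCubicalSet A) : Hom.map (𝟙 X) = 𝟙 X.cubes := rfl

@[simp] theorem comp_map {X Y Z : MarkedCubicalSet A} (f : X ⟶ Y) (g : Y ⟶ Z) :
    Hom.map (f ≫ g) = f.map ≫ g.map := rfl

/-- The marked cubical set on `X` whose marked cubes are the degenerate ones and those in `S`
which have positive dimension. -/
def ofMarks (X : CubicalSet A) (S : ∀ c : CubeCat A, Set (X.obj (op c))) :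
    MarkedCubicalSet A where
  cubes := X
  marked c := {x | X.IsDegenerate x ∨ (0 < c.dim ∧ x ∈ S c)}
  pos h := h.elim (fun h => h.pos) (fun h => h.1)
  degenerate h := Or.inl h

/-- The regular subcomplex of `X` on a family of cubes closed under the structure maps: a cube
is marked in it iff it is marked in `X`. -/
def regular (X : MarkedCubicalSet A) (S : Subfunctor X.cubes) : MarkedCubicalSet A where
  cubes := S.toFunctor
  marked c := {x | x.1 ∈ X.marked c}
  pos h := X.pos h
  degenerate h := X.degenerate (h.app S.ι)

/-- The regular subcomplex inclusion. -/
def regularι (X : MarkedCubicalSet A) (S : Subfunctor X.cubes) : X.regular S ⟶ X where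
  map := S.ι
  marked h := h

/-- The entire map which adds marked cubes. -/
def entire (X : CubicalSet A) {S T : ∀ c : CubeCat A, Set (X.obj (op c))}
    (h : ∀ c, S c ⊆ T c) : ofMarks X S ⟶ ofMarks X T where
  map := 𝟙 X
  marked {c _} hx := Or.imp id (fun hx => ⟨hx.1, h c hx.2⟩) hx

/-! ### Standard cubes, boundaries, comical open boxes and marking extensions -/

/-- The standard cube `□^n_A`: the representable cubical set, with only the degenerate cubes
marked. -/
def stdCube (A : Set Bool) (n : ℕ) : MarkedCubicalSet A :=
  ofMarks (yoneda.obj ⟨n⟩) (fun _ => ∅)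

/-- The subcomplex of the `n`-cube consisting of all cubes of those faces `∂_{j,ε}` for which
`P j ε` holds. -/
def faceUnion (A : Set Bool) : ∀ (n : ℕ) (_ : Fin n → Bool → Prop),
    Subfunctor (yoneda.obj (⟨n⟩ : CubeCat A))
  | 0, _ => ⊥
  | n + 1, P =>
    { obj c := {φ | ∃ (j : Fin (n + 1)) (ε : Bool) (ψ : c.unop ⟶ (⟨n⟩ : CubeCat A)),
        P j ε ∧ φ = ψ ≫ CubeCat.face j ε}
      map := by
        rintro c d f φ ⟨j, ε, ψ, hP, rfl⟩
        exact ⟨j, ε, f.unop ≫ ψ, hP, by simp⟩ }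

/-- The boundary `∂□^n_A`. -/
def boundary (A : Set Bool) (n : ℕ) : MarkedCubicalSet A :=
  (stdCube A n).regular (faceUnion A n fun _ _ => True)

/-- The boundary inclusion `∂□^n_A ↪ □^n_A`. -/
def boundaryι (A : Set Bool) (n : ℕ) : boundary A n ⟶ stdCube A n :=
  regularι _ _

/-- The critical faces of the `n`-cube with respect to `∂_{i,ε}`. -/
def criticalFaces (A : Set Bool) (n : ℕ) (i : Fin n) (ε : Bool) (c : CubeCat A) :
    Set ((yoneda.obj (⟨n⟩ : CubeCat A)).obj (op c)) :=
  {δ : c ⟶ ⟨n⟩ | CubeCat.IsCritical i ε δ}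

/-- The `(i,ε)`-comical cube `□^n_{A,i,ε}`. -/
def comicalCube (A : Set Bool) (n : ℕ) (i : Fin n) (ε : Bool) : MarkedCubicalSet A :=
  ofMarks (yoneda.obj ⟨n⟩) (criticalFaces A n i ε)

/-- The `(i,ε)`-comical open box: the regular subcomplex of the comical cube formed by all faces
other than the interior and `∂_{i,ε}`. -/
def comicalBox (A : Set Bool) (n : ℕ) (i : Fin n) (ε : Bool) : MarkedCubicalSet A :=
  (comicalCube A n i ε).regular (faceUnion A n fun j ε' => (j, ε') ≠ (i, ε))

/-- The `(i,ε)`-comical open box inclusion. -/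
def comicalBoxι (A : Set Bool) (n : ℕ) (i : Fin n) (ε : Bool) :
    comicalBox A n i ε ⟶ comicalCube A n i ε :=
  regularι _ _

/-- The critical faces of the `(n+1)`-cube with respect to `∂_{i,ε}`, and its `n`-dimensional
faces other than `∂_{i,ε}`. -/
def criticalAndOtherFaces (A : Set Bool) (n : ℕ) (i : Fin (n + 1)) (ε : Bool) (c : CubeCat A) :
    Set ((yoneda.obj (⟨n + 1⟩ : CubeCat A)).obj (op c)) :=
  criticalFaces A (n + 1) i ε c ∪
    {δ : c ⟶ ⟨n + 1⟩ | ∃ j ε', (j, ε') ≠ (i, ε) ∧ CubeCat.IsFace j ε' δ}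

/-- The critical faces of the `(n+1)`-cube with respect to `∂_{i,ε}`, and all cubes of dimension
at least `n`. -/
def criticalAndHighCubes (A : Set Bool) (n : ℕ) (i : Fin (n + 1)) (ε : Bool) (c : CubeCat A) :
    Set ((yoneda.obj (⟨n + 1⟩ : CubeCat A)).obj (op c)) :=
  criticalFaces A (n + 1) i ε c ∪ {_δ : c ⟶ ⟨n + 1⟩ | n ≤ c.dim}

theorem criticalAndOtherFaces_subset (A : Set Bool) (n : ℕ) (i : Fin (n + 1)) (ε : Bool)
    (c : CubeCat A) : criticalAndOtherFaces A n i ε c ⊆ criticalAndHighCubes A n i ε c := by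
  rintro δ (h | ⟨j, ε', -, h⟩)
  · exact Or.inl h
  · refine Or.inr ?_
    cases h
    exact le_refl n

/-- The `(i,ε)`-comical marking extension `(□^{n+2}_{A,i,ε})' ⟶ τ_n □^{n+2}_{A,i,ε}`. In its
domain all critical faces and all codimension one faces except `∂_{i,ε}` are marked; in its
codomain, the `n`-trivialization, all cubes of dimension greater than `n` are marked too. -/
def comicalMarkingExt (A : Set Bool) (n : ℕ) (i : Fin (n + 2)) (ε : Bool) :
    ofMarks (yoneda.obj ⟨n + 2⟩) (criticalAndOtherFaces A (n + 1) i ε) ⟶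
      ofMarks (yoneda.obj ⟨n + 2⟩) (criticalAndHighCubes A (n + 1) i ε) :=
  entire _ (criticalAndOtherFaces_subset A (n + 1) i ε)

/-! ### Comical maps and comical fibrations -/

/-- The comical open box inclusions, in all dimensions `n + 1 ≥ 1`, and the comical marking
extensions, in all dimensions `n + 2 ≥ 2`. -/
def comicalGenerators (A : Set Bool) : MorphismProperty (MarkedCubicalSet A) :=
  MorphismProperty.ofHoms
      (fun p : (n : ℕ) × Fin (n + 1) × Bool => comicalBoxι A (p.1 + 1) p.2.1 p.2.2) ⊔
    MorphismProperty.ofHoms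
      (fun p : (n : ℕ) × Fin (n + 2) × Bool => comicalMarkingExt A p.1 p.2.1 p.2.2)

/-- The saturation of a class of maps: the smallest class containing it and closed under
pushouts, transfinite composition and retracts. -/
def saturation {C : Type 1} [Category.{0} C] (I : MorphismProperty C) : MorphismProperty C :=
  fun _ _ f => ∀ W : MorphismProperty C, I ≤ W → W.IsStableUnderCobaseChange →
    MorphismProperty.IsStableUnderTransfiniteComposition.{0} W → W.IsStableUnderRetracts → W f

/-- Comical maps. -/
def comical (A : Set Bool) : MorphismProperty (MarkedCubicalSet A) :=
  saturation (comicalGenerators A)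

/-- Comical fibrations: the maps with the right lifting property with respect to all comical open
box inclusions and comical marking extensions. -/
def comicalFibration (A : Set Bool) : MorphismProperty (MarkedCubicalSet A) :=
  (comicalGenerators A).rlp

/-! ### The adjunction `i_! ⊣ i^*` -/

/-- The functor `i^*`, which forgets the connections not in `A`. -/
def iStar (h : A ⊆ B) : MarkedCubicalSet B ⥤ MarkedCubicalSet A where
  obj X :=
    { cubes := (CubeCat.incl h).op ⋙ X.cubes
      marked c := X.marked ((CubeCat.incl h).obj c)
      pos hx := X.pos hx
      degenerate {c x} hx := by
        apply X.degenerate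
        cases hx with
        | degen i y => exact .degen (X := X.cubes) i y
        | conn i ε hε y => exact .conn (X := X.cubes) i ε (h hε) y }
  map f :=
    { map := Functor.whiskerLeft (CubeCat.incl h).op f.map
      marked hx := f.marked hx }

/-- On objects, `i_!` is the left Kan extension of the underlying cubical set; its marked cubes
are the degenerate ones and those coming from the marked cubes of `X`. -/
noncomputable def iShriekObj (h : A ⊆ B) (X : MarkedCubicalSet A) : MarkedCubicalSet B :=
  ofMarks ((CubeCat.incl h).op.lan.obj X.cubes) (fun c =>
    {y | ∃ x ∈ X.marked ⟨c.dim⟩,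
      ((CubeCat.incl h).op.lanUnit.app X.cubes).app (op ⟨c.dim⟩) x = y})

theorem lan_homEquiv (h : A ⊆ B) (X : CubicalSet A) (Y : CubicalSet B)
    (f : (CubeCat.incl h).op.lan.obj X ⟶ Y) :
    ((CubeCat.incl h).op.lanAdjunction Type).homEquiv X Y f =
      (CubeCat.incl h).op.lanUnit.app X ≫ Functor.whiskerLeft (CubeCat.incl h).op f := by
  rw [Adjunction.homEquiv_unit, Functor.lanAdjunction_unit]
  rfl

/-- The bijection between maps `i_! X ⟶ Y` and maps `X ⟶ i^* Y`. -/
noncomputable def iShriekEquiv (h : A ⊆ B) (X : MarkedCubicalSet A) (Y : MarkedCubicalSet B) :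
    (iShriekObj h X ⟶ Y) ≃ (X ⟶ (iStar h).obj Y) where
  toFun f :=
    { map := ((CubeCat.incl h).op.lanAdjunction Type).homEquiv _ _ f.map
      marked {c x} hx := by
        have key := f.marked (c := (CubeCat.incl h).obj c)
          (x := ((CubeCat.incl h).op.lanUnit.app X.cubes).app (op c) x)
          (Or.inr ⟨X.pos hx, x, hx, rfl⟩)
        have e := lan_homEquiv h X.cubes Y.cubes f.map
        rw [e]
        exact key }
  invFun g :=
    { map := (((CubeCat.incl h).op.lanAdjunction Type).homEquiv _ _).symm g.map
      marked {c y} hy := by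
        rcases hy with hy | ⟨-, x, hx, rfl⟩
        · exact Y.degenerate (hy.app _)
        · have key := g.marked hx
          have e := (lan_homEquiv h X.cubes Y.cubes _).symm.trans
            ((((CubeCat.incl h).op.lanAdjunction Type).homEquiv
              X.cubes Y.cubes).apply_symm_apply g.map)
          rw [← e] at key
          exact key }
  left_inv f := by
    ext1
    exact Equiv.symm_apply_apply _ _
  right_inv g := by
    ext1
    exact Equiv.apply_symm_apply _ _

theorem iShriekEquiv_naturality (h : A ⊆ B) (X : MarkedCubicalSet A) (Y Y' : MarkedCubicalSet B)
    (g : Y ⟶ Y') (f : iShriekObj h X ⟶ Y) :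
    iShriekEquiv h X Y' (f ≫ g) = iShriekEquiv h X Y f ≫ (iStar h).map g := by
  ext1
  exact Adjunction.homEquiv_naturality_right _ _ _

/-- The functor `i_!`, which freely adds the connections of `□_B`. -/
noncomputable def iShriek (h : A ⊆ B) : MarkedCubicalSet A ⥤ MarkedCubicalSet B :=
  Adjunction.leftAdjointOfEquiv (iShriekEquiv h) (iShriekEquiv_naturality h)

/-- The adjunction `i_! ⊣ i^*`. -/
noncomputable def iAdj (h : A ⊆ B) : iShriek h ⊣ iStar h :=
  Adjunction.adjunctionOfEquivLeft (iShriekEquiv h) (iShriekEquiv_naturality h)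

/-- A weak connection structure (with respect to `□_B`) on a map `f : X ⟶ Y`: a map
`Γ : i^* i_! X ⟶ Y` whose composite with the unit `X ⟶ i^* i_! X` is `f`. -/
structure WeakConnectionStructure (h : A ⊆ B) {X Y : MarkedCubicalSet A} (f : X ⟶ Y) where
  /-- the underlying map -/
  Γ : (iStar h).obj ((iShriek h).obj X) ⟶ Y
  unit_comp : (iAdj h).unit.app X ≫ Γ = f

/-- The weak connection structure `Γ_f ∘ i^* i_! k` on `f k`, for `k : W ⟶ X`. -/
noncomputable def WeakConnectionStructure.precomp {h : A ⊆ B} {W X Y : MarkedCubicalSet A} {f : X ⟶ Y}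
    (G : WeakConnectionStructure h f) (k : W ⟶ X) : WeakConnectionStructure h (k ≫ f) where
  Γ := (iStar h).map ((iShriek h).map k) ≫ G.Γ
  unit_comp := by
    have e : (iAdj h).unit.app W ≫ (iStar h).map ((iShriek h).map k) =
        k ≫ (iAdj h).unit.app X := ((iAdj h).unit.naturality k).symm
    rw [← Category.assoc, e, Category.assoc, G.unit_comp]

/-- The weak connection structure `g Γ_f` on `g f`, for `g : Y ⟶ Z`. -/
noncomputable def WeakConnectionStructure.postcomp {h : A ⊆ B} {X Y Z : MarkedCubicalSet A} {f : X ⟶ Y}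
    (G : WeakConnectionStructure h f) (g : Y ⟶ Z) : WeakConnectionStructure h (f ≫ g) where
  Γ := G.Γ ≫ g
  unit_comp := by rw [← Category.assoc, G.unit_comp]

/-! ### Colimits of marked cubical sets -/

section Colimits

variable {J : Type} [Category.{0} J] (F : J ⥤ MarkedCubicalSet A)

/-- The functor to the underlying cubical sets. -/
def toCubical (A : Set Bool) : MarkedCubicalSet A ⥤ CubicalSet A where
  obj X := X.cubes
  map f := f.map

/-- The colimit cocone: a cube of the colimit is marked iff it is degenerate or comes from a
marked cube of the diagram. -/
noncomputable def colimitCocone : Cocone F where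
  pt := ofMarks (colimit (F ⋙ toCubical A)) (fun c =>
    {y | ∃ (j : J) (x : (F.obj j).cubes.obj (op c)), x ∈ (F.obj j).marked c ∧
      (colimit.ι (F ⋙ toCubical A) j).app (op c) x = y})
  ι :=
    { app j :=
        { map := colimit.ι (F ⋙ toCubical A) j
          marked {c x} hx := Or.inr ⟨(F.obj j).pos hx, j, x, hx, rfl⟩ }
      naturality j j' f := by
        ext1
        exact (colimit.w (F ⋙ toCubical A) f).trans (Category.comp_id _).symm }

/-- The colimit cocone is a colimit. -/
noncomputable def colimitCoconeIsColimit : IsColimit (colimitCocone F) where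
  desc s :=
    { map := colimit.desc (F ⋙ toCubical A) ((toCubical A).mapCocone s)
      marked {c y} hy := by
        rcases hy with hy | ⟨-, j, x, hx, rfl⟩
        · exact s.pt.degenerate (hy.app _)
        · have key := (s.ι.app j).marked hx
          have e : (s.ι.app j).map = colimit.ι (F ⋙ toCubical A) j ≫
              colimit.desc (F ⋙ toCubical A) ((toCubical A).mapCocone s) :=
            (colimit.ι_desc ((toCubical A).mapCocone s) j).symm
          rw [e] at key
          exact key }
  fac s j := by
    ext1
    exact colimit.ι_desc ((toCubical A).mapCocone s) j
  uniq s m hm := by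
    ext1
    refine colimit.hom_ext fun j => ?_
    exact (congrArg Hom.map (hm j)).trans (colimit.ι_desc ((toCubical A).mapCocone s) j).symm

instance : HasColimitsOfSize.{0, 0} (MarkedCubicalSet A) where
  has_colimits_of_shape _ _ := { has_colimit F := ⟨⟨⟨_, colimitCoconeIsColimit F⟩⟩⟩ }

end Colimits

/-! ### The inclusion `□_∅^n ∪_{∂□_∅^n} i^* ∂□_A^n ↪ i^* □_A^n` -/

theorem incl_mem_faceUnion (h : A ⊆ B) (n : ℕ) (P : Fin n → Bool → Prop) {c : CubeCat A}
    {φ : c ⟶ ⟨n⟩} (hφ : φ ∈ (faceUnion A n P).obj (op c)) :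
    (CubeCat.incl h).map φ ∈ (faceUnion B n P).obj (op ((CubeCat.incl h).obj c)) := by
  cases n with
  | zero => exact hφ.elim
  | succ n =>
    obtain ⟨j, ε, ψ, hP, rfl⟩ := hφ
    exact ⟨j, ε, (CubeCat.incl h).map ψ, hP, rfl⟩

/-- The natural inclusion `□_A^n ↪ i^* □_B^n`. -/
def cubeToIStar (h : A ⊆ B) (n : ℕ) : stdCube A n ⟶ (iStar h).obj (stdCube B n) where
  map := { app c := ↾fun φ => (CubeCat.incl h).map φ }
  marked {c φ} hφ := by
    rcases hφ with hφ | hφ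
    · exact ((iStar h).obj (stdCube B n)).degenerate (hφ.app _)
    · exact hφ.2.elim

/-- Its restriction `∂□_A^n ↪ i^* ∂□_B^n` to the boundaries. -/
def boundaryToIStar (h : A ⊆ B) (n : ℕ) : boundary A n ⟶ (iStar h).obj (boundary B n) where
  map := { app c := ↾fun φ => ⟨(CubeCat.incl h).map φ.1, incl_mem_faceUnion h n _ φ.2⟩ }
  marked {c φ} hφ := (cubeToIStar h n).marked hφ

theorem boundaryToIStar_comp (h : A ⊆ B) (n : ℕ) :
    boundaryToIStar h n ≫ (iStar h).map (boundaryι B n) = boundaryι A n ≫ cubeToIStar h n :=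
  rfl

/-- The inclusion `□_A^n ∪_{∂□_A^n} i^* ∂□_B^n ↪ i^* □_B^n` of the pushout. -/
noncomputable def cornerInclusion (h : A ⊆ B) (n : ℕ) :
    pushout (boundaryι A n) (boundaryToIStar h n) ⟶ (iStar h).obj (stdCube B n) :=
  pushout.desc (cubeToIStar h n) ((iStar h).map (boundaryι B n)) (boundaryToIStar_comp h n).symm

end MarkedCubicalSet

open MarkedCubicalSet

/-!
Filter `i^* □_A^n` by the cubes which lie in the boundary or whose coordinates from the `K`-th on
are constants or projections. For `K = 0` this is the domain of the corner inclusion, and for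
`K = n` it is everything. The step from `k` to `k + 1` is a retract, along the face `∂_{k+1,ε}` and
the connection `γ_{k,ε}`, of an inclusion of subcomplexes of the `(n + 2)`-cube. That inclusion
is built by attaching cubes in order of dimension. Every missing cube `y` is the face
`∂_{p,ε}` of a unique missing cube `x` in which a variable has been inserted at position `p`, so the
two can be attached together along an open box; this box is comical because coordinates of maps of
`□_A` use their variables in increasing order. Where `y` becomes degenerate under the retraction, it
has to be marked, which takes a comical marking extension.

For the second part, `i^* i_! □_∅^n` and `i^* i_! ∂□_∅^n` are `i^* □_A^n` and `i^* ∂□_A^n`, so a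
weak connection structure on `x` with prescribed restriction and image is a lift against the corner
inclusion.
-/

/-- Vertices of the cube `[1]^n`. -/
abbrev Vertex (n : ℕ) := Fin n → Bool

/-! ### Essential variables -/

section Essential

variable {ι κ α β : Type*} [DecidableEq ι]

/-- The variable `s` is essential for `g` if the value of `g` depends on it. -/
def IsEssential (g : (ι → α) → β) (s : ι) : Prop :=
  ∃ v b, g (Function.update v s b) ≠ g v

theorem update_of_not_isEssential {g : (ι → α) → β} {s : ι} (h : ¬ IsEssential g s) (v : ι → α)
    (b : α) : g (Function.update v s b) = g v :=
  not_not.1 fun hne => h ⟨v, b, hne⟩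

theorem dependsOn_setOf_isEssential [Finite ι] (g : (ι → α) → β) :
    DependsOn g {s | IsEssential g s} := by
  intro v w h
  have := Fintype.ofFinite ι
  suffices key : ∀ F : Finset ι, g (F.piecewise v w) = g w by simpa using key Finset.univ
  intro F
  induction F using Finset.induction_on with
  | empty => simp
  | insert a F ha ih =>
    rw [Finset.piecewise_insert, ← ih]
    by_cases hg : IsEssential g a
    · rw [h a hg, ← Finset.piecewise_eq_of_notMem F v w ha, Function.update_eq_self]
    · exact update_of_not_isEssential hg _ _

theorem IsEssential.exists_of_comp [Finite κ] [DecidableEq κ] {γ : Type*} {f : (ι → α) → κ → γ}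
    {g : (κ → γ) → β} {s : ι} (h : IsEssential (fun x => g (f x)) s) :
    ∃ u, IsEssential g u ∧ IsEssential (fun x => f x u) s := by
  by_contra! hc
  obtain ⟨v, b, hv⟩ := h
  exact hv (dependsOn_setOf_isEssential g fun u hu => update_of_not_isEssential (hc u hu) v b)

theorem not_isEssential_of_const {g : (ι → α) → β} {b : β} (h : ∀ v, g v = b) (s : ι) :
    ¬ IsEssential g s := by
  rintro ⟨v, a, hv⟩
  exact hv (by rw [h, h])

theorem eq_of_forall_not_isEssential [Finite ι] {g : (ι → α) → β} (h : ∀ s, ¬ IsEssential g s)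
    (v w : ι → α) : g v = g w :=
  dependsOn_setOf_isEssential g fun s hs => (h s hs).elim

theorem IsEssential.exists_coord {φ : (ι → α) → κ → β} {s : ι} (h : IsEssential φ s) :
    ∃ j, IsEssential (fun v => φ v j) s := by
  by_contra! hc
  obtain ⟨v, b, hv⟩ := h
  exact hv (funext fun j => update_of_not_isEssential (hc j) v b)

theorem IsEssential.of_comp {γ : Type*} {f : (ι → α) → γ} {φ : γ → β} {s : ι}
    (h : IsEssential (fun v => φ (f v)) s) : IsEssential f s := by
  obtain ⟨v, b, hv⟩ := h
  exact ⟨v, b, fun e => hv (congrArg φ e)⟩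

theorem IsEssential.of_coord {φ : (ι → α) → κ → β} {s : ι} {j : κ}
    (h : IsEssential (fun v => φ v j) s) : IsEssential φ s :=
  h.of_comp (φ := fun w => w j)

variable [Nontrivial α]

theorem isEssential_proj {a s : ι} : IsEssential (fun x : ι → α => x a) s ↔ s = a := by
  constructor
  · rintro ⟨v, b, h⟩
    by_contra hne
    exact h (Function.update_of_ne (Ne.symm hne) _ _)
  · rintro rfl
    obtain ⟨a, b, hab⟩ := exists_pair_ne α
    exact ⟨fun _ => a, b, by simpa using hab.symm⟩

theorem not_injective_of_not_isEssential {g : (ι → α) → β} {s : ι} (h : ¬ IsEssential g s) :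
    ¬ Function.Injective g := by
  intro hg
  obtain ⟨a, b, hab⟩ := exists_pair_ne α
  refine hab (Eq.symm ?_)
  simpa using congrFun (hg (update_of_not_isEssential h (fun _ => a) b)) s

theorem isEssential_comp_reindex_iff [Finite κ] [DecidableEq κ] {ψ : (κ → α) → β}
    (hψ : ∀ u, IsEssential ψ u) {ρ : κ → ι} (hρ : Function.Injective ρ) {t : ι} :
    IsEssential (fun v => ψ fun j => v (ρ j)) t ↔ t ∈ Set.range ρ := by
  constructor
  · intro ht
    obtain ⟨u, -, hu⟩ := IsEssential.exists_of_comp (f := fun v j => v (ρ j)) ht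
    exact ⟨u, (isEssential_proj.1 hu).symm⟩
  · rintro ⟨u, rfl⟩
    obtain ⟨v, b, hv⟩ := hψ u
    obtain ⟨w, rfl⟩ := hρ.surjective_comp_right v
    exact ⟨w, b, by rwa [← Function.update_comp_eq_of_injective _ hρ] at hv⟩

theorem eq_of_comp_reindex_eq {d m : ℕ} {ψ : (Fin m → α) → β} (hψ : ∀ s, IsEssential ψ s)
    {σ τ : Fin m → Fin d} (hσ : StrictMono σ) (hτ : StrictMono τ)
    (h : ∀ v : Fin d → α, ψ (fun j => v (σ j)) = ψ (fun j => v (τ j))) : σ = τ := by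
  rw [← StrictMono.range_inj hσ hτ]
  ext t
  simp only [← isEssential_comp_reindex_iff hψ hσ.injective,
    ← isEssential_comp_reindex_iff hψ hτ.injective, h]

end Essential

theorem Vertex.not_injective {m n : ℕ} (h : n < m) (f : Vertex m → Vertex n) :
    ¬ Function.Injective f := fun hf =>
  (Nat.pow_lt_pow_right one_lt_two h).not_ge (by simpa using Fintype.card_le_of_injective f hf)

/-! ### Coordinates of the generating maps -/

section Generators

variable {n : ℕ}

@[simp] theorem cubeFace_same (i : Fin (n + 1)) (ε : Bool) (x : Vertex n) :
    cubeFace i ε x i = ε := by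
  simp [cubeFace]

@[simp] theorem cubeFace_succAbove (i : Fin (n + 1)) (ε : Bool) (x : Vertex n) (j : Fin n) :
    cubeFace i ε x (i.succAbove j) = x j := by
  simp [cubeFace]

theorem IsEssential.of_comp_cubeFace {β : Type*} {g : Vertex (n + 1) → β} {s : Fin (n + 1)}
    {ε : Bool} {t : Fin n} (h : IsEssential (fun v => g (cubeFace s ε v)) t) :
    IsEssential g (s.succAbove t) := by
  obtain ⟨u, hu, hu'⟩ := h.exists_of_comp
  rcases Fin.eq_self_or_eq_succAbove s u with rfl | ⟨u, rfl⟩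
  · exact (not_isEssential_of_const (cubeFace_same u ε) _ hu').elim
  · simp only [cubeFace_succAbove, isEssential_proj] at hu'
    rwa [hu']

@[simp] theorem cubeDegen_cubeFace (i : Fin (n + 1)) (ε : Bool) (x : Vertex n) :
    cubeDegen i (cubeFace i ε x) = x := by
  ext j; simp [cubeDegen]

theorem cubeFace_cubeDegen (i : Fin (n + 1)) (ε : Bool) (x : Vertex (n + 1)) :
    cubeFace i ε (cubeDegen i x) = Function.update x i ε := by
  ext j
  rcases Fin.eq_self_or_eq_succAbove i j with rfl | ⟨j, rfl⟩
  · simp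
  · simp [cubeDegen]

theorem cubeFace_cubeDegen_of_eq {i : Fin (n + 1)} {ε : Bool} {x : Vertex (n + 1)}
    (h : x i = ε) : cubeFace i ε (cubeDegen i x) = x := by
  rw [cubeFace_cubeDegen, ← h, Function.update_eq_self]

theorem apply_cubeFace_cubeDegen {β : Type*} {g : Vertex (n + 1) → β} {s : Fin (n + 1)}
    (h : ¬ IsEssential g s) (ε : Bool) (v : Vertex (n + 1)) :
    g (cubeFace s ε (cubeDegen s v)) = g v := by
  rw [cubeFace_cubeDegen, update_of_not_isEssential h]

/-- The binary operation of the connection `γ_{i,ε}`: minimum for `ε = 1`, maximum for `ε = 0`. -/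
def connOp (ε a b : Bool) : Bool := if ε then min a b else max a b

theorem connOp_comm (ε a b : Bool) : connOp ε a b = connOp ε b a := by
  cases ε <;> cases a <;> cases b <;> rfl

@[simp] theorem connOp_unit_right (ε a : Bool) : connOp ε a ε = a := by
  cases ε <;> cases a <;> rfl

@[simp] theorem connOp_unit_left (ε a : Bool) : connOp ε ε a = a := by
  rw [connOp_comm, connOp_unit_right]

@[simp] theorem connOp_not_right (ε a : Bool) : connOp ε a (!ε) = !ε := by
  cases ε <;> cases a <;> rfl

@[simp] theorem connOp_not_left (ε a : Bool) : connOp ε (!ε) a = !ε := by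
  rw [connOp_comm, connOp_not_right]

theorem connOp_mono (ε : Bool) {a b c d : Bool} (h : a ≤ c) (h' : b ≤ d) :
    connOp ε a b ≤ connOp ε c d := by
  revert a b c d ε; decide

variable {i j : Fin (n + 1)}

theorem cubeConn_same (i : Fin (n + 1)) (ε : Bool) (x : Vertex (n + 2)) :
    cubeConn i ε x i = connOp ε (x i.castSucc) (x i.succ) := by
  simp [cubeConn, connOp]

theorem cubeConn_lt (h : j < i) (ε : Bool) (x : Vertex (n + 2)) :
    cubeConn i ε x j = x j.castSucc := by
  simp [cubeConn, h]

theorem cubeConn_gt (h : i < j) (ε : Bool) (x : Vertex (n + 2)) :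
    cubeConn i ε x j = x j.succ := by
  simp [cubeConn, h.not_gt, h.ne']

theorem exists_cubeConn_apply_eq (h : j ≠ i) (ε : Bool) :
    ∃ a, a ≠ i.castSucc ∧ a ≠ i.succ ∧ ∀ x, cubeConn i ε x j = x a := by
  rcases lt_or_gt_of_ne h with h | h
  · have := Fin.castSucc_lt_castSucc_iff.2 h
    exact ⟨_, this.ne, (this.trans Fin.castSucc_lt_succ).ne, cubeConn_lt h ε⟩
  · have := Fin.succ_lt_succ_iff.2 h
    exact ⟨_, (Fin.castSucc_lt_succ.trans this).ne', this.ne', cubeConn_gt h ε⟩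

theorem cubeConn_congr {ε : Bool} {x y : Vertex (n + 2)}
    (h : ∀ a, a ≠ i.castSucc → a ≠ i.succ → x a = y a)
    (hi : connOp ε (x i.castSucc) (x i.succ) = connOp ε (y i.castSucc) (y i.succ)) :
    cubeConn i ε x = cubeConn i ε y := by
  ext j
  by_cases hj : j = i
  · rw [hj, cubeConn_same, cubeConn_same, hi]
  · obtain ⟨a, ha, ha', e⟩ := exists_cubeConn_apply_eq hj ε
    rw [e, e, h a ha ha']

@[simp] theorem cubeConn_cubeFace_castSucc (i : Fin (n + 1)) (ε : Bool) (x : Vertex (n + 1)) :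
    cubeConn i ε (cubeFace i.castSucc ε x) = x := by
  ext j
  rcases lt_trichotomy j i with h | rfl | h
  · rw [cubeConn_lt h, ← Fin.succAbove_castSucc_of_lt _ _ h, cubeFace_succAbove]
  · rw [cubeConn_same, cubeFace_same, connOp_unit_left, ← Fin.succAbove_castSucc_self,
      cubeFace_succAbove]
  · rw [cubeConn_gt h, ← Fin.succAbove_castSucc_of_le _ _ h.le, cubeFace_succAbove]

@[simp] theorem cubeConn_cubeFace_succ (i : Fin (n + 1)) (ε : Bool) (x : Vertex (n + 1)) :
    cubeConn i ε (cubeFace i.succ ε x) = x := by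
  ext j
  rcases lt_trichotomy j i with h | rfl | h
  · rw [cubeConn_lt h, ← Fin.succAbove_succ_of_le _ _ h.le, cubeFace_succAbove]
  · rw [cubeConn_same, cubeFace_same, connOp_unit_right, ← Fin.succAbove_succ_self,
      cubeFace_succAbove]
  · rw [cubeConn_gt h, ← Fin.succAbove_succ_of_lt _ _ h, cubeFace_succAbove]

theorem cubeFace_succ_cubeConn (i : Fin (n + 1)) (ε : Bool) (x : Vertex (n + 2)) :
    cubeFace i.succ ε (cubeConn i ε x) = Function.update
      (Function.update x i.castSucc (connOp ε (x i.castSucc) (x i.succ))) i.succ ε := by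
  ext u
  rcases Fin.eq_self_or_eq_succAbove i.succ u with rfl | ⟨u, rfl⟩
  · simp
  rw [cubeFace_succAbove, Function.update_of_ne (Fin.succAbove_ne _ _)]
  rcases lt_trichotomy u i with h | rfl | h
  · rw [cubeConn_lt h, Fin.succAbove_of_castSucc_lt _ _ (Fin.castSucc_lt_succ_iff.2 h.le),
      Function.update_of_ne (Fin.castSucc_injective _ |>.ne h.ne)]
  · rw [cubeConn_same, Fin.succAbove_succ_self, Function.update_self]
  · rw [cubeConn_gt h, Fin.succAbove_of_le_castSucc _ _ (Fin.succ_le_castSucc_iff.2 h),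
      Function.update_of_ne (Fin.castSucc_lt_succ_iff.2 h.le).ne']

theorem isEssential_cubeConn {ε : Bool} {s : Fin (n + 2)}
    (h : IsEssential (fun x => cubeConn i ε x j) s) :
    (j < i ∧ s = j.castSucc) ∨ (j = i ∧ (s = i.castSucc ∨ s = i.succ)) ∨ (i < j ∧ s = j.succ) := by
  rcases lt_trichotomy j i with hj | rfl | hj
  · simp only [cubeConn_lt hj, isEssential_proj] at h
    exact Or.inl ⟨hj, h⟩
  · refine Or.inr (Or.inl ⟨rfl, ?_⟩)
    by_contra! hc
    obtain ⟨v, b, hv⟩ := h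
    apply hv
    simp [cubeConn_same, Function.update_of_ne hc.1.symm, Function.update_of_ne hc.2.symm]
  · simp only [cubeConn_gt hj, isEssential_proj] at h
    exact Or.inr (Or.inr ⟨hj, h⟩)

end Generators

theorem IsCubeMap.monotone {A : Set Bool} {m n : ℕ} {φ : Vertex m → Vertex n}
    (h : IsCubeMap A φ) : Monotone φ := by
  induction h with
  | id n => exact monotone_id
  | face i ε =>
    intro v w h j
    rcases Fin.eq_self_or_eq_succAbove i j with rfl | ⟨j, rfl⟩
    · simp
    · simpa using h j
  | degen i => exact fun v w h j => h _
  | conn i ε _ =>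
    intro v w h j
    rcases lt_trichotomy j i with hj | rfl | hj
    · simpa only [cubeConn_lt hj] using h _
    · simpa only [cubeConn_same] using connOp_mono _ (h _) (h _)
    · simpa only [cubeConn_gt hj] using h _
  | comp _ _ h₁ h₂ => exact h₂.comp h₁

/-! ### The order of the variables -/

/-- The coordinates of `φ` use their essential variables in order: those of a coordinate all precede
those of any later coordinate. -/
def IsOrdered {m n : ℕ} (φ : Vertex m → Vertex n) : Prop :=
  ∀ ⦃j j' : Fin n⦄ ⦃s t : Fin m⦄, j < j' → IsEssential (fun v => φ v j) s →
    IsEssential (fun v => φ v j') t → s < t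

theorem IsOrdered.comp {k m n : ℕ} {f : Vertex k → Vertex m} {g : Vertex m → Vertex n}
    (hg : IsOrdered g) (hf : IsOrdered f) : IsOrdered fun x => g (f x) := by
  intro j j' s t hj hs ht
  obtain ⟨u, hu, hs⟩ := IsEssential.exists_of_comp (f := f) (g := fun y => g y j) hs
  obtain ⟨u', hu', ht⟩ := IsEssential.exists_of_comp (f := f) (g := fun y => g y j') ht
  exact hf (hg hj hu hu') hs ht

theorem isOrdered_reindex {m n : ℕ} {σ : Fin n → Fin m} :
    IsOrdered (fun (v : Vertex m) j => v (σ j)) ↔ StrictMono σ := by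
  simp only [IsOrdered, isEssential_proj]
  exact ⟨fun h j j' hj => h hj rfl rfl, by rintro h j j' _ _ hj rfl rfl; exact h hj⟩

theorem isOrdered_cubeFace {n : ℕ} (i : Fin (n + 1)) (ε : Bool) : IsOrdered (cubeFace i ε) := by
  intro j j' s t hj hs ht
  rcases Fin.eq_self_or_eq_succAbove i j with rfl | ⟨j, rfl⟩
  · exact (not_isEssential_of_const (cubeFace_same j ε) _ hs).elim
  rcases Fin.eq_self_or_eq_succAbove i j' with rfl | ⟨j', rfl⟩
  · exact (not_isEssential_of_const (cubeFace_same j' ε) _ ht).elim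
  simp only [cubeFace_succAbove, isEssential_proj] at hs ht
  rw [hs, ht]
  exact (Fin.strictMono_succAbove i).lt_iff_lt.1 hj

theorem isOrdered_cubeConn {n : ℕ} (i : Fin (n + 1)) (ε : Bool) : IsOrdered (cubeConn i ε) := by
  intro j j' s t hj hs ht
  have hs := isEssential_cubeConn hs
  have ht := isEssential_cubeConn ht
  simp only [Fin.ext_iff, Fin.lt_def, Fin.val_castSucc, Fin.val_succ] at *
  omega

theorem IsCubeMap.isOrdered {A : Set Bool} {m n : ℕ} {φ : Vertex m → Vertex n}
    (h : IsCubeMap A φ) : IsOrdered φ := by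
  induction h with
  | id n => exact isOrdered_reindex.2 strictMono_id
  | face i ε => exact isOrdered_cubeFace i ε
  | degen i => exact isOrdered_reindex.2 (Fin.strictMono_succAbove i)
  | conn i ε _ => exact isOrdered_cubeConn i ε
  | comp _ _ hf hg => exact hg.comp hf

theorem IsOrdered.eq_of_isEssential {m n : ℕ} {φ : Vertex m → Vertex n} (h : IsOrdered φ)
    {j j' : Fin n} {s : Fin m} (hs : IsEssential (fun v => φ v j) s)
    (hs' : IsEssential (fun v => φ v j') s) : j = j' := by
  rcases lt_trichotomy j j' with hj | hj | hj
  · exact (lt_irrefl _ (h hj hs hs')).elim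
  · exact hj
  · exact (lt_irrefl _ (h hj hs' hs)).elim

theorem IsOrdered.apply_cubeFace_cubeDegen_of_ne {m n : ℕ} {φ : Vertex (m + 1) → Vertex n}
    (hφ : IsOrdered φ) {c j : Fin n} {p : Fin (m + 1)} (hc : ∀ v, φ v c = v p) (hj : j ≠ c)
    (b : Bool) (v : Vertex (m + 1)) : φ (cubeFace p b (cubeDegen p v)) j = φ v j :=
  apply_cubeFace_cubeDegen (g := fun v => φ v j)
    (fun h => hj (hφ.eq_of_isEssential h (by simp only [hc, isEssential_proj]))) b v

theorem IsOrdered.isEssential_of_comp {m n : ℕ} {β : Type*} {f : Vertex m → Vertex n}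
    (hf : IsOrdered f) {g : Vertex n → β} {s : Fin m} {t : Fin n} (ht : ∀ v, f v t = v s)
    (h : IsEssential (fun v => g (f v)) s) : IsEssential g t := by
  obtain ⟨u, hu, hu'⟩ := h.exists_of_comp
  have hts : IsEssential (fun v => f v t) s := by simp only [ht, isEssential_proj]
  rwa [hf.eq_of_isEssential hts hu']

theorem castSucc_covBy_succ {n : ℕ} (i : Fin n) : i.castSucc ⋖ i.succ :=
  ⟨Fin.castSucc_lt_succ, fun _ h h' => h'.not_ge (Fin.castSucc_lt_iff_succ_le.1 h)⟩

theorem IsOrdered.isEssential_of_lt_of_lt {m n : ℕ} {f : Vertex m → Vertex n} (hf : IsOrdered f)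
    {i j : Fin n} (hij : i ⋖ j) {s t u : Fin m} (hs : IsEssential (fun v => f v i) s)
    (ht : ∀ v, f v j = v t) (hu : IsEssential f u) (hsu : s < u) (hut : u < t) :
    IsEssential (fun v => f v i) u := by
  have et : IsEssential (fun v => f v j) t := by simp only [ht, isEssential_proj]
  obtain ⟨l, hl⟩ := hu.exists_coord
  rcases lt_trichotomy l i with h | rfl | h
  · exact (lt_asymm hsu (hf h hl hs)).elim
  · exact hl
  rcases lt_trichotomy l j with h' | rfl | h'
  · exact (hij.2 h h').elim
  · simp only [ht, isEssential_proj] at hl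
    exact (hut.ne hl).elim
  · exact (lt_asymm hut (hf h' et hl)).elim

theorem IsOrdered.covBy {m n : ℕ} {f : Vertex m → Vertex n} (hf : IsOrdered f)
    (hess : ∀ s, IsEssential f s) {i j : Fin n} (hij : i ⋖ j) {s t : Fin m}
    (hs : ∀ v, f v i = v s) (ht : ∀ v, f v j = v t) : s ⋖ t := by
  have es : IsEssential (fun v => f v i) s := by simp only [hs, isEssential_proj]
  refine ⟨hf hij.lt es (by simp only [ht, isEssential_proj]), fun u hsu hut => hsu.ne' ?_⟩
  simpa only [hs, isEssential_proj] using
    hf.isEssential_of_lt_of_lt hij es ht (hess u) hsu hut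

theorem IsOrdered.exists_eq_castSucc_succ {m n : ℕ} {f : Vertex (m + 1) → Vertex (n + 1)}
    (hf : IsOrdered f) (hess : ∀ s, IsEssential f s) {i : Fin n} {s t : Fin (m + 1)}
    (hs : ∀ v, f v i.castSucc = v s) (ht : ∀ v, f v i.succ = v t) :
    ∃ r : Fin m, s = r.castSucc ∧ t = r.succ := by
  have h := hf.covBy hess (castSucc_covBy_succ i) hs ht
  obtain ⟨r, rfl⟩ := Fin.exists_castSucc_eq.2 (h.lt.trans_le (Fin.le_last t)).ne
  exact ⟨r, rfl, h.unique_right (castSucc_covBy_succ r)⟩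

/-! ### Cube maps without connections -/

/-- A Boolean function is elementary if it is a constant or a coordinate projection. The maps of
`□_∅` are those with ordered elementary coordinates. -/
def IsElementary {ι : Type*} (g : (ι → Bool) → Bool) : Prop :=
  (∃ b, ∀ v, g v = b) ∨ ∃ s, ∀ v, g v = v s

theorem IsElementary.comp {ι κ : Type*} {f : (ι → Bool) → κ → Bool} {g : (κ → Bool) → Bool}
    (hg : IsElementary g) (hf : ∀ j, IsElementary fun x => f x j) :
    IsElementary fun x => g (f x) := by
  rcases hg with ⟨b, hb⟩ | ⟨s, hs⟩
  · exact Or.inl ⟨b, fun v => hb _⟩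
  · simpa only [hs] using hf s

theorem IsElementary.eq_proj {ι : Type*} [DecidableEq ι] {g : (ι → Bool) → Bool}
    (h : IsElementary g) {s : ι} (hs : IsEssential g s) (v : ι → Bool) : g v = v s := by
  rcases h with ⟨b, hb⟩ | ⟨t, ht⟩
  · exact (not_isEssential_of_const hb s hs).elim
  · obtain rfl : g = fun v => v t := funext ht
    rw [isEssential_proj.1 hs]

theorem IsElementary.connOp_const {ι : Type*} {g : (ι → Bool) → Bool} (hg : IsElementary g)
    (ε b : Bool) : IsElementary fun v => connOp ε b (g v) := by
  rcases Bool.eq_or_eq_not b ε with rfl | rfl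
  · simpa only [connOp_unit_left] using hg
  · exact Or.inl ⟨!ε, fun _ => connOp_not_left _ _⟩

theorem isElementary_of_monotone {m : ℕ} {g : Vertex m → Bool} (hg : Monotone g) (s : Fin m)
    (h : ∀ t, IsEssential g t → t = s) : IsElementary g := by
  have e : ∀ v, g v = g fun _ => v s := fun v =>
    dependsOn_setOf_isEssential g fun t ht => by rw [h t ht]
  have hle : g (fun _ => false) ≤ g (fun _ => true) := hg fun _ => Bool.false_le _
  rcases h0 : g (fun _ => false) with _ | _ <;> rcases h1 : g (fun _ => true) with _ | _
  · exact Or.inl ⟨false, fun v => by rw [e]; cases v s <;> assumption⟩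
  · exact Or.inr ⟨s, fun v => by rw [e]; cases v s <;> assumption⟩
  · rw [h0, h1] at hle
    exact absurd hle (by decide)
  · exact Or.inl ⟨true, fun v => by rw [e]; cases v s <;> assumption⟩

theorem IsCubeMap.isElementary {m n : ℕ} {φ : Vertex m → Vertex n}
    (h : IsCubeMap ∅ φ) : ∀ j, IsElementary fun v => φ v j := by
  induction h with
  | id n => exact fun j => Or.inr ⟨j, fun _ => rfl⟩
  | face i ε =>
    intro j
    rcases Fin.eq_self_or_eq_succAbove i j with rfl | ⟨j, rfl⟩
    · exact Or.inl ⟨ε, by simp⟩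
    · exact Or.inr ⟨j, by simp⟩
  | degen i => exact fun j => Or.inr ⟨i.succAbove j, fun _ => rfl⟩
  | conn i ε hε => exact hε.elim
  | comp _ _ h₁ h₂ => exact fun j => (h₂ j).comp h₁

theorem isCubeMap_reindex {A : Set Bool} {m n : ℕ} {σ : Fin n → Fin m} (hσ : StrictMono σ) :
    IsCubeMap A fun (v : Vertex m) j => v (σ j) := by
  induction m generalizing n with
  | zero =>
    obtain rfl : n = 0 := by simpa using Fintype.card_le_of_injective σ hσ.injective
    obtain rfl := hσ.eq_id
    exact .id 0
  | succ m ih =>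
    by_cases hs : Function.Surjective σ
    · obtain rfl : n = m + 1 := by
        simpa using Fintype.card_congr (Equiv.ofBijective σ ⟨hσ.injective, hs⟩)
      obtain rfl := hσ.eq_id
      exact .id _
    · obtain ⟨s, hs⟩ := not_forall.1 hs
      choose τ hτ using fun j => Fin.exists_succAbove_eq fun h : σ j = s => hs ⟨j, h⟩
      have hτ_mono : StrictMono τ := fun i j hij =>
        (Fin.strictMono_succAbove s).lt_iff_lt.1 (by simpa only [hτ] using hσ hij)
      simpa only [cubeDegen, hτ] using (IsCubeMap.degen s).comp (ih hτ_mono)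

theorem isCubeMap_of_isElementary {A : Set Bool} {m n : ℕ} {φ : Vertex m → Vertex n}
    (hφ : ∀ j, IsElementary fun v => φ v j) (ho : IsOrdered φ) : IsCubeMap A φ := by
  by_cases hc : ∃ j b, ∀ v, φ v j = b
  · obtain ⟨j, b, hj⟩ := hc
    cases n with
    | zero => exact j.elim0
    | succ n =>
      have h : IsCubeMap A fun v => cubeDegen j (φ v) :=
        isCubeMap_of_isElementary (fun i => hφ (j.succAbove i))
          ((isOrdered_reindex.2 (Fin.strictMono_succAbove j)).comp ho)
      simpa only [cubeFace_cubeDegen_of_eq (hj _)] using h.comp (.face j b)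
  · choose σ hσ using fun j => (hφ j).resolve_left (not_exists.1 hc j)
    obtain rfl : φ = fun v j => v (σ j) := funext fun v => funext fun j => hσ j v
    exact isCubeMap_reindex (isOrdered_reindex.1 ho)

/-! ### Degenerate cube maps -/

/-- The maps of `□_A` which factor through a degeneracy or a connection, i.e. the degenerate cubes
of the representable cubical sets. -/
inductive IsDegenerateMap (A : Set Bool) : ∀ {m n : ℕ}, (Vertex m → Vertex n) → Prop
  | degen {m n : ℕ} (i : Fin (m + 1)) (ψ : Vertex m → Vertex n) (hψ : IsCubeMap A ψ) :
      IsDegenerateMap A fun x => ψ (cubeDegen i x)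
  | conn {m n : ℕ} (i : Fin (m + 1)) (ε : Bool) (hε : ε ∈ A)
      (ψ : Vertex (m + 1) → Vertex n) (hψ : IsCubeMap A ψ) :
      IsDegenerateMap A fun x => ψ (cubeConn i ε x)

section Degenerate

variable {A : Set Bool} {m n : ℕ}

theorem IsDegenerateMap.comp {k : ℕ} {f : Vertex k → Vertex m} {g : Vertex m → Vertex n}
    (hf : IsDegenerateMap A f) (hg : IsCubeMap A g) : IsDegenerateMap A fun x => g (f x) := by
  cases hf with
  | degen i ψ hψ => exact .degen i _ (hψ.comp hg)
  | conn i ε hε ψ hψ => exact .conn i ε hε _ (hψ.comp hg)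

theorem IsDegenerateMap.not_injective {φ : Vertex m → Vertex n} (h : IsDegenerateMap A φ) :
    ¬ Function.Injective φ := by
  cases h with
  | degen i ψ _ =>
    exact fun h =>
      Vertex.not_injective (Nat.lt_succ_self _) _ (Function.Injective.of_comp (f := ψ) h)
  | conn i ε _ ψ _ =>
    exact fun h =>
      Vertex.not_injective (Nat.lt_succ_self _) _ (Function.Injective.of_comp (f := ψ) h)

theorem IsCubeMap.isDegenerateMap_of_not_isEssential {φ : Vertex m → Vertex n}
    (h : IsCubeMap A φ) {s : Fin m} (hs : ¬ IsEssential φ s) : IsDegenerateMap A φ := by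
  obtain _ | m := m
  · exact s.elim0
  · simpa only [apply_cubeFace_cubeDegen hs] using
      IsDegenerateMap.degen s _ ((IsCubeMap.face s false).comp h)

theorem cubeConn_comp_cubeConn {f : Vertex (m + 2) → Vertex (n + 2)} (hf : IsOrdered f)
    {i : Fin (n + 1)} {s : Fin (m + 1)} (hs : ∀ v, f v i.castSucc = v s.castSucc)
    (ht : ∀ v, f v i.succ = v s.succ) (ε : Bool) (v : Vertex (m + 2)) :
    cubeConn i ε (f (cubeFace s.succ ε (cubeConn s ε v))) = cubeConn i ε (f v) := by
  refine cubeConn_congr (fun a hai hai' => dependsOn_setOf_isEssential (fun v => f v a) ?_) ?_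
  · intro u hu
    have hus : u ≠ s.castSucc := by
      rintro rfl
      exact hai (hf.eq_of_isEssential hu (by simp only [hs, isEssential_proj]))
    have hut : u ≠ s.succ := by
      rintro rfl
      exact hai' (hf.eq_of_isEssential hu (by simp only [ht, isEssential_proj]))
    rw [cubeFace_succ_cubeConn, Function.update_of_ne hut, Function.update_of_ne hus]
  · simp [hs, ht, cubeFace_succ_cubeConn, Fin.castSucc_lt_succ.ne]

theorem isDegenerateMap_cubeConn_comp {f : Vertex m → Vertex (n + 2)} (hf : IsCubeMap A f)
    (i : Fin (n + 1)) {ε : Bool} (hε : ε ∈ A) (hess : ∀ s, IsEssential f s) {s t : Fin m}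
    (hs : ∀ v, f v i.castSucc = v s) (ht : ∀ v, f v i.succ = v t) :
    IsDegenerateMap A fun v => cubeConn i ε (f v) := by
  obtain _ | m := m
  · exact s.elim0
  obtain ⟨s, rfl, rfl⟩ := hf.isOrdered.exists_eq_castSucc_succ hess hs ht
  obtain _ | m := m
  · exact s.elim0
  simpa only [cubeConn_comp_cubeConn hf.isOrdered hs ht] using
    IsDegenerateMap.conn s ε hε _ (((IsCubeMap.face s.succ ε).comp hf).comp (.conn i ε hε))

theorem isElementary_or_isDegenerateMap_cubeConn_comp {f : Vertex m → Vertex (n + 2)}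
    (hf : IsCubeMap A f) (h : ∀ j, IsElementary fun v => f v j) (i : Fin (n + 1)) {ε : Bool}
    (hε : ε ∈ A) : (∀ j, IsElementary fun v => cubeConn i ε (f v) j) ∨
      IsDegenerateMap A fun v => cubeConn i ε (f v) := by
  by_cases hess : ∀ s, IsEssential f s
  swap
  · obtain ⟨s, hs⟩ := not_forall.1 hess
    exact Or.inr ((hf.isDegenerateMap_of_not_isEssential hs).comp (.conn i ε hε))
  have elementary_of_connOp : (IsElementary fun v => connOp ε (f v i.castSucc) (f v i.succ)) →
      ∀ j, IsElementary fun v => cubeConn i ε (f v) j := by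
    intro hi j
    rcases lt_trichotomy j i with hj | rfl | hj
    · simpa only [cubeConn_lt hj] using h _
    · simpa only [cubeConn_same] using hi
    · simpa only [cubeConn_gt hj] using h _
  rcases h i.castSucc with ⟨b, hb⟩ | ⟨s, hs⟩
  · exact Or.inl (elementary_of_connOp (by simpa only [hb] using (h i.succ).connOp_const ε b))
  rcases h i.succ with ⟨b, hb⟩ | ⟨t, ht⟩
  · exact Or.inl (elementary_of_connOp
      (by simpa only [hb, connOp_comm] using (h i.castSucc).connOp_const ε b))
  · exact Or.inr (isDegenerateMap_cubeConn_comp hf i hε hess hs ht)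

theorem isElementary_or_isDegenerateMap_comp {g : Vertex m → Vertex n} (hg : IsCubeMap A g) :
    ∀ {k : ℕ} {f : Vertex k → Vertex m}, IsCubeMap A f →
      ((∀ j, IsElementary fun v => f v j) ∨ IsDegenerateMap A f) →
      ((∀ j, IsElementary fun v => g (f v) j) ∨ IsDegenerateMap A fun v => g (f v)) := by
  induction hg with
  | id n => exact fun _ h => h
  | face i ε =>
    rintro k f - (h | h)
    · exact Or.inl fun j => ((IsCubeMap.face i ε).isElementary j).comp h
    · exact Or.inr (h.comp (.face i ε))
  | degen i =>
    rintro k f - (h | h)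
    · exact Or.inl fun j => ((IsCubeMap.degen i).isElementary j).comp h
    · exact Or.inr (h.comp (.degen i))
  | comp hg₁ _ h₁ h₂ => exact fun hf h => h₂ (hf.comp hg₁) (h₁ hf h)
  | conn i ε hε =>
    rintro k f hf (h | h)
    · exact isElementary_or_isDegenerateMap_cubeConn_comp hf h i hε
    · exact Or.inr (h.comp (.conn i ε hε))

theorem IsCubeMap.isDegenerateMap_iff {φ : Vertex m → Vertex n} (h : IsCubeMap A φ) :
    IsDegenerateMap A φ ↔ ¬ Function.Injective φ := by
  refine ⟨fun h => h.not_injective, fun hi => ?_⟩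
  rcases isElementary_or_isDegenerateMap_comp h (.id m)
    (Or.inl fun j => Or.inr ⟨j, fun _ => rfl⟩) with he | hd
  · by_contra hd
    refine hi fun v w hvw => funext fun s => ?_
    have hs : IsEssential φ s := by
      by_contra hs
      exact hd (h.isDegenerateMap_of_not_isEssential hs)
    obtain ⟨j, hj⟩ := hs.exists_coord
    rw [← (he j).eq_proj hj v, ← (he j).eq_proj hj w, hvw]
  · exact hd

end Degenerate

/-! ### Insertion of a new variable -/

theorem exists_insert_cubeConn {A : Set Bool} {n : ℕ} (i : Fin (n + 1)) {ε : Bool} (hε : ε ∈ A)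
    (c : Fin (n + 2)) : ∃ (p : Fin (n + 3)) (x : Vertex (n + 3) → Vertex (n + 2)),
      IsCubeMap A x ∧ (∀ v, x v c = v p) ∧
        ∀ v, cubeDegen c (x v) = cubeConn i ε (cubeDegen p v) := by
  rcases le_or_gt c i.castSucc with hc | hc
  · refine ⟨c.castSucc, _, .conn i.succ ε hε,
      cubeConn_lt (hc.trans_lt Fin.castSucc_lt_succ) ε, fun v => ?_⟩
    ext j
    simp only [cubeDegen, cubeConn, Fin.succAbove, Fin.lt_def, Fin.ext_iff, Fin.le_def,
      Fin.val_castSucc, Fin.val_succ] at *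
    split_ifs <;> first | (exfalso; simp only [Fin.val_castSucc, Fin.val_succ] at *; omega) | rfl
  · refine ⟨c.succ, _, .conn i.castSucc ε hε, cubeConn_gt hc ε, fun v => ?_⟩
    ext j
    simp only [cubeDegen, cubeConn, Fin.succAbove, Fin.lt_def, Fin.ext_iff,
      Fin.val_castSucc, Fin.val_succ] at *
    split_ifs <;> first | (exfalso; simp only [Fin.val_castSucc, Fin.val_succ] at *; omega) | rfl

theorem IsCubeMap.exists_insert {A : Set Bool} {m n : ℕ} {φ : Vertex m → Vertex n}
    (h : IsCubeMap A φ) : ∀ c : Fin (n + 1), ∃ (p : Fin (m + 1))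
      (x : Vertex (m + 1) → Vertex (n + 1)), IsCubeMap A x ∧ (∀ v, x v c = v p) ∧
        ∀ v, cubeDegen c (x v) = φ (cubeDegen p v) := by
  induction h with
  | id n => exact fun c => ⟨c, _, .id _, fun _ => rfl, fun _ => rfl⟩
  | face i ε =>
    intro c
    refine ⟨i.predAbove c, _, .face (c.succAbove i) ε, fun v => ?_, fun v => ?_⟩
    · simpa only [Fin.succAbove_succAbove_predAbove] using
        cubeFace_succAbove (c.succAbove i) ε v (i.predAbove c)
    · ext j
      rcases Fin.eq_self_or_eq_succAbove i j with rfl | ⟨j, rfl⟩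
      · simp [cubeDegen]
      · rw [cubeFace_succAbove, cubeDegen, ← Fin.succAbove_succAbove_succAbove_predAbove,
          cubeFace_succAbove, cubeDegen]
  | degen i =>
    intro c
    obtain ⟨p, rfl⟩ := Fin.predAbove_surjective i c
    refine ⟨p, _, .degen (p.succAbove i), fun v => ?_, fun v => ?_⟩
    · rw [cubeDegen, Fin.succAbove_succAbove_predAbove]
    · ext j
      simp only [cubeDegen, Fin.succAbove_succAbove_succAbove_predAbove]
  | conn i ε hε => exact exists_insert_cubeConn i hε
  | comp _ _ h₁ h₂ =>
    intro c
    obtain ⟨p', y, hy, hyc, hyd⟩ := h₂ c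
    obtain ⟨p, x, hx, hxc, hxd⟩ := h₁ p'
    exact ⟨p, _, hx.comp hy, fun v => by rw [hyc, hxc], fun v => by rw [hyd, hxd]⟩

section Uniqueness

variable {m n : ℕ} {x x' : Vertex (m + 1) → Vertex n} {c : Fin n} {p p' : Fin (m + 1)}

theorem not_lt_of_comp_cubeFace_eq (hx : IsOrdered x) (hx' : IsOrdered x')
    (hc : ∀ v, x v c = v p) (hc' : ∀ v, x' v c = v p') {b : Bool}
    (h : ∀ v, x (cubeFace p b v) = x' (cubeFace p' b v))
    (hy : ∀ s, IsEssential (fun v => x (cubeFace p b v)) s) : ¬ p < p' := by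
  intro hlt
  obtain ⟨p, rfl⟩ : ∃ s : Fin m, s.castSucc = p := ⟨p.castLT (by omega), rfl⟩
  obtain ⟨j, hj⟩ := (hy p).exists_coord
  have h1 : IsEssential (fun v => x v j) p.succ := by
    rw [← Fin.succAbove_castSucc_self p]
    exact IsEssential.of_comp_cubeFace hj
  have h2 : IsEssential (fun v => x' v j) p.castSucc := by
    rw [← Fin.succAbove_of_castSucc_lt _ _ hlt]
    simp only [h] at hj
    exact IsEssential.of_comp_cubeFace hj
  rcases lt_trichotomy j c with hjc | rfl | hjc
  · exact lt_asymm Fin.castSucc_lt_succ (hx hjc h1 (by simp only [hc, isEssential_proj]))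
  · simp only [hc', isEssential_proj] at h2
    exact hlt.ne h2
  · exact lt_asymm hlt (hx' hjc (by simp only [hc', isEssential_proj]) h2)

theorem eq_of_comp_cubeFace_eq (hx : IsOrdered x) (hx' : IsOrdered x')
    (hc : ∀ v, x v c = v p) (hc' : ∀ v, x' v c = v p') {b : Bool}
    (h : ∀ v, x (cubeFace p b v) = x' (cubeFace p' b v))
    (hy : ∀ s, IsEssential (fun v => x (cubeFace p b v)) s) : x = x' := by
  obtain rfl : p = p' := le_antisymm
    (not_lt.1 (not_lt_of_comp_cubeFace_eq hx' hx hc' hc (fun v => (h v).symm)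
      (by simpa only [h] using hy)))
    (not_lt.1 (not_lt_of_comp_cubeFace_eq hx hx' hc hc' h hy))
  ext v j
  by_cases hj : j = c
  · rw [hj, hc, hc']
  · rw [← hx.apply_cubeFace_cubeDegen_of_ne hc hj b, h,
      hx'.apply_cubeFace_cubeDegen_of_ne hc' hj]

end Uniqueness

theorem eq_of_monotone_of_const {m : ℕ} {g : Vertex m → Bool} (hg : Monotone g) (b : Bool)
    {v : Vertex m} (hv : g v = b) : g (fun _ => b) = b := by
  cases b
  · exact Bool.eq_false_of_le_false ((hg fun _ => Bool.false_le _).trans hv.le)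
  · exact Bool.eq_true_of_true_le (hv.ge.trans (hg fun _ => Bool.le_true _))

/-! ### Cube maps using all their variables -/

theorem IsCubeMap.exists_isEssential_factorization {A : Set Bool} {m n : ℕ}
    {ψ : Vertex m → Vertex n} (h : IsCubeMap A ψ) :
    ∃ (d : ℕ) (f : Vertex m → Vertex d) (g : Vertex d → Vertex m),
      IsCubeMap ∅ f ∧ IsCubeMap ∅ g ∧ (∀ s, IsEssential (fun v => ψ (g v)) s) ∧
        ∀ v, ψ (g (f v)) = ψ v := by
  induction m with
  | zero => exact ⟨0, _, _, .id _, .id _, fun s => s.elim0, fun _ => rfl⟩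
  | succ m ih =>
    by_cases hs : ∀ s, IsEssential ψ s
    · exact ⟨_, _, _, .id _, .id _, hs, fun _ => rfl⟩
    obtain ⟨s, hs⟩ := not_forall.1 hs
    obtain ⟨d, f, g, hf, hg, he, hc⟩ := ih ((IsCubeMap.face s false).comp h)
    refine ⟨d, _, _, (IsCubeMap.degen s).comp hf, hg.comp (.face s false), he, fun v => ?_⟩
    rw [hc, apply_cubeFace_cubeDegen hs]

section AllEssential

variable {m n : ℕ}

theorem strictMono_of_proj {g : Vertex m → Vertex n} (h : IsOrdered g) {σ : Fin n → Fin m}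
    (hσ : ∀ v j, g v j = v (σ j)) : StrictMono σ := by
  obtain rfl : g = fun v j => v (σ j) := funext fun v => funext (hσ v)
  exact isOrdered_reindex.1 h

theorem IsCubeMap.le_of_isEssential {g : Vertex m → Vertex n} (h : IsCubeMap ∅ g)
    (hs : ∀ s, IsEssential g s) : m ≤ n := by
  choose τ hτ using fun s => (hs s).exists_coord
  have hinj : Function.Injective τ := fun s t hst => by
    have e : IsEssential (fun v => g v (τ s)) t := hst ▸ hτ t
    rw [funext ((h.isElementary _).eq_proj (hτ s))] at e
    exact (isEssential_proj.1 e).symm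
  simpa using Fintype.card_le_of_injective τ hinj

theorem isEssential_cubeDegen_comp {g : Vertex m → Vertex (n + 1)} {j : Fin (n + 1)} {b : Bool}
    (hb : ∀ v, g v j = b) {s : Fin m} (hs : IsEssential g s) :
    IsEssential (fun v => cubeDegen j (g v)) s := by
  obtain ⟨i, hi⟩ := hs.exists_coord
  have hij : i ≠ j := by
    rintro rfl
    exact not_isEssential_of_const hb s hi
  obtain ⟨i, rfl⟩ := Fin.exists_succAbove_eq hij
  exact IsEssential.of_coord (j := i) hi

theorem IsCubeMap.eq_id_of_isEssential {g : Vertex m → Vertex m} (h : IsCubeMap ∅ g)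
    (hs : ∀ s, IsEssential g s) : g = fun v => v := by
  have hc : ∀ j, ∃ s, ∀ v, g v j = v s := fun j => (h.isElementary j).resolve_left fun ⟨b, hb⟩ => by
    obtain _ | m := m
    · exact j.elim0
    · have := (h.comp (.degen j)).le_of_isEssential fun s => isEssential_cubeDegen_comp hb (hs s)
      omega
  choose σ hσ using hc
  obtain rfl := (strictMono_of_proj h.isOrdered fun v j => hσ j v).eq_id
  exact funext fun v => funext fun j => hσ j v

theorem IsCubeMap.exists_section {f : Vertex m → Vertex n} (hf : IsCubeMap ∅ f)
    (hsurj : Function.Surjective f) : ∃ g, IsCubeMap ∅ g ∧ ∀ v, f (g v) = v := by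
  obtain ⟨d, r, g, -, hg, hs, e⟩ := hf.exists_isEssential_factorization
  obtain rfl : d = n := by
    refine le_antisymm ((hg.comp hf).le_of_isEssential hs) (not_lt.1 fun hlt => ?_)
    refine Vertex.not_injective hlt (fun v => r (Function.surjInv hsurj v)) fun v w h => ?_
    simpa only [e, Function.surjInv_eq] using congrArg (fun u => f (g u)) h
  exact ⟨g, hg, congrFun ((hg.comp hf).eq_id_of_isEssential hs)⟩

theorem IsCubeMap.exists_eq_cubeFace {g : Vertex m → Vertex (m + 1)} (h : IsCubeMap ∅ g)
    (hs : ∀ s, IsEssential g s) : ∃ i ε, g = cubeFace i ε := by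
  obtain ⟨j, b, hb⟩ : ∃ j b, ∀ v, g v j = b := by
    by_contra hc
    choose σ hσ using fun j => (h.isElementary j).resolve_left (not_exists.1 hc j)
    have := Fintype.card_le_of_injective σ
      (strictMono_of_proj h.isOrdered fun v j => hσ j v).injective
    simp at this
  have e := (h.comp (.degen j)).eq_id_of_isEssential fun s => isEssential_cubeDegen_comp hb (hs s)
  refine ⟨j, b, funext fun v => ?_⟩
  rw [← cubeFace_cubeDegen_of_eq (hb v)]
  exact congrArg _ (congrFun e v)

end AllEssential

/-! ### Pushouts and unions of regular subcomplexes -/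

namespace MarkedCubicalSet

variable {A : Set Bool}

theorem isPushout_of_isPushout_map {I P Q T : MarkedCubicalSet A} {t : I ⟶ P} {l : I ⟶ Q}
    {r : P ⟶ T} {b : Q ⟶ T} (h : IsPushout t.map l.map r.map b.map)
    (hmark : ∀ (c : CubeCat A) (x : T.cubes.obj (op c)), x ∈ T.marked c →
      T.cubes.IsDegenerate x ∨ (∃ y ∈ P.marked c, r.map.app (op c) y = x) ∨
        ∃ y ∈ Q.marked c, b.map.app (op c) y = x) :
    IsPushout t l r b where
  w := by ext1; exact h.w
  isColimit' := ⟨PushoutCocone.IsColimit.mk _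
    (fun s =>
      { map := h.desc s.inl.map s.inr.map (congrArg Hom.map s.condition)
        marked := by
          intro c x hx
          rcases hmark c x hx with hx | ⟨y, hy, rfl⟩ | ⟨y, hy, rfl⟩
          · exact s.pt.degenerate (hx.app _)
          · have := s.inl.marked hy
            rwa [← h.inl_desc s.inl.map s.inr.map (congrArg Hom.map s.condition)] at this
          · have := s.inr.marked hy
            rwa [← h.inr_desc s.inl.map s.inr.map (congrArg Hom.map s.condition)] at this })
    (fun s => by ext1; exact h.inl_desc _ _ _)
    (fun s => by ext1; exact h.inr_desc _ _ _)
    (fun s m h₁ h₂ => by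
      ext1
      exact h.hom_ext ((congrArg Hom.map h₁).trans (h.inl_desc _ _ _).symm)
        ((congrArg Hom.map h₂).trans (h.inr_desc _ _ _).symm))⟩

theorem isPushout_of_cover {I P Q T : MarkedCubicalSet A} {t : I ⟶ P} {l : I ⟶ Q}
    {r : P ⟶ T} {b : Q ⟶ T} (w : t ≫ r = l ≫ b)
    (hl : ∀ c, Function.Injective (l.map.app (op c)))
    (hr : ∀ c, Function.Injective (r.map.app (op c)))
    (hcov : ∀ c (x : T.cubes.obj (op c)),
      (∃ y, r.map.app (op c) y = x) ∨ ∃ y, b.map.app (op c) y = x)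
    (hpb : ∀ c y z, r.map.app (op c) y = b.map.app (op c) z → ∃ i, l.map.app (op c) i = z)
    (hinj : ∀ c y z, (¬ ∃ i, l.map.app (op c) i = y) → (¬ ∃ i, l.map.app (op c) i = z) →
      b.map.app (op c) y = b.map.app (op c) z → y = z)
    (hmark : ∀ (c : CubeCat A) (x : T.cubes.obj (op c)), x ∈ T.marked c →
      T.cubes.IsDegenerate x ∨ (∃ y ∈ P.marked c, r.map.app (op c) y = x) ∨
        ∃ y ∈ Q.marked c, b.map.app (op c) y = x) :
    IsPushout t l r b := by
  refine isPushout_of_isPushout_map (IsPushout.of_forall_isPushout_app fun c => ?_) hmark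
  have hw : ∀ i, r.map.app c (t.map.app c i) = b.map.app c (l.map.app c i) := fun i =>
    ConcreteCategory.congr_hom (congrArg (fun f : I ⟶ T => f.map.app c) w) i
  have : Mono (r.map.app c) := (mono_iff_injective _).2 (hr c.unop)
  refine Types.isPushout_of_isPullback_of_mono' ((Types.isPullback_iff _ _ _ _).2
    ⟨congrArg (fun f : I ⟶ T => f.map.app c) w, fun i j h => hl c.unop h.2, fun y z h => ?_⟩)
    ?_ (hinj c.unop)
  · obtain ⟨i, hi⟩ := hpb c.unop y z h
    refine ⟨i, hr c.unop ?_, hi⟩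
    rw [h, ← hi]
    exact hw i
  · ext x
    simpa using hcov c.unop x

/-- The inclusion of one regular subcomplex into another. -/
def regularHomOfLE (X : MarkedCubicalSet A) {S T : Subfunctor X.cubes} (h : S ≤ T) :
    X.regular S ⟶ X.regular T where
  map := Subfunctor.homOfLe h
  marked hx := hx

theorem isIso_of_isIso_map {X Y : MarkedCubicalSet A} (f : X ⟶ Y) [IsIso f.map]
    (h : ∀ (c : CubeCat A) (x : X.cubes.obj (op c)),
      f.map.app (op c) x ∈ Y.marked c → x ∈ X.marked c) : IsIso f := by
  refine ⟨⟨{ map := inv f.map, marked := fun {c y} hy => h c _ ?_ }, ?_, ?_⟩⟩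
  · have e : f.map.app (op c) ((inv f.map).app (op c) y) = y :=
      ConcreteCategory.congr_hom (congr_app (IsIso.inv_hom_id f.map) (op c)) y
    rwa [e]
  · ext1; exact IsIso.hom_inv_id f.map
  · ext1; exact IsIso.inv_hom_id f.map

section Chain

variable (X : MarkedCubicalSet A)

/-- The regular subcomplexes of `X` as a functor on the poset of subcomplexes. -/
def regularFunctor : Subfunctor X.cubes ⥤ MarkedCubicalSet A where
  obj S := X.regular S
  map f := X.regularHomOfLE (leOfHom f)

variable {X} {F : ℕ → Subfunctor X.cubes} (hF : Monotone F) {T : Subfunctor X.cubes}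
  (hT : T = ⨆ i, F i)

include hT in
theorem exists_mem_of_eq_iSup {c : (CubeCat A)ᵒᵖ} (x : T.toFunctor.obj c) :
    ∃ i, x.1 ∈ (F i).obj c := by
  have := hT.le c x.2
  rwa [Subfunctor.iSup_obj, Set.mem_iUnion] at this

/-- The cocone on an increasing sequence of regular subcomplexes given by their union. -/
def chainCocone : Cocone (hF.functor ⋙ X.regularFunctor) where
  pt := X.regular T
  ι :=
    { app i := X.regularHomOfLE (hT ▸ le_iSup F i)
      naturality _ _ _ := rfl }

theorem chainCocone_app_eq (s : Cocone (hF.functor ⋙ X.regularFunctor)) {c : (CubeCat A)ᵒᵖ}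
    {i j : ℕ} {x : X.cubes.obj c} (hi : x ∈ (F i).obj c) (hj : x ∈ (F j).obj c) :
    (s.ι.app i).map.app c ⟨x, hi⟩ = (s.ι.app j).map.app c ⟨x, hj⟩ := by
  wlog h : i ≤ j
  · exact (this hF s hj hi (le_of_not_ge h)).symm
  rw [← s.w (homOfLE h)]
  rfl

/-- The union of an increasing sequence of regular subcomplexes is its colimit. -/
noncomputable def chainCoconeIsColimit : IsColimit (chainCocone hF hT) where
  desc s :=
    { map :=
        { app c := ↾fun x : T.toFunctor.obj c =>
            (s.ι.app (exists_mem_of_eq_iSup hT x).choose).map.app c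
              ⟨x.1, (exists_mem_of_eq_iSup hT x).choose_spec⟩
          naturality c d f := by
            ext x
            have hx := (exists_mem_of_eq_iSup hT x).choose_spec
            exact (chainCocone_app_eq hF s
                (exists_mem_of_eq_iSup hT (T.toFunctor.map f x)).choose_spec
                ((F _).map f hx)).trans
              (NatTrans.naturality_apply (s.ι.app _).map f ⟨x.1, hx⟩) }
      marked := by
        intro c x hx
        exact (s.ι.app (exists_mem_of_eq_iSup hT x).choose).marked
          (x := ⟨x.1, (exists_mem_of_eq_iSup hT x).choose_spec⟩) hx }
  fac s i := by
    ext1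
    ext c x
    exact chainCocone_app_eq hF s _ _
  uniq s m hm := by
    ext1
    ext c x
    have hx := (exists_mem_of_eq_iSup hT x).choose_spec
    exact ConcreteCategory.congr_hom
      (congrArg (fun f => Hom.map f) (hm (exists_mem_of_eq_iSup hT x).choose) ▸ rfl :
        ((chainCocone hF hT).ι.app _ ≫ m).map.app c = (s.ι.app _).map.app c)
      (⟨x.1, hx⟩ : (F _).toFunctor.obj c)

end Chain

theorem regularHomOfLE_iSup_mem {W : MorphismProperty (MarkedCubicalSet A)}
    [MorphismProperty.IsStableUnderTransfiniteComposition.{0} W] {X : MarkedCubicalSet A}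
    {F : ℕ → Subfunctor X.cubes} (hF : Monotone F) {T : Subfunctor X.cubes} (hT : T = ⨆ i, F i)
    (h : ∀ i, W (X.regularHomOfLE (hF (Nat.le_succ i)))) (h0 : F 0 ≤ T) :
    W (X.regularHomOfLE h0) := by
  exact W.transfiniteCompositionsOfShape_le ℕ _
    ⟨{ F := hF.functor ⋙ X.regularFunctor
       isoBot := Iso.refl _
       incl := (chainCocone hF hT).ι
       isColimit := chainCoconeIsColimit hF hT
       fac := by ext1; rfl
       map_mem i _ := h i }⟩

theorem mem_faceUnion_iff {n : ℕ} {P : Fin n → Bool → Prop} {c : CubeCat A}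
    {f : c ⟶ (⟨n⟩ : CubeCat A)} :
    f ∈ (faceUnion A n P).obj (op c) ↔ ∃ j ε, P j ε ∧ ∀ v, f.1 v j = ε := by
  obtain _ | n := n
  · exact ⟨False.elim, fun ⟨j, _⟩ => j.elim0⟩
  · constructor
    · rintro ⟨j, ε, ψ, hP, rfl⟩
      exact ⟨j, ε, hP, fun v => cubeFace_same _ _ _⟩
    · rintro ⟨j, ε, hP, h⟩
      exact ⟨j, ε, f ≫ CubeCat.degen j, hP,
        Subtype.ext (funext fun v => (cubeFace_cubeDegen_of_eq (h v)).symm)⟩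

end MarkedCubicalSet

/-! ### Attaching a comical cube along an open box -/

/-- The cube `f` of the `n`-cube belongs to the open box with missing face `∂_{p,b}`, i.e. it
factors through another face. -/
def IsInOpenBox {d n : ℕ} (p : Fin n) (b : Bool) (f : Vertex d → Vertex n) : Prop :=
  ∃ j ε, (j, ε) ≠ (p, b) ∧ ∀ v, f v j = ε

theorem IsCubeMap.exists_strictMono_of_not_isInOpenBox {d m : ℕ}
    {f : Vertex d → Vertex (m + 1)} (hf : IsCubeMap ∅ f) {p : Fin (m + 1)} {b : Bool}
    (h : ¬ IsInOpenBox p b f) :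
    (∃ σ : Fin (m + 1) → Fin d, StrictMono σ ∧ ∀ v, f v = fun j => v (σ j)) ∨
      ∃ σ : Fin m → Fin d, StrictMono σ ∧ ∀ v, f v = cubeFace p b fun j => v (σ j) := by
  have hne : ∀ j, j ≠ p → ∃ s, ∀ v, f v j = v s := fun j hj =>
    (hf.isElementary j).resolve_left fun ⟨ε, hε⟩ => h ⟨j, ε, fun e => hj (congrArg Prod.fst e), hε⟩
  rcases hf.isElementary p with ⟨ε, hε⟩ | hp
  · right
    obtain rfl : ε = b := by
      by_contra hb
      exact h ⟨p, ε, fun e => hb (congrArg Prod.snd e), hε⟩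
    choose σ hσ using fun j : Fin m => hne (p.succAbove j) (Fin.succAbove_ne p j)
    refine ⟨σ, strictMono_of_proj (hf.comp (.degen p)).isOrdered fun v j => hσ j v, fun v => ?_⟩
    rw [← cubeFace_cubeDegen_of_eq (hε v)]
    exact congrArg _ (funext fun j => hσ j v)
  · left
    choose σ hσ using fun j => (em (j = p)).elim (fun e => e ▸ hp) (hne j)
    exact ⟨σ, strictMono_of_proj hf.isOrdered fun v j => hσ j v, fun v => funext fun j => hσ j v⟩

theorem IsCubeMap.le_of_not_isInOpenBox {d m : ℕ} {f : Vertex d → Vertex (m + 1)}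
    (hf : IsCubeMap ∅ f) {p : Fin (m + 1)} {b : Bool} (h : ¬ IsInOpenBox p b f) : m ≤ d := by
  rcases hf.exists_strictMono_of_not_isInOpenBox h with ⟨σ, hσ, -⟩ | ⟨σ, hσ, -⟩
  · have := Fin.le_of_injective σ hσ.injective
    omega
  · exact Fin.le_of_injective σ hσ.injective

namespace MarkedCubicalSet

theorem isDegenerate_iff_isDegenerateMap {A : Set Bool} {c d : CubeCat A} (f : c ⟶ d) :
    CubicalSet.IsDegenerate (yoneda.obj d) (c := c) f ↔ IsDegenerateMap A f.1 := by
  constructor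
  · suffices ∀ f : (yoneda.obj d).obj (op c), CubicalSet.IsDegenerate (yoneda.obj d) f →
        IsDegenerateMap A (Subtype.val (p := IsCubeMap A) f) from this f
    intro f h
    cases h with
    | degen i y => exact .degen i y.1 y.2
    | conn i ε hε y => exact .conn i ε hε y.1 y.2
  · obtain ⟨m⟩ := c
    obtain ⟨n⟩ := d
    obtain ⟨f, hf⟩ := f
    intro h
    cases h with
    | degen i ψ hψ =>
      exact .degen (X := yoneda.obj (⟨n⟩ : CubeCat A)) i (⟨ψ, hψ⟩ : (⟨_⟩ : CubeCat A) ⟶ ⟨n⟩)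
    | conn i ε hε ψ hψ =>
      exact .conn (X := yoneda.obj (⟨n⟩ : CubeCat A)) i ε hε
        (⟨ψ, hψ⟩ : (⟨_⟩ : CubeCat A) ⟶ ⟨n⟩)

theorem isDegenerate_map {A : Set Bool} {X : CubicalSet A} {c d : CubeCat A} (f : c ⟶ d)
    (h : IsDegenerateMap A f.1) (x : X.obj (op d)) :
    X.IsDegenerate (c := c) (X.map f.op x) :=
  ((isDegenerate_iff_isDegenerateMap f).2 h).app (yonedaEquiv.symm x)

/-- The subcomplex of the `(m+1)`-cube underlying the open box with missing face `∂_{p,b}`. -/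
abbrev boxSub (m : ℕ) (p : Fin (m + 1)) (b : Bool) :
    Subfunctor (yoneda.obj (⟨m + 1⟩ : CubeCat ∅)) :=
  faceUnion ∅ (m + 1) fun j ε' => (j, ε') ≠ (p, b)

theorem mem_boxSub_iff {m : ℕ} {p : Fin (m + 1)} {b : Bool} {c : CubeCat ∅}
    {f : c ⟶ (⟨m + 1⟩ : CubeCat ∅)} : f ∈ (boxSub m p b).obj (op c) ↔ IsInOpenBox p b f.1 :=
  mem_faceUnion_iff

theorem isCritical_id {A : Set Bool} {c : CubeCat A} (p : Fin c.dim) (b : Bool) :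
    CubeCat.IsCritical p b (𝟙 c) := by
  have not_hasFace (j : Fin c.dim) (ε : Bool) : ¬ CubeCat.HasFace (𝟙 c) j ε := fun hj =>
    Bool.not_ne_self ε (hj fun _ => !ε)
  exact ⟨inferInstance, fun h => h.elim (not_hasFace _ _) (not_hasFace _ _),
    fun ⟨j, _, hj, _⟩ => not_hasFace _ _ hj, fun ⟨j, _, hj, _⟩ => not_hasFace _ _ hj⟩

theorem isCritical_or_exists_eq_face {d m : ℕ} {f : (⟨d⟩ : CubeCat ∅) ⟶ ⟨m + 1⟩}
    (hf : ¬ IsDegenerateMap ∅ f.1) (hm : m ≤ d) (p : Fin (m + 1)) (b : Bool) :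
    CubeCat.IsCritical p b f ∨
      ∃ h : d = m, ∃ i ε, h ▸ f = (CubeCat.face i ε : (⟨m⟩ : CubeCat ∅) ⟶ ⟨m + 1⟩) := by
  have hs : ∀ s, IsEssential f.1 s := fun s => by
    by_contra hs
    exact hf (f.2.isDegenerateMap_of_not_isEssential hs)
  obtain rfl | rfl : d = m + 1 ∨ d = m := by
    have : d ≤ m + 1 := f.2.le_of_isEssential hs
    omega
  · obtain rfl : f = 𝟙 _ := Subtype.ext (f.2.eq_id_of_isEssential hs)
    exact Or.inl (isCritical_id (c := ⟨m + 1⟩) p b)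
  · obtain ⟨i, ε, e⟩ := f.2.exists_eq_cubeFace hs
    exact Or.inr ⟨rfl, i, ε, Subtype.ext e⟩

section Attach

variable {X : MarkedCubicalSet ∅} {S : Subfunctor X.cubes} {m : ℕ}
  {x : X.cubes.obj (op ⟨m + 1⟩)} {p : Fin (m + 1)} {b : Bool}

/-- The conditions under which `S ∪ ⟨x⟩` is obtained from `S` by attaching the comical cube `x`
along its open box with missing face `∂_{p,b}`. -/
structure IsComicalCell (S : Subfunctor X.cubes) (x : X.cubes.obj (op ⟨m + 1⟩))
    (p : Fin (m + 1)) (b : Bool) : Prop where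
  mem_iff : ∀ {c : CubeCat ∅} (f : c ⟶ ⟨m + 1⟩),
    X.cubes.map f.op x ∈ S.obj (op c) ↔ f ∈ (boxSub m p b).obj (op c)
  inj : ∀ {c : CubeCat ∅} (f g : c ⟶ ⟨m + 1⟩), f ∉ (boxSub m p b).obj (op c) →
    g ∉ (boxSub m p b).obj (op c) → X.cubes.map f.op x = X.cubes.map g.op x → f = g
  critical : ∀ {c : CubeCat ∅} (f : c ⟶ ⟨m + 1⟩), CubeCat.IsCritical p b f → 0 < c.dim →
    X.cubes.map f.op x ∈ X.marked c
  faces : X.cubes.map (CubeCat.face p b).op x ∈ X.marked ⟨m⟩ →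
    ∀ j ε, (j, ε) ≠ (p, b) → X.cubes.map (CubeCat.face j ε).op x ∈ X.marked ⟨m⟩

/-- The subcomplex `S ∪ ⟨x⟩`, in which new cubes are marked only if they are degenerate or
critical faces of `x`. -/
def attachBox (S : Subfunctor X.cubes) (x : X.cubes.obj (op ⟨m + 1⟩)) (p : Fin (m + 1))
    (b : Bool) : MarkedCubicalSet ∅ :=
  ofMarks (S ⊔ Subfunctor.ofSection x).toFunctor fun c =>
    {t | t.1 ∈ X.marked c ∧ (t.1 ∈ S.obj (op c) ∨
      ∃ f : c ⟶ ⟨m + 1⟩, CubeCat.IsCritical p b f ∧ X.cubes.map f.op x = t.1)}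

/-- The inclusion of `S` into `S ∪ ⟨x⟩`. -/
def attachBoxInl (S : Subfunctor X.cubes) (x : X.cubes.obj (op ⟨m + 1⟩)) (p : Fin (m + 1))
    (b : Bool) : X.regular S ⟶ attachBox S x p b where
  map := Subfunctor.homOfLe le_sup_left
  marked {_ t} ht := Or.inr ⟨X.pos ht, ht, Or.inl t.2⟩

/-- The map to `S ∪ ⟨x⟩` classifying `x`. -/
def cellMap (S : Subfunctor X.cubes) (x : X.cubes.obj (op ⟨m + 1⟩)) :
    yoneda.obj (⟨m + 1⟩ : CubeCat ∅) ⟶ (S ⊔ Subfunctor.ofSection x).toFunctor :=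
  yonedaEquiv.symm ⟨x, Or.inr (Subfunctor.mem_ofSection_obj x)⟩

/-- The identity of `S ∪ ⟨x⟩`, from the marking of `attachBox` to the one induced by `X`. -/
def attachBoxToRegular (S : Subfunctor X.cubes) (x : X.cubes.obj (op ⟨m + 1⟩)) (p : Fin (m + 1))
    (b : Bool) : attachBox S x p b ⟶ X.regular (S ⊔ Subfunctor.ofSection x) where
  map := 𝟙 _
  marked {c t} ht := by
    rcases ht with ht | ⟨_, ht, _⟩
    · exact X.degenerate (ht.app (Subfunctor.ι _))
    · exact ht

namespace IsComicalCell

/-- The map from the comical cube to `S ∪ ⟨x⟩` classifying `x`. -/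
def boxInr (h : IsComicalCell S x p b) : comicalCube ∅ (m + 1) p b ⟶ attachBox S x p b where
  map := cellMap S x
  marked {c f} hf := by
    rcases hf with hf | ⟨hc, hf⟩
    · exact Or.inl (hf.app _)
    · exact Or.inr ⟨hc, h.critical f hf hc, Or.inr ⟨f, hf, rfl⟩⟩

/-- The restriction of `x` to its open box, the attaching map of `x`. -/
def boxTop (h : IsComicalCell S x p b) : comicalBox ∅ (m + 1) p b ⟶ X.regular S where
  map :=
    { app c := ↾fun f => ⟨X.cubes.map f.1.op x, (h.mem_iff f.1).2 f.2⟩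
      naturality c d g := by
        ext f
        apply Subtype.ext
        exact X.cubes.map_comp_apply f.1.op g x }
  marked {c f} hf := by
    rcases hf with hf | ⟨hc, hf⟩
    · exact X.degenerate (hf.app (yonedaEquiv.symm x))
    · exact h.critical f.1 hf hc

theorem isPushout_box (h : IsComicalCell S x p b) :
    IsPushout h.boxTop (comicalBoxι ∅ (m + 1) p b) (attachBoxInl S x p b) h.boxInr := by
  refine isPushout_of_cover rfl (fun c => Subtype.val_injective)
    (fun c y z e => Subtype.ext
      (congrArg (fun t : (S ⊔ Subfunctor.ofSection x).toFunctor.obj (op c) => t.1) e)) ?_ ?_ ?_ ?_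
  · rintro c ⟨t, ht | ⟨f, rfl⟩⟩
    · exact Or.inl ⟨⟨t, ht⟩, rfl⟩
    · exact Or.inr ⟨f.unop, rfl⟩
  · intro c y z e
    refine ⟨⟨z, (h.mem_iff z).1 ?_⟩, rfl⟩
    have e' : y.1 = X.cubes.map (Quiver.Hom.op z) x := Subtype.ext_iff.1 e
    exact e' ▸ y.2
  · intro c y z hy hz e
    exact h.inj y z (fun hy' => hy ⟨⟨y, hy'⟩, rfl⟩) (fun hz' => hz ⟨⟨z, hz'⟩, rfl⟩)
      (congrArg Subtype.val e)
  · rintro c t (ht | ⟨hc, ht, ht' | ⟨f, hf, e⟩⟩)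
    · exact Or.inl ht
    · exact Or.inr (Or.inl ⟨⟨t.1, ht'⟩, ht, rfl⟩)
    · exact Or.inr (Or.inr ⟨f, Or.inr ⟨hc, hf⟩, Subtype.ext e⟩)

theorem mem_attachBox_or_exists_face (h : IsComicalCell S x p b) {c : CubeCat ∅}
    (t : (X.regular (S ⊔ Subfunctor.ofSection x)).cubes.obj (op c))
    (ht : t ∈ (X.regular (S ⊔ Subfunctor.ofSection x)).marked c) :
    t ∈ (attachBox S x p b).marked c ∨ (c.dim = m ∧
      X.cubes.map (CubeCat.face p b).op x ∈ X.marked ⟨m⟩ ∧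
        ∃ f : c ⟶ ⟨m + 1⟩, (cellMap S x).app (op c) f = t) := by
  obtain ⟨d⟩ := c
  obtain ⟨t, ht' | ⟨f, rfl⟩⟩ := t
  · exact Or.inl (Or.inr ⟨X.pos ht, ht, Or.inl ht'⟩)
  obtain ⟨f, rfl⟩ : ∃ g : (⟨d⟩ : CubeCat ∅) ⟶ ⟨m + 1⟩, f = g.op := ⟨f.unop, rfl⟩
  by_cases hb : f ∈ (boxSub m p b).obj (op ⟨d⟩)
  · exact Or.inl (Or.inr ⟨X.pos ht, ht, Or.inl ((h.mem_iff f).2 hb)⟩)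
  by_cases hd : IsDegenerateMap ∅ f.1
  · exact Or.inl (Or.inl (((isDegenerate_iff_isDegenerateMap f).2 hd).app (cellMap S x)))
  have hm : m ≤ d := f.2.le_of_not_isInOpenBox (mt mem_boxSub_iff.2 hb)
  rcases isCritical_or_exists_eq_face hd hm p b with hc | ⟨rfl, i, ε, e⟩
  · exact Or.inl (Or.inr ⟨X.pos ht, ht, Or.inr ⟨f, hc, rfl⟩⟩)
  · obtain rfl : f = CubeCat.face i ε := e
    obtain ⟨rfl, rfl⟩ : i = p ∧ ε = b := Prod.mk.inj (by
      by_contra hne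
      exact hb (mem_boxSub_iff.2 ⟨i, ε, hne, fun v => cubeFace_same i ε v⟩))
    exact Or.inr ⟨rfl, ht, _, rfl⟩

theorem isIso_attachBoxToRegular (h : IsComicalCell S x p b)
    (hy : X.cubes.map (CubeCat.face p b).op x ∉ X.marked ⟨m⟩) :
    IsIso (attachBoxToRegular S x p b) :=
  have : IsIso (attachBoxToRegular S x p b).map := inferInstanceAs (IsIso (𝟙 _))
  isIso_of_isIso_map _ fun _ t ht =>
    (h.mem_attachBox_or_exists_face t ht).resolve_right fun hh => hy hh.2.1

end IsComicalCell

end Attach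

namespace IsComicalCell

section MarkedFace

variable {X : MarkedCubicalSet ∅} {S : Subfunctor X.cubes} {m : ℕ}
  {x : X.cubes.obj (op ⟨m + 2⟩)} {p : Fin (m + 2)} {b : Bool}

/-- The map classifying `x` out of the domain of the comical marking extension, for a comical cube
`x` whose face `∂_{p,b}` is marked. -/
def markingTop (h : IsComicalCell S x p b)
    (hy : X.cubes.map (CubeCat.face p b).op x ∈ X.marked ⟨m + 1⟩) :
    ofMarks (yoneda.obj (⟨m + 2⟩ : CubeCat ∅)) (criticalAndOtherFaces ∅ (m + 1) p b) ⟶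
      attachBox S x p b where
  map := cellMap S x
  marked := by
    rintro c f (hf | ⟨hc, hf | ⟨j, ε, hne, hf⟩⟩)
    · exact Or.inl (hf.app _)
    · exact Or.inr ⟨hc, h.critical f hf hc, Or.inr ⟨f, hf, rfl⟩⟩
    · cases hf
      exact Or.inr ⟨hc, h.faces hy j ε hne, Or.inl ((h.mem_iff _).2
        (mem_boxSub_iff.2 ⟨j, ε, hne, fun v => cubeFace_same j ε v⟩))⟩

/-- The map classifying `x` out of the codomain of the comical marking extension, for a comical
cube `x` whose face `∂_{p,b}` is marked. -/
def markingBot (h : IsComicalCell S x p b)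
    (hy : X.cubes.map (CubeCat.face p b).op x ∈ X.marked ⟨m + 1⟩) :
    ofMarks (yoneda.obj (⟨m + 2⟩ : CubeCat ∅)) (criticalAndHighCubes ∅ (m + 1) p b) ⟶
      X.regular (S ⊔ Subfunctor.ofSection x) where
  map := cellMap S x
  marked := by
    rintro ⟨d⟩ f (hf | ⟨hc, hf | hf⟩)
    · exact X.degenerate (hf.app (yonedaEquiv.symm x))
    · exact h.critical f hf hc
    · change X.cubes.map (Quiver.Hom.op f) x ∈ X.marked ⟨d⟩
      by_cases hd : IsDegenerateMap ∅ f.1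
      · exact X.degenerate (isDegenerate_map f hd x)
      rcases isCritical_or_exists_eq_face hd hf p b with hcr | ⟨rfl, i, ε, e⟩
      · exact h.critical f hcr hc
      · obtain rfl : f = CubeCat.face i ε := e
        by_cases hne : (i, ε) = (p, b)
        · obtain ⟨rfl, rfl⟩ := Prod.mk.inj hne
          exact hy
        · exact h.faces hy i ε hne

theorem isPushout_marking (h : IsComicalCell S x p b)
    (hy : X.cubes.map (CubeCat.face p b).op x ∈ X.marked ⟨m + 1⟩) :
    IsPushout (h.markingTop hy) (comicalMarkingExt ∅ m p b) (attachBoxToRegular S x p b)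
      (h.markingBot hy) := by
  refine isPushout_of_cover rfl (fun c => fun _ _ e => e) (fun c => fun _ _ e => e)
    (fun c t => Or.inl ⟨t, rfl⟩) (fun c y z _ => ⟨z, rfl⟩)
    (fun c y z hy => (hy ⟨y, rfl⟩).elim) fun c t ht => ?_
  rcases h.mem_attachBox_or_exists_face t ht with ht' | ⟨hc, -, f, rfl⟩
  · exact Or.inr (Or.inl ⟨t, ht', rfl⟩)
  · exact Or.inr (Or.inr ⟨f, Or.inr ⟨X.pos ht, Or.inr hc.ge⟩, rfl⟩)

end MarkedFace

variable {W : MorphismProperty (MarkedCubicalSet ∅)} [W.IsStableUnderCobaseChange]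
  {X : MarkedCubicalSet ∅} {S : Subfunctor X.cubes} {m : ℕ} {x : X.cubes.obj (op ⟨m + 1⟩)}
  {p : Fin (m + 1)} {b : Bool}

theorem attachBoxInl_mem (hW : comicalGenerators ∅ ≤ W) (h : IsComicalCell S x p b) :
    W (attachBoxInl S x p b) :=
  MorphismProperty.of_isPushout h.isPushout_box (hW _ (Or.inl
    (MorphismProperty.ofHoms.mk (f := fun q : (n : ℕ) × Fin (n + 1) × Bool =>
      comicalBoxι ∅ (q.1 + 1) q.2.1 q.2.2) ⟨m, p, b⟩)))

theorem attachBoxToRegular_mem [W.ContainsIdentities] [W.RespectsIso]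
    (hW : comicalGenerators ∅ ≤ W) (h : IsComicalCell S x p b) :
    W (attachBoxToRegular S x p b) := by
  by_cases hy : X.cubes.map (CubeCat.face p b).op x ∈ X.marked ⟨m⟩
  · obtain _ | m := m
    · exact (X.pos hy).ne rfl |>.elim
    · exact MorphismProperty.of_isPushout (h.isPushout_marking hy) (hW _ (Or.inr
        (MorphismProperty.ofHoms.mk (f := fun q : (n : ℕ) × Fin (n + 2) × Bool =>
          comicalMarkingExt ∅ q.1 q.2.1 q.2.2) ⟨m, p, b⟩)))
  · have := h.isIso_attachBoxToRegular hy
    exact W.of_isIso _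

theorem regularHomOfLE_mem [W.IsMultiplicative]
    (hW : comicalGenerators ∅ ≤ W) (h : IsComicalCell S x p b) :
    W (X.regularHomOfLE (le_sup_left : S ≤ S ⊔ Subfunctor.ofSection x)) :=
  W.comp_mem (attachBoxInl S x p b) _ (h.attachBoxInl_mem hW) (h.attachBoxToRegular_mem hW)

end IsComicalCell

end MarkedCubicalSet

/-! ### Complexes of maps between cubes -/

/-- A property of maps to the `N`-cube which is stable under precomposition with maps of `□_∅`. -/
structure CubeSieve (N : ℕ) where
  mem : ∀ {m : ℕ}, (Vertex m → Vertex N) → Prop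
  comp : ∀ {k m : ℕ} {f : Vertex k → Vertex m} {φ : Vertex m → Vertex N},
    IsCubeMap ∅ f → mem φ → mem fun v => φ (f v)

namespace MarkedCubicalSet

/-- The cubical set `i^* □_A^N`. -/
abbrev restrictedCube (A : Set Bool) (N : ℕ) : CubicalSet ∅ :=
  (CubeCat.incl (Set.empty_subset A)).op ⋙ yoneda.obj (⟨N⟩ : CubeCat A)

/-- The cubical set `i^* □_A^N`, in which a cube is marked if its composite with `g` is not
injective. -/
def markedCube (A : Set Bool) (N : ℕ) {N' : ℕ} (g : Vertex N → Vertex N') :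
    MarkedCubicalSet ∅ where
  cubes := restrictedCube A N
  marked c := {ψ : (⟨c.dim⟩ : CubeCat A) ⟶ ⟨N⟩ | ¬ Function.Injective fun v => g (ψ.1 v)}
  pos {c ψ} h := by
    by_contra h0
    obtain ⟨d⟩ := c
    obtain rfl : d = 0 := by simpa using h0
    exact h (Function.injective_of_subsingleton _)
  degenerate {c ψ} h := by
    have not_injective_comp : ∀ {d d' : ℕ} {f : Vertex d → Vertex d'} {φ : Vertex d' → Vertex N},
        ¬ Function.Injective f → ¬ Function.Injective fun v => g (φ (f v)) := fun hf h =>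
      hf (Function.Injective.of_comp (f := fun v => g _) h)
    cases h with
    | degen i y =>
      exact not_injective_comp (f := cubeDegen i) (φ := Subtype.val (p := IsCubeMap A) y)
        (Vertex.not_injective (Nat.lt_succ_self _) _)
    | conn i ε hε y => exact hε.elim

/-- The subcomplex of `i^* □_A^N` defined by a property of maps. -/
def sieveSub (A : Set Bool) {N : ℕ} (S : CubeSieve N) : Subfunctor (restrictedCube A N) where
  obj c := {ψ : (⟨c.unop.dim⟩ : CubeCat A) ⟶ ⟨N⟩ | S.mem ψ.1}
  map f _ hψ := S.comp (f := f.unop.1) f.unop.2 hψ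

theorem sieveSub_mono (A : Set Bool) {N : ℕ} {S T : CubeSieve N}
    (h : ∀ {m : ℕ} (φ : Vertex m → Vertex N), IsCubeMap A φ → S.mem φ → T.mem φ) :
    sieveSub A S ≤ sieveSub A T := fun _ ψ hψ => h ψ.1 ψ.2 hψ

end MarkedCubicalSet

/-- The conditions under which the complex of maps satisfying `T` is obtained from that of the maps
satisfying `S` by attaching comical cubes, with missing face in the variable that is inserted at
the coordinate `c`. -/
structure IsInsertionPair (A : Set Bool) {N N' : ℕ} (g : Vertex (N + 1) → Vertex N')
    (S T : CubeSieve (N + 1)) (c : Fin (N + 1)) (b : Bool) : Prop where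
  le : ∀ {m : ℕ} {φ : Vertex m → Vertex (N + 1)}, IsCubeMap A φ → S.mem φ → T.mem φ
  coord : ∀ {m : ℕ} {φ : Vertex m → Vertex (N + 1)}, IsCubeMap A φ → T.mem φ →
    ¬ S.mem φ → (∃ p, ∀ v, φ v c = v p) ∨ ∀ v, φ v c = b
  opposite : ∀ {m : ℕ} {φ : Vertex (m + 1) → Vertex (N + 1)} {p : Fin (m + 1)},
    IsCubeMap A φ → T.mem φ → ¬ S.mem φ → (∀ v, φ v c = v p) → S.mem fun v => φ (cubeFace p (!b) v)
  missing : ∀ {m : ℕ} {φ : Vertex (m + 1) → Vertex (N + 1)} {p : Fin (m + 1)},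
    IsCubeMap A φ → T.mem φ → ¬ S.mem φ → (∀ v, φ v c = v p) → ¬ S.mem fun v => φ (cubeFace p b v)
  insert : ∀ {m : ℕ} {φ : Vertex (m + 1) → Vertex (N + 1)} {p : Fin (m + 1)},
    IsCubeMap A φ → (∀ v, φ v c = v p) → (T.mem fun v => φ (cubeFace p b v)) →
      (¬ S.mem fun v => φ (cubeFace p b v)) → T.mem φ
  critical : ∀ {m : ℕ} {φ : Vertex (m + 1) → Vertex (N + 1)} {p : Fin (m + 1)},
    IsCubeMap A φ → T.mem φ → ¬ S.mem φ → (∀ v, φ v c = v p) → (∀ s, IsEssential φ s) →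
      ∀ {d : ℕ} (δ : (⟨d⟩ : CubeCat ∅) ⟶ ⟨m + 1⟩), CubeCat.IsCritical p b δ →
        ¬ Function.Injective fun v => g (φ (δ.1 v))
  faces : ∀ {m : ℕ} {φ : Vertex (m + 1) → Vertex (N + 1)} {p : Fin (m + 1)},
    IsCubeMap A φ → T.mem φ → ¬ S.mem φ → (∀ v, φ v c = v p) → (∀ s, IsEssential φ s) →
      (¬ Function.Injective fun v => g (φ (cubeFace p b v))) → ∀ j ε, (j, ε) ≠ (p, b) →
        ¬ Function.Injective fun v => g (φ (cubeFace j ε v))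

theorem isEssential_comp_cubeFace {m n : ℕ} {x : Vertex (m + 1) → Vertex n} (hx : IsOrdered x)
    {c : Fin n} {p : Fin (m + 1)} (hc : ∀ v, x v c = v p) (hess : ∀ s, IsEssential x s) (b : Bool)
    (s : Fin m) : IsEssential (fun v => x (cubeFace p b v)) s := by
  obtain ⟨j, hj⟩ := (hess (p.succAbove s)).exists_coord
  have hjc : j ≠ c := by
    rintro rfl
    simp only [hc, isEssential_proj] at hj
    exact Fin.succAbove_ne p s hj
  rw [← funext (hx.apply_cubeFace_cubeDegen_of_ne hc hjc b)] at hj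
  obtain ⟨u, hu, hu'⟩ := IsEssential.exists_of_comp (f := cubeDegen p)
    (g := fun w => x (cubeFace p b w) j) hj
  obtain rfl : s = u := Fin.succAbove_right_injective (isEssential_proj.1 hu')
  exact IsEssential.of_coord hu

theorem IsCubeMap.exists_comp_cubeFace_eq {A : Set Bool} {m n : ℕ}
    {ψ : Vertex m → Vertex (n + 1)} (hψ : IsCubeMap A ψ) (hess : ∀ s, IsEssential ψ s)
    {c : Fin (n + 1)} {b : Bool} (hb : ∀ v, ψ v c = b) :
    ∃ (p : Fin (m + 1)) (x : Vertex (m + 1) → Vertex (n + 1)), IsCubeMap A x ∧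
      (∀ v, x v c = v p) ∧ (∀ s, IsEssential x s) ∧ ∀ v, x (cubeFace p b v) = ψ v := by
  obtain ⟨p, x, hx, hxc, hxd⟩ := (hψ.comp (.degen c)).exists_insert c
  have hxf : ∀ v, x (cubeFace p b v) = ψ v := fun v => by
    rw [← cubeFace_cubeDegen_of_eq (hb v), ← cubeFace_cubeDegen_of_eq
      ((hxc (cubeFace p b v)).trans (cubeFace_same p b v)), hxd, cubeDegen_cubeFace]
  refine ⟨p, x, hx, hxc, fun s => ?_, hxf⟩
  rcases Fin.eq_self_or_eq_succAbove p s with rfl | ⟨s, rfl⟩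
  · exact IsEssential.of_coord (j := c) (by simp only [hxc, isEssential_proj])
  · exact IsEssential.of_comp_cubeFace (ε := b) (by simpa only [hxf] using hess s)

namespace IsInsertionPair

variable {A : Set Bool} {N N' : ℕ} {g : Vertex (N + 1) → Vertex N'}
  {S T : CubeSieve (N + 1)} {c : Fin (N + 1)} {b : Bool}

/-- A nondegenerate cube to be attached: a map using all its variables, in `T` but not in `S`,
with coordinate `c` a projection. -/
structure IsCell (A : Set Bool) (S T : CubeSieve (N + 1)) (c : Fin (N + 1)) {m : ℕ}
    (x : Vertex (m + 1) → Vertex (N + 1)) (p : Fin (m + 1)) : Prop where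
  isCubeMap : IsCubeMap A x
  mem : T.mem x
  notMem : ¬ S.mem x
  coord : ∀ v, x v c = v p
  essential : ∀ s, IsEssential x s

/-- The maps from cubes of positive dimension to the `(N + 1)`-cube, all dimensions together. -/
abbrev Cubes (N : ℕ) := (m : ℕ) × (Vertex (m + 1) → Vertex (N + 1))

/-- The cubes to be attached, of all dimensions. -/
def cells (A : Set Bool) (S T : CubeSieve (N + 1)) (c : Fin (N + 1)) : Set (Cubes N) :=
  {a | ∃ p, IsCell A S T c a.2 p}

/-- The cubes to be attached which have dimension at most `m`. -/
def below (A : Set Bool) (S T : CubeSieve (N + 1)) (c : Fin (N + 1)) (m : ℕ) : Set (Cubes N) :=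
  {a | a ∈ cells A S T c ∧ a.1 < m}

theorem below_mono (A : Set Bool) (S T : CubeSieve (N + 1)) (c : Fin (N + 1)) {m m' : ℕ}
    (h : m ≤ m') : below A S T c m ⊆ below A S T c m' :=
  fun _ ha => ⟨ha.1, ha.2.trans_le h⟩

/-- The property of belonging to `S` or to one of the cubes in `K`. -/
def adjoin (S : CubeSieve (N + 1)) (K : Set (Cubes N)) : CubeSieve (N + 1) where
  mem {m} φ := S.mem φ ∨ ∃ a ∈ K, ∃ f : Vertex m → Vertex (a.1 + 1),
    IsCubeMap ∅ f ∧ φ = fun v => a.2 (f v)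
  comp {k m f φ} hf h := by
    rcases h with h | ⟨a, ha, f', hf', rfl⟩
    · exact Or.inl (S.comp hf h)
    · exact Or.inr ⟨a, ha, _, hf.comp hf', rfl⟩

theorem adjoin_mono {K L : Set (Cubes N)} (h : K ⊆ L) {m : ℕ}
    {φ : Vertex m → Vertex (N + 1)} (hφ : (adjoin S K).mem φ) :
    (adjoin S L).mem φ :=
  hφ.imp_right fun ⟨a, ha, hf⟩ => ⟨a, h ha, hf⟩

theorem exists_isEssential_factorization {d : ℕ} {φ : Vertex d → Vertex (N + 1)}
    (hφ : IsCubeMap A φ) (hT : T.mem φ) (hS : ¬ S.mem φ) :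
    ∃ d' ≤ d, ∃ (ψ : Vertex d' → Vertex (N + 1)) (f : Vertex d → Vertex d'), IsCubeMap A ψ ∧
      T.mem ψ ∧ ¬ S.mem ψ ∧ (∀ s, IsEssential ψ s) ∧ IsCubeMap ∅ f ∧ φ = fun v => ψ (f v) := by
  obtain ⟨d', f, k, hf, hk, hess, e⟩ := hφ.exists_isEssential_factorization
  exact ⟨d', hk.le_of_isEssential fun s => (hess s).of_comp, fun v => φ (k v), f,
    (hk.mono (Set.empty_subset A)).comp hφ, T.comp hk hT,
    fun hS' => hS (by simpa only [e] using S.comp hf hS'), hess, hf, funext fun v => (e v).symm⟩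

theorem exists_cell_of_proj (h : IsInsertionPair A g S T c b) {d : ℕ}
    {φ : Vertex d → Vertex (N + 1)} (hφ : IsCubeMap A φ) (hT : T.mem φ) (hS : ¬ S.mem φ) {q : Fin d}
    (hq : ∀ v, φ v c = v q) :
    ∃ a ∈ cells A S T c, a.1 + 1 ≤ d ∧ ∃ f, IsCubeMap ∅ f ∧ φ = fun v => a.2 (f v) := by
  obtain ⟨d', hle, ψ, f, hψ, hψT, hψS, hess, hf, rfl⟩ := exists_isEssential_factorization hφ hT hS
  rcases h.coord hψ hψT hψS with ⟨p, hp⟩ | hb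
  · obtain _ | m := d'
    · exact p.elim0
    · exact ⟨⟨m, ψ⟩, ⟨p, hψ, hψT, hψS, hp, hess⟩, hle, f, hf, rfl⟩
  · exact (Bool.not_ne_self b ((hq fun _ => !b).symm.trans (hb _))).elim

theorem exists_cell (h : IsInsertionPair A g S T c b) {d : ℕ}
    {φ : Vertex d → Vertex (N + 1)} (hφ : IsCubeMap A φ) (hT : T.mem φ) (hS : ¬ S.mem φ) :
    ∃ a ∈ cells A S T c, ∃ f, IsCubeMap ∅ f ∧ φ = fun v => a.2 (f v) := by
  obtain ⟨d', -, ψ, f, hψ, hψT, hψS, hess, hf, rfl⟩ := exists_isEssential_factorization hφ hT hS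
  rcases h.coord hψ hψT hψS with ⟨p, hp⟩ | hb
  · obtain ⟨a, ha, -, f', hf', rfl⟩ := h.exists_cell_of_proj hψ hψT hψS hp
    exact ⟨a, ha, _, hf.comp hf', rfl⟩
  obtain ⟨p, x, hx, hxc, hxess, hxf⟩ := hψ.exists_comp_cubeFace_eq hess hb
  obtain rfl : ψ = fun v => x (cubeFace p b v) := funext fun v => (hxf v).symm
  exact ⟨⟨d', x⟩, ⟨p, hx, h.insert hx hxc hψT hψS, fun hS' => hψS (S.comp (.face p b) hS'), hxc,
    hxess⟩, _, hf.comp (.face p b), rfl⟩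

section Step

variable {K : Set (Cubes N)} {m : ℕ} {x : Vertex (m + 1) → Vertex (N + 1)}
  {p : Fin (m + 1)}

theorem adjoin_face (h : IsInsertionPair A g S T c b) (hx : IsCell A S T c x p)
    (hK : below A S T c m ⊆ K) {j : Fin (m + 1)} {ε : Bool}
    (hne : (j, ε) ≠ (p, b)) : (adjoin S K).mem fun v => x (cubeFace j ε v) := by
  by_cases hS : S.mem fun v => x (cubeFace j ε v)
  · exact Or.inl hS
  have hj : p ≠ j := by
    rintro rfl
    obtain rfl : ε = !b := by
      rcases Bool.eq_or_eq_not ε b with rfl | e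
      · exact (hne rfl).elim
      · exact e
    exact hS (h.opposite hx.isCubeMap hx.mem hx.notMem hx.coord)
  obtain ⟨q, rfl⟩ := Fin.exists_succAbove_eq hj
  obtain ⟨a, ha, hle, hf⟩ := h.exists_cell_of_proj (q := q) ((IsCubeMap.face j ε).comp hx.isCubeMap)
    (T.comp (.face j ε) hx.mem) hS fun v => by rw [hx.coord, cubeFace_succAbove]
  exact Or.inr ⟨a, hK ⟨ha, by omega⟩, hf⟩

theorem not_adjoin_self (hx : IsCell A S T c x p) (hKm : K ⊆ below A S T c (m + 1))
    (hxK : (⟨m, x⟩ : Cubes N) ∉ K) : ¬ (adjoin S K).mem x := by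
  rintro (hS | ⟨⟨m', x'⟩, ha, f, hf, rfl⟩)
  · exact hx.notMem hS
  have hess : ∀ s, IsEssential f s := fun s => (hx.essential s).of_comp
  obtain rfl : m' = m := by
    have hle : m + 1 ≤ m' + 1 := hf.le_of_isEssential hess
    have hlt : m' < m + 1 := (hKm ha).2
    omega
  obtain rfl := hf.eq_id_of_isEssential hess
  exact hxK ha

theorem not_adjoin_missing (h : IsInsertionPair A g S T c b) (hx : IsCell A S T c x p)
    (hKm : K ⊆ below A S T c (m + 1)) (hxK : (⟨m, x⟩ : Cubes N) ∉ K) :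
    ¬ (adjoin S K).mem fun v => x (cubeFace p b v) := by
  rintro (hS | ⟨⟨m', x'⟩, ha, f, hf, e⟩)
  · exact h.missing hx.isCubeMap hx.mem hx.notMem hx.coord hS
  have hy := isEssential_comp_cubeFace hx.isCubeMap.isOrdered hx.coord hx.essential b
  have hess : ∀ s, IsEssential f s := fun s => by
    have hs := hy s
    rw [e] at hs
    exact hs.of_comp
  obtain ⟨⟨p', hx' : IsCell A S T c x' p'⟩, hlt : m' < m + 1⟩ := hKm ha
  have hle : m ≤ m' + 1 := hf.le_of_isEssential hess
  have hc : ∀ v, f v p' = b := fun v =>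
    (hx'.coord (f v)).symm.trans <| (congrFun (congrFun e v) c).symm.trans <|
      (hx.coord _).trans (cubeFace_same p b v)
  obtain rfl | rfl : m = m' + 1 ∨ m = m' := by omega
  · obtain rfl := hf.eq_id_of_isEssential hess
    exact Bool.not_ne_self b (hc fun _ => !b)
  · obtain ⟨i, ε, rfl⟩ := hf.exists_eq_cubeFace hess
    rcases Fin.eq_self_or_eq_succAbove i p' with rfl | ⟨q, rfl⟩
    · obtain rfl : ε = b := by simpa only [cubeFace_same] using hc fun _ => b
      obtain rfl := eq_of_comp_cubeFace_eq hx.isCubeMap.isOrdered hx'.isCubeMap.isOrdered hx.coord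
        hx'.coord (congrFun e) hy
      exact hxK ha
    · exact Bool.not_ne_self b (by simpa only [cubeFace_succAbove] using hc fun _ => !b)

theorem adjoin_comp_iff (h : IsInsertionPair A g S T c b) (hx : IsCell A S T c x p)
    (hK : below A S T c m ⊆ K) (hKm : K ⊆ below A S T c (m + 1)) (hxK : (⟨m, x⟩ : Cubes N) ∉ K)
    {d : ℕ} {f : Vertex d → Vertex (m + 1)} (hf : IsCubeMap ∅ f) :
    ((adjoin S K).mem fun v => x (f v)) ↔ IsInOpenBox p b f := by
  constructor
  · intro hm
    by_contra hbox
    rcases hf.exists_strictMono_of_not_isInOpenBox hbox with ⟨σ, hσ, e⟩ | ⟨σ, hσ, e⟩ <;>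
      obtain ⟨k, hk, hkσ⟩ :=
        (isCubeMap_reindex hσ).exists_section hσ.injective.surjective_comp_right <;>
      have hmk := (adjoin S K).comp hk hm <;>
      simp only [e, hkσ] at hmk
    · exact not_adjoin_self hx hKm hxK hmk
    · exact h.not_adjoin_missing hx hKm hxK hmk
  · rintro ⟨j, ε, hne, hj⟩
    have := (adjoin S K).comp (hf.comp (.degen j)) (h.adjoin_face hx hK hne)
    simpa only [cubeFace_cubeDegen_of_eq (hj _)] using this

theorem eq_of_comp_eq (hx : IsCell A S T c x p) {d : ℕ}
    {f f' : Vertex d → Vertex (m + 1)} (hf : IsCubeMap ∅ f) (hf' : IsCubeMap ∅ f')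
    (hb : ¬ IsInOpenBox p b f) (hb' : ¬ IsInOpenBox p b f') (e : ∀ v, x (f v) = x (f' v)) :
    f = f' := by
  have ep : ∀ v, f v p = f' v p := fun v => by rw [← hx.coord (f v), e, hx.coord]
  rcases hf.exists_strictMono_of_not_isInOpenBox hb with ⟨σ, hσ, h1⟩ | ⟨σ, hσ, h1⟩ <;>
    rcases hf'.exists_strictMono_of_not_isInOpenBox hb' with ⟨τ, hτ, h2⟩ | ⟨τ, hτ, h2⟩ <;>
    simp only [h1, h2, cubeFace_same] at e ep
  · obtain rfl := eq_of_comp_reindex_eq hx.essential hσ hτ e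
    exact funext fun v => (h1 v).trans (h2 v).symm
  · exact (Bool.not_ne_self b (ep fun _ => !b)).elim
  · exact (Bool.not_ne_self b (ep fun _ => !b).symm).elim
  · obtain rfl := eq_of_comp_reindex_eq
      (isEssential_comp_cubeFace hx.isCubeMap.isOrdered hx.coord hx.essential b) hσ hτ e
    exact funext fun v => (h1 v).trans (h2 v).symm

theorem isComicalCell (h : IsInsertionPair A g S T c b) (hx : IsCell A S T c x p)
    (hK : below A S T c m ⊆ K) (hKm : K ⊆ below A S T c (m + 1)) (hxK : (⟨m, x⟩ : Cubes N) ∉ K) :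
    IsComicalCell (X := markedCube A (N + 1) g) (sieveSub A (adjoin S K)) (m := m)
      (⟨x, hx.isCubeMap⟩ : (⟨m + 1⟩ : CubeCat A) ⟶ ⟨N + 1⟩) p b where
  mem_iff f := (h.adjoin_comp_iff hx hK hKm hxK f.2).trans mem_boxSub_iff.symm
  inj f f' hf hf' e := Subtype.ext (eq_of_comp_eq hx f.2 f'.2
    (mt mem_boxSub_iff.2 hf) (mt mem_boxSub_iff.2 hf')
    (congrFun (congrArg (Subtype.val (p := IsCubeMap A)) e)))
  critical f hf _ := h.critical hx.isCubeMap hx.mem hx.notMem hx.coord hx.essential f hf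
  faces hy j ε hne := h.faces hx.isCubeMap hx.mem hx.notMem hx.coord hx.essential hy j ε hne

theorem sieveSub_adjoin_insert (hx : IsCubeMap A x) :
    sieveSub A (adjoin S (Insert.insert (⟨m, x⟩ : Cubes N) K)) = sieveSub A (adjoin S K) ⊔
      Subfunctor.ofSection (F := restrictedCube A (N + 1)) (X := op ⟨m + 1⟩)
        (⟨x, hx⟩ : (⟨m + 1⟩ : CubeCat A) ⟶ ⟨N + 1⟩) := by
  apply le_antisymm
  · rintro d ψ (hψ | ⟨a, rfl | ha, f, hf, e⟩)
    · exact Or.inl (Or.inl hψ)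
    · exact Or.inr ⟨Quiver.Hom.op ⟨f, hf⟩, Subtype.ext e.symm⟩
    · exact Or.inl (Or.inr ⟨a, ha, f, hf, e⟩)
  · rintro d ψ (hψ | ⟨f, rfl⟩)
    · exact adjoin_mono (Set.subset_insert _ _) hψ
    · exact Or.inr ⟨_, Set.mem_insert _ _, f.unop.1, f.unop.2, rfl⟩

end Step

variable {W : MorphismProperty (MarkedCubicalSet ∅)} [W.IsStableUnderCobaseChange]

theorem regularHomOfLE_union_mem [W.IsMultiplicative] (h : IsInsertionPair A g S T c b)
    (hW : comicalGenerators ∅ ≤ W) (m : ℕ) (L : Finset (Cubes N))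
    (hL : ∀ a ∈ L, a ∈ cells A S T c ∧ a.1 = m)
    (hle : sieveSub A (adjoin S (below A S T c m)) ≤ sieveSub A (adjoin S (below A S T c m ∪ L))) :
    W ((markedCube A (N + 1) g).regularHomOfLE hle) := by
  classical
  induction L using Finset.induction_on with
  | empty =>
    revert hle
    rw [Finset.coe_empty, Set.union_empty]
    exact fun _ => W.id_mem _
  | insert a L ha ih =>
    obtain ⟨⟨p, hp⟩, rfl⟩ := hL a (Finset.mem_insert_self _ _)
    have hL' : ∀ a' ∈ L, a' ∈ cells A S T c ∧ a'.1 = a.1 := fun a' ha' =>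
      hL a' (Finset.mem_insert_of_mem ha')
    have hcell := h.isComicalCell (K := below A S T c a.1 ∪ L) hp Set.subset_union_left
      (Set.union_subset (below_mono A S T c a.1.le_succ)
        fun a' ha' => ⟨(hL' a' ha').1, (hL' a' ha').2.trans_lt a.1.lt_succ_self⟩)
      (fun h' => h'.elim (fun h' => lt_irrefl _ h'.2) ha)
    revert hle
    rw [Finset.coe_insert, Set.union_insert, sieveSub_adjoin_insert hp.isCubeMap]
    exact fun _ => W.comp_mem _ _
      (ih hL' (sieveSub_mono A fun _ _ => adjoin_mono Set.subset_union_left))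
      (hcell.regularHomOfLE_mem hW)

theorem regularHomOfLE_succ_mem [W.IsMultiplicative] (h : IsInsertionPair A g S T c b)
    (hW : comicalGenerators ∅ ≤ W) (m : ℕ)
    (hle : sieveSub A (adjoin S (below A S T c m)) ≤
      sieveSub A (adjoin S (below A S T c (m + 1)))) :
    W ((markedCube A (N + 1) g).regularHomOfLE hle) := by
  have hfin : {a | a ∈ cells A S T c ∧ a.1 = m}.Finite := by
    refine (Set.finite_range fun x : Vertex (m + 1) → Vertex (N + 1) =>
      (⟨m, x⟩ : Cubes N)).subset ?_
    rintro ⟨m', x⟩ ⟨-, rfl⟩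
    exact ⟨x, rfl⟩
  have e : below A S T c (m + 1) = below A S T c m ∪ hfin.toFinset := by
    ext a
    simp only [Set.Finite.coe_toFinset, Set.mem_union, below, Set.mem_ofPred_eq, ← and_or_left,
      Nat.lt_succ_iff_lt_or_eq]
  revert hle
  rw [e]
  exact h.regularHomOfLE_union_mem hW m _ fun a ha => hfin.mem_toFinset.1 ha

theorem sieveSub_adjoin_below_zero :
    sieveSub A (adjoin S (below A S T c 0)) = sieveSub A S := by
  apply le_antisymm
  · rintro d ψ (hψ | ⟨a, ha, -⟩)
    · exact hψ
    · exact (Nat.not_lt_zero _ ha.2).elim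
  · exact fun d ψ hψ => Or.inl hψ

theorem sieveSub_eq_iSup (h : IsInsertionPair A g S T c b) :
    sieveSub A T = ⨆ m : ℕ, sieveSub A (adjoin S (below A S T c m)) := by
  apply le_antisymm
  · intro d ψ hψ
    rw [Subfunctor.iSup_obj, Set.mem_iUnion]
    by_cases hS : S.mem ψ.1
    · exact ⟨0, Or.inl hS⟩
    · obtain ⟨a, ha, f, hf, e⟩ := h.exists_cell ψ.2 hψ hS
      exact ⟨a.1 + 1, Or.inr ⟨a, ⟨ha, Nat.lt_succ_self _⟩, f, hf, e⟩⟩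
  · refine iSup_le fun m => sieveSub_mono A fun φ hφ hm => ?_
    rcases hm with hS | ⟨a, ⟨⟨p, ha⟩, -⟩, f, hf, rfl⟩
    · exact h.le hφ hS
    · exact T.comp hf ha.mem

theorem regularHomOfLE_mem [MorphismProperty.IsStableUnderTransfiniteComposition.{0} W]
    (h : IsInsertionPair A g S T c b) (hW : comicalGenerators ∅ ≤ W)
    (hle : sieveSub A S ≤ sieveSub A T) :
    W ((markedCube A (N + 1) g).regularHomOfLE hle) := by
  have hmono : Monotone fun m : ℕ => sieveSub A (adjoin S (below A S T c m)) := fun m m' hm =>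
    sieveSub_mono A fun _ _ => adjoin_mono (below_mono A S T c hm)
  revert hle
  rw [← sieveSub_adjoin_below_zero (A := A) (S := S) (T := T) (c := c)]
  exact regularHomOfLE_iSup_mem (X := markedCube A (N + 1) g) hmono h.sieveSub_eq_iSup
    fun m => h.regularHomOfLE_succ_mem hW m _

end IsInsertionPair

/-! ### Adding a connection at one coordinate -/

theorem isElementary_of_comp_cubeFace {m n : ℕ} {φ : Vertex (m + 1) → Vertex n}
    (hφ : IsOrdered φ) {c j : Fin n} {p : Fin (m + 1)} (hc : ∀ v, φ v c = v p) (hj : j ≠ c)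
    {b : Bool} (h : IsElementary fun v => φ (cubeFace p b v) j) : IsElementary fun v => φ v j := by
  simpa only [hφ.apply_cubeFace_cubeDegen_of_ne hc hj b] using
    h.comp (IsCubeMap.degen p).isElementary

theorem isElementary_of_comp_cubeFace_of_le {m n : ℕ} {φ : Vertex (m + 1) → Vertex n}
    (hφ : IsOrdered φ) {c : Fin n} {p : Fin (m + 1)} (hc : ∀ v, φ v c = v p) {b : Bool}
    (h : ∀ j, c ≤ j → IsElementary fun v => φ (cubeFace p b v) j) (j : Fin n) (hj : c ≤ j) :
    IsElementary fun v => φ v j := by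
  by_cases hjc : j = c
  · exact Or.inr ⟨p, hjc ▸ hc⟩
  · exact isElementary_of_comp_cubeFace hφ hc hjc (h j hj)

theorem forall_eq_or_exists_eq_not {α : Type*} (g : α → Bool) (b : Bool) :
    (∀ v, g v = b) ∨ ∃ v, g v = !b := by
  simpa only [Bool.eq_not, ← not_forall] using Classical.em (∀ v, g v = b)

theorem exists_isEssential_eq_forall_gt_eq_not {m : ℕ} {g : Vertex m → Bool} (hg : Monotone g)
    {ε : Bool} {x : Vertex m} (hx : g x = ε) (hne : ∃ v, g v = !ε) :
    ∃ t, IsEssential g t ∧ x t = ε ∧ ∀ u, IsEssential g u → t < u → x u = !ε := by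
  obtain ⟨v, hv⟩ := hne
  have hex : {t | IsEssential g t ∧ x t = ε}.Nonempty := by
    by_contra! hc
    have e : g x = g fun _ => !ε := dependsOn_setOf_isEssential g fun t ht =>
      Bool.eq_not.2 fun h => hc.subset ⟨ht, h⟩
    rw [hx, eq_of_monotone_of_const hg (!ε) hv] at e
    exact Bool.not_ne_self ε e.symm
  obtain ⟨t, ⟨ht, htx⟩, hmax⟩ := (Set.toFinite _).exists_maximal hex
  exact ⟨t, ht, htx, fun u hu htu =>
    Bool.eq_not.2 fun h => htu.not_ge (hmax ⟨hu, h⟩ htu.le)⟩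

theorem CubeCat.IsCritical.exists_apply_eq {d m : ℕ} {p : Fin m} {ε : Bool}
    {δ : (⟨d⟩ : CubeCat ∅) ⟶ ⟨m⟩} (hδ : CubeCat.IsCritical p ε δ) : ∃ s, ∀ v, δ.1 v p = v s := by
  refine (δ.2.isElementary p).resolve_left fun ⟨b, hb⟩ => hδ.middle ?_
  rcases Bool.eq_or_eq_not b ε with rfl | rfl
  · exact Or.inl hb
  · exact Or.inr hb

section Connection

variable {n : ℕ} {k : Fin (n + 1)} {ε : Bool} {c c' : Fin (n + 2)}

section Pair

variable (hc : s(c, c') = s(k.castSucc, k.succ))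

include hc

theorem cubeConn_same_of_pair (x : Vertex (n + 2)) :
    cubeConn k ε x k = connOp ε (x c) (x c') := by
  rw [cubeConn_same]
  rcases Sym2.eq_iff.1 hc with ⟨rfl, rfl⟩ | ⟨rfl, rfl⟩
  · rfl
  · exact connOp_comm _ _ _

theorem ne_of_pair : c ≠ c' := by
  rcases Sym2.eq_iff.1 hc with ⟨rfl, rfl⟩ | ⟨rfl, rfl⟩
  · exact Fin.castSucc_lt_succ.ne
  · exact Fin.castSucc_lt_succ.ne'

theorem exists_cubeConn_apply_eq_of_pair {j : Fin (n + 1)} (hj : j ≠ k) :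
    ∃ a, a ≠ c ∧ a ≠ c' ∧ ∀ x, cubeConn k ε x j = x a := by
  obtain ⟨a, ha, ha', e⟩ := exists_cubeConn_apply_eq hj ε
  rcases Sym2.eq_iff.1 hc with ⟨rfl, rfl⟩ | ⟨rfl, rfl⟩
  · exact ⟨a, ha, ha', e⟩
  · exact ⟨a, ha', ha, e⟩

theorem not_injective_cubeConn_of_eq_not {d : ℕ} {ψ : Vertex d → Vertex (n + 2)}
    (hψ : IsOrdered ψ) {s : Fin d} (hs : IsEssential (fun v => ψ v c) s) {v : Vertex d}
    (hv : ψ v c' = !ε) : ¬ Function.Injective fun v => cubeConn k ε (ψ v) := by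
  intro hinj
  have agree : ∀ a, a ≠ c → ψ (Function.update v s (!v s)) a = ψ v a := fun a ha =>
    not_not.1 fun h => ha (hψ.eq_of_isEssential ⟨v, _, h⟩ hs)
  have e : Function.update v s (!v s) = v := by
    refine hinj (funext fun j => ?_)
    by_cases hj : j = k
    · simp only [hj, cubeConn_same_of_pair hc, agree c' (ne_of_pair hc).symm, hv,
        connOp_not_right]
    · obtain ⟨a, ha, -, e⟩ := exists_cubeConn_apply_eq_of_pair (ε := ε) hc hj
      simp only [e, agree a ha]
  simpa using congrFun e s

end Pair

theorem not_injective_cubeConn_of_eq {d m : ℕ} {φ : Vertex m → Vertex (n + 2)}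
    (hφ : IsOrdered φ) {δ : Vertex d → Vertex m} (hδ : IsOrdered δ) {p t : Fin m}
    (hp : ∀ v, φ v k.succ = v p) (ht : IsEssential (fun v => φ v k.castSucc) t) {s s' : Fin d}
    (hs : ∀ v, δ v p = v s) (hs' : ∀ v, δ v t = v s') (hu : ∀ v, φ (δ v) k.castSucc = ε) :
    ¬ Function.Injective fun v => cubeConn k ε (φ (δ v)) := by
  have hpe : IsEssential (fun v => φ v k.succ) p := by simp only [hp, isEssential_proj]
  have hss : s' < s := hδ (hφ Fin.castSucc_lt_succ ht hpe)
    (by simp only [hs', isEssential_proj]) (by simp only [hs, isEssential_proj])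
  refine not_injective_of_not_isEssential (s := s') fun h => ?_
  obtain ⟨j, hj⟩ := h.exists_coord
  by_cases hjk : j = k
  · subst hjk
    simp only [cubeConn_same, hu, hp, hs, connOp_unit_left, isEssential_proj] at hj
    exact hss.ne hj
  · obtain ⟨a, ha, -, e⟩ := exists_cubeConn_apply_eq hjk ε
    simp only [e] at hj
    exact ha (hφ.eq_of_isEssential
      (hδ.isEssential_of_comp (g := fun v => φ v a) hs' hj) ht)

/-- The maps which lie in the boundary after applying the connection `γ_{k,ε}`: some coordinate of
the composite is constant. -/
def HasConstantConn (k : Fin (n + 1)) (ε : Bool) {m : ℕ} (φ : Vertex m → Vertex (n + 2)) : Prop :=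
  ∃ j b, ∀ v, cubeConn k ε (φ v) j = b

theorem HasConstantConn.comp {d m : ℕ} {φ : Vertex m → Vertex (n + 2)}
    (h : HasConstantConn k ε φ) (f : Vertex d → Vertex m) : HasConstantConn k ε fun v => φ (f v) :=
  let ⟨j, b, hb⟩ := h
  ⟨j, b, fun _ => hb _⟩

section Pair

variable (hc : s(c, c') = s(k.castSucc, k.succ))

include hc

theorem hasConstantConn_of_eq_not {m : ℕ} {φ : Vertex m → Vertex (n + 2)}
    (h : ∀ v, φ v c = !ε) : HasConstantConn k ε φ :=
  ⟨k, !ε, fun v => by rw [cubeConn_same_of_pair hc, h, connOp_not_left]⟩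

theorem IsElementary.proj_or_eq {m : ℕ} {φ : Vertex m → Vertex (n + 2)}
    (h : IsElementary fun v => φ v c) (hB : ¬ HasConstantConn k ε φ) :
    (∃ p, ∀ v, φ v c = v p) ∨ ∀ v, φ v c = ε := by
  rcases h with ⟨b, hb⟩ | hp
  · rcases Bool.eq_or_eq_not b ε with rfl | rfl
    · exact Or.inr hb
    · exact (hB (hasConstantConn_of_eq_not hc hb)).elim
  · exact Or.inl hp

theorem HasConstantConn.of_comp_cubeFace {m : ℕ} {φ : Vertex (m + 1) → Vertex (n + 2)}
    (hφ : IsOrdered φ) {p : Fin (m + 1)} (hp : ∀ v, φ v c = v p)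
    (h : HasConstantConn k ε fun v => φ (cubeFace p ε v)) :
    HasConstantConn k ε φ ∨ ∀ v, φ v c' = ε := by
  obtain ⟨j, b, hb : ∀ v, cubeConn k ε (φ (cubeFace p ε v)) j = b⟩ := h
  by_cases hj : j = k
  · have hc' : ∀ v, φ v c' = b := fun v => by
      rw [← hφ.apply_cubeFace_cubeDegen_of_ne hp (ne_of_pair hc).symm ε, ← hb (cubeDegen p v), hj,
        cubeConn_same_of_pair hc, hp, cubeFace_same, connOp_unit_left]
    rcases Bool.eq_or_eq_not b ε with rfl | rfl
    · exact Or.inr hc'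
    · exact Or.inl (hasConstantConn_of_eq_not (Sym2.eq_swap.trans hc) hc')
  · obtain ⟨a, ha, -, e⟩ := exists_cubeConn_apply_eq_of_pair (ε := ε) hc hj
    refine Or.inl ⟨j, b, fun v => ?_⟩
    rw [e, ← hφ.apply_cubeFace_cubeDegen_of_ne hp ha ε, ← hb (cubeDegen p v), e]

end Pair

/-- The sieve of maps whose coordinates from `l` on are elementary, together with those that lie in
the boundary after applying the connection. -/
def elementaryFrom (k : Fin (n + 1)) (ε : Bool) (l : Fin (n + 2)) : CubeSieve (n + 2) where
  mem φ := HasConstantConn k ε φ ∨ ∀ a, l ≤ a → IsElementary fun v => φ v a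
  comp hf h := h.imp (fun h => h.comp _) fun h a ha => (h a ha).comp hf.isElementary

/-- The subsieve of `elementaryFrom k ε k.castSucc` of the maps with coordinate `k.succ` constant at
the unit of the connection, again together with those that lie in the boundary after applying the
connection. -/
def unitSieve (k : Fin (n + 1)) (ε : Bool) : CubeSieve (n + 2) where
  mem φ := HasConstantConn k ε φ ∨
    ((∀ a, k.castSucc ≤ a → IsElementary fun v => φ v a) ∧ ∀ v, φ v k.succ = ε)
  comp hf h := h.imp (fun h => h.comp _)
    fun h => ⟨fun a ha => (h.1 a ha).comp hf.isElementary, fun _ => h.2 _⟩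

section Proj

variable {m : ℕ} {φ : Vertex (m + 1) → Vertex (n + 2)} {p q : Fin (m + 1)}

theorem exists_proj_of_not_mem_unitSieve (hT : (elementaryFrom k ε k.castSucc).mem φ)
    (hS : ¬ (unitSieve k ε).mem φ) : ∃ q, ∀ v, φ v k.succ = v q := by
  have hB : ¬ HasConstantConn k ε φ := fun h => hS (Or.inl h)
  have hE := hT.resolve_left hB
  exact ((hE k.succ Fin.castSucc_lt_succ.le).proj_or_eq Sym2.eq_swap hB).resolve_right
    fun h => hS (Or.inr ⟨hE, h⟩)

theorem not_injective_of_isCritical_of_proj (hφ : IsOrdered φ) (hess : ∀ s, IsEssential φ s)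
    (hp : ∀ v, φ v k.castSucc = v p) (hq : ∀ v, φ v k.succ = v q) {d : ℕ}
    {δ : (⟨d⟩ : CubeCat ∅) ⟶ ⟨m + 1⟩} (hδ : CubeCat.IsCritical p ε δ) :
    ¬ Function.Injective fun v => cubeConn k ε (φ (δ.1 v)) := by
  have hpq : p ⋖ q := hφ.covBy hess (castSucc_covBy_succ k) hp hq
  obtain ⟨s, hs⟩ := hδ.exists_apply_eq
  obtain ⟨v, hv⟩ := (forall_eq_or_exists_eq_not (fun v => δ.1 v q) ε).resolve_left fun h =>
    hδ.high ⟨q, hpq.lt, h, fun _ h₁ h₂ => (hpq.2 h₁ h₂).elim⟩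
  exact not_injective_cubeConn_of_eq_not rfl (hφ.comp δ.2.isOrdered) (s := s)
    (by simp only [hp, hs, isEssential_proj]) ((hq _).trans hv)

theorem not_injective_comp_cubeFace_of_proj (hφ : IsOrdered φ) (hess : ∀ s, IsEssential φ s)
    (hp : ∀ v, φ v k.castSucc = v p) (hq : ∀ v, φ v k.succ = v q)
    (hy : ¬ Function.Injective fun v => cubeConn k ε (φ (cubeFace p ε v))) {j : Fin (m + 1)}
    {η : Bool} (hne : (j, η) ≠ (p, ε)) :
    ¬ Function.Injective fun v => cubeConn k ε (φ (cubeFace j η v)) := by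
  obtain ⟨r, rfl, rfl⟩ := hφ.exists_eq_castSucc_succ hess hp hq
  have hψ := hφ.comp (isOrdered_cubeFace j η)
  by_cases hj : r.castSucc = j
  · subst hj
    obtain rfl : η = !ε := Bool.eq_not.2 fun h => hne (h ▸ rfl)
    refine not_injective_cubeConn_of_eq_not Sym2.eq_swap hψ (s := r) ?_ (v := fun _ => false) ?_
    · simp only [hq, ← Fin.succAbove_castSucc_self r, cubeFace_succAbove, isEssential_proj]
    · rw [hp, cubeFace_same]
  obtain ⟨s, hs⟩ := Fin.exists_succAbove_eq hj
  rcases forall_eq_or_exists_eq_not (fun v => cubeFace j η v r.succ) ε with h | ⟨v, hv⟩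
  · obtain rfl : r.succ = j := by
      by_contra hqj
      obtain ⟨u, hu⟩ := Fin.exists_succAbove_eq hqj
      rw [← hu] at h
      exact Bool.not_ne_self ε ((cubeFace_succAbove j η (fun _ => !ε) u).symm.trans (h _))
    obtain rfl : η = ε := by simpa only [cubeFace_same] using h fun _ => ε
    have e : ∀ v, cubeConn k η (φ (cubeFace r.succ η v)) =
        cubeConn k η (φ (cubeFace r.castSucc η v)) := fun v => by
      obtain _ | m := m
      · exact r.elim0
      · rw [← cubeConn_comp_cubeConn hφ hp hq η (cubeFace r.castSucc η v),
          cubeConn_cubeFace_castSucc]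
    simpa only [e] using hy
  · exact not_injective_cubeConn_of_eq_not rfl hψ (s := s)
      (by simp only [hp, ← hs, cubeFace_succAbove, isEssential_proj]) ((hq _).trans hv)

theorem isInsertionPair_unitSieve {A : Set Bool} :
    IsInsertionPair A (cubeConn k ε) (unitSieve k ε) (elementaryFrom k ε k.castSucc)
      k.castSucc ε where
  le _ h := h.imp_right And.left
  coord {_ φ} _ hT hS :=
    have hB : ¬ HasConstantConn k ε φ := fun h => hS (Or.inl h)
    (hT.resolve_left hB _ le_rfl).proj_or_eq rfl hB
  opposite _ _ _ hp := Or.inl (hasConstantConn_of_eq_not rfl fun _ => by rw [hp, cubeFace_same])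
  missing {_ φ _} hφ hT hS hp hm := by
    obtain ⟨q, hq⟩ := exists_proj_of_not_mem_unitSieve hT hS
    have hne : ¬ ∀ v, φ v k.succ = ε := fun h =>
      Bool.not_ne_self ε ((hq _).symm.trans (h fun _ => !ε))
    rcases hm with hB | ⟨-, hm⟩
    · exact (HasConstantConn.of_comp_cubeFace rfl hφ.isOrdered hp hB).elim
        (fun h => hS (Or.inl h)) hne
    · exact hne fun v => (hφ.isOrdered.apply_cubeFace_cubeDegen_of_ne hp
        Fin.castSucc_lt_succ.ne' ε v).symm.trans (hm _)
  insert hφ hp hT hS := Or.inr <|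
    isElementary_of_comp_cubeFace_of_le hφ.isOrdered hp (hT.resolve_left fun h => hS (Or.inl h))
  critical hφ hT hS hp hess _ _ hδ :=
    have ⟨_, hq⟩ := exists_proj_of_not_mem_unitSieve hT hS
    not_injective_of_isCritical_of_proj hφ.isOrdered hess hp hq hδ
  faces hφ hT hS hp hess hy _ _ hne :=
    have ⟨_, hq⟩ := exists_proj_of_not_mem_unitSieve hT hS
    not_injective_comp_cubeFace_of_proj hφ.isOrdered hess hp hq hy hne

end Proj

section NotElementary

variable {A : Set Bool} {m : ℕ} {φ : Vertex (m + 1) → Vertex (n + 2)} {p : Fin (m + 1)}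

theorem not_isElementary_of_not_mem_elementaryFrom (hT : (elementaryFrom k ε k.succ).mem φ)
    (hS : ¬ (elementaryFrom k ε k.castSucc).mem φ) : ¬ IsElementary fun v => φ v k.castSucc := by
  refine fun h => hS (hT.imp_right fun hE a ha => ?_)
  rcases ha.eq_or_lt with rfl | ha
  · exact h
  · exact hE a (Fin.castSucc_lt_iff_succ_le.1 ha)

theorem not_injective_of_isCritical_of_not_isElementary (hφ : IsCubeMap A φ)
    (hess : ∀ s, IsEssential φ s) (hne : ¬ IsElementary fun v => φ v k.castSucc)
    (hp : ∀ v, φ v k.succ = v p) {d : ℕ} {δ : (⟨d⟩ : CubeCat ∅) ⟶ ⟨m + 1⟩}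
    (hδ : CubeCat.IsCritical p ε δ) :
    ¬ Function.Injective fun v => cubeConn k ε (φ (δ.1 v)) := by
  obtain ⟨s, hs⟩ := hδ.exists_apply_eq
  rcases forall_eq_or_exists_eq_not (fun v => φ (δ.1 v) k.castSucc) ε with hu | ⟨v, hv⟩
  swap
  · exact not_injective_cubeConn_of_eq_not Sym2.eq_swap (hφ.isOrdered.comp δ.2.isOrdered) (s := s)
      (by simp only [hp, hs, isEssential_proj]) hv
  by_cases ht : ∃ t, IsEssential (fun v => φ v k.castSucc) t ∧ ∃ s', ∀ v, δ.1 v t = v s'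
  · obtain ⟨t, ht, s', hs'⟩ := ht
    exact not_injective_cubeConn_of_eq hφ.isOrdered δ.2.isOrdered hp ht hs hs' hu
  have hconst : ∀ t, IsEssential (fun v => φ v k.castSucc) t → ∀ {b : Bool},
      δ.1 (fun _ => false) t = b → ∀ v, δ.1 v t = b := fun t h b hb v => by
    obtain ⟨b', hb'⟩ := (δ.2.isElementary t).resolve_right fun h' => ht ⟨t, h, h'⟩
    exact (hb' v).trans ((hb' _).symm.trans hb)
  obtain ⟨t, ht, htε, hlast⟩ := exists_isEssential_eq_forall_gt_eq_not
    (fun v w h => hφ.monotone h k.castSucc) (hu fun _ => false)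
    ((forall_eq_or_exists_eq_not _ ε).resolve_left fun h => hne (Or.inl ⟨ε, h⟩))
  have htp : t < p := hφ.isOrdered Fin.castSucc_lt_succ ht (by simp only [hp, isEssential_proj])
  refine (hδ.low ⟨t, htp, hconst t ht htε, fun u htu hup => ?_⟩).elim
  have hue := hφ.isOrdered.isEssential_of_lt_of_lt (castSucc_covBy_succ k) ht hp (hess u) htu hup
  exact hconst u hue (hlast u hue htu)

theorem not_injective_comp_cubeFace_of_not_isElementary (hφ : IsCubeMap A φ)
    (hne : ¬ IsElementary fun v => φ v k.castSucc) (hp : ∀ v, φ v k.succ = v p) {j : Fin (m + 1)}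
    {η : Bool} (hj : (j, η) ≠ (p, ε)) :
    ¬ Function.Injective fun v => cubeConn k ε (φ (cubeFace j η v)) := by
  have hψ := hφ.isOrdered.comp (isOrdered_cubeFace j η)
  by_cases hpj : p = j
  · subst hpj
    obtain rfl : η = !ε := Bool.eq_not.2 fun h => hj (h ▸ rfl)
    obtain ⟨s, hs⟩ : ∃ s, IsEssential (fun v => φ (cubeFace p (!ε) v) k.castSucc) s := by
      by_contra! h
      exact hne (isElementary_of_comp_cubeFace hφ.isOrdered hp Fin.castSucc_lt_succ.ne
        (Or.inl ⟨_, fun v => eq_of_forall_not_isEssential h v fun _ => false⟩))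
    exact not_injective_cubeConn_of_eq_not rfl hψ hs (v := fun _ => false)
      ((hp _).trans (cubeFace_same _ _ _))
  obtain ⟨p, rfl⟩ := Fin.exists_succAbove_eq hpj
  rcases forall_eq_or_exists_eq_not (fun v => φ (cubeFace j η v) k.castSucc) ε with hu | ⟨v, hv⟩
  · obtain ⟨t, ht, htj⟩ : ∃ t, IsEssential (fun v => φ v k.castSucc) t ∧ t ≠ j := by
      by_contra! h
      exact hne (isElementary_of_monotone (fun v w h => hφ.monotone h _) j h)
    obtain ⟨t, rfl⟩ := Fin.exists_succAbove_eq htj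
    exact not_injective_cubeConn_of_eq hφ.isOrdered (isOrdered_cubeFace j η) hp ht
      (fun v => cubeFace_succAbove j η v p) (fun v => cubeFace_succAbove j η v t) hu
  · exact not_injective_cubeConn_of_eq_not Sym2.eq_swap hψ (s := p)
      (by simp only [hp, cubeFace_succAbove, isEssential_proj]) hv

theorem isInsertionPair_elementaryFrom :
    IsInsertionPair A (cubeConn k ε) (elementaryFrom k ε k.castSucc) (elementaryFrom k ε k.succ)
      k.succ ε where
  le _ h := h.imp_right fun h a ha => h a (Fin.castSucc_lt_succ.le.trans ha)
  coord {_ φ} _ hT hS :=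
    have hB : ¬ HasConstantConn k ε φ := fun h => hS (Or.inl h)
    (hT.resolve_left hB _ le_rfl).proj_or_eq Sym2.eq_swap hB
  opposite _ _ _ hp :=
    Or.inl (hasConstantConn_of_eq_not Sym2.eq_swap fun _ => by rw [hp, cubeFace_same])
  missing hφ hT hS hp hm := by
    have hne := not_isElementary_of_not_mem_elementaryFrom hT hS
    rcases hm with hB | hm
    · exact (HasConstantConn.of_comp_cubeFace Sym2.eq_swap hφ.isOrdered hp hB).elim
        (fun h => hS (Or.inl h)) fun h => hne (Or.inl ⟨ε, h⟩)
    · exact hne (isElementary_of_comp_cubeFace hφ.isOrdered hp Fin.castSucc_lt_succ.ne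
        (hm _ le_rfl))
  insert hφ hp hT hS := Or.inr <|
    isElementary_of_comp_cubeFace_of_le hφ.isOrdered hp (hT.resolve_left fun h => hS (Or.inl h))
  critical hφ hT hS hp hess _ _ hδ :=
    not_injective_of_isCritical_of_not_isElementary hφ hess
      (not_isElementary_of_not_mem_elementaryFrom hT hS) hp hδ
  faces hφ hT hS hp _ _ _ _ hne :=
    not_injective_comp_cubeFace_of_not_isElementary hφ
      (not_isElementary_of_not_mem_elementaryFrom hT hS) hp hne

end NotElementary

end Connection

/-! ### The filtration of the cube with connections -/

/-- Maps with a constant coordinate, or whose coordinates from `K` on are elementary. -/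
def cubeFiltration (n K : ℕ) : CubeSieve n where
  mem φ := (∃ j b, ∀ v, φ v j = b) ∨ ∀ j : Fin n, K ≤ j.val → IsElementary fun v => φ v j
  comp hf h := h.imp (fun ⟨j, b, h⟩ => ⟨j, b, fun _ => h _⟩)
    fun h j hj => (h j hj).comp hf.isElementary

theorem isElementary_cubeFace {n m : ℕ} {p a : Fin (n + 1)} {φ : Vertex m → Vertex n}
    (h : ∀ j, a ≤ p.succAbove j → IsElementary fun v => φ v j) (ε : Bool) (i : Fin (n + 1))
    (hi : a ≤ i) : IsElementary fun v => cubeFace p ε (φ v) i := by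
  rcases Fin.eq_self_or_eq_succAbove p i with rfl | ⟨j, rfl⟩
  · exact Or.inl ⟨ε, fun v => cubeFace_same _ _ _⟩
  · simpa only [cubeFace_succAbove] using h j hi

section Retract

variable {n m : ℕ} {k : Fin (n + 1)} {ε : Bool}

theorem hasConstantConn_cubeFace_succ {φ : Vertex m → Vertex (n + 1)}
    (h : ∃ j b, ∀ v, φ v j = b) : HasConstantConn k ε fun v => cubeFace k.succ ε (φ v) := by
  simpa only [HasConstantConn, cubeConn_cubeFace_succ] using h

theorem mem_unitSieve_cubeFace_succ {φ : Vertex m → Vertex (n + 1)}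
    (h : (cubeFiltration (n + 1) k).mem φ) :
    (unitSieve k ε).mem fun v => cubeFace k.succ ε (φ v) := by
  refine h.imp hasConstantConn_cubeFace_succ fun h =>
    ⟨isElementary_cubeFace (fun j hj => h j ?_) ε, fun v => cubeFace_same _ _ _⟩
  rwa [← Fin.succAbove_succ_self, Fin.succAbove_le_succAbove_iff] at hj

theorem mem_elementaryFrom_cubeFace_succ {φ : Vertex m → Vertex (n + 1)}
    (h : (cubeFiltration (n + 1) (k + 1)).mem φ) :
    (elementaryFrom k ε k.succ).mem fun v => cubeFace k.succ ε (φ v) := by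
  refine h.imp hasConstantConn_cubeFace_succ fun h =>
    isElementary_cubeFace (fun j hj => h j ?_) ε
  have hk : k.succ.succAbove k < k.succ.succAbove j :=
    (Fin.succAbove_succ_self k).trans_lt (Fin.castSucc_lt_succ.trans_le hj)
  exact Fin.succAbove_lt_succAbove_iff.1 hk

theorem mem_cubeFiltration_cubeConn_of_unitSieve {ψ : Vertex m → Vertex (n + 2)}
    (h : (unitSieve k ε).mem ψ) :
    (cubeFiltration (n + 1) k).mem fun v => cubeConn k ε (ψ v) := by
  refine h.imp_right fun ⟨h, hε⟩ j hj => ?_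
  rcases (Fin.le_def.2 hj).eq_or_lt with rfl | hj
  · simpa only [cubeConn_same, hε, connOp_unit_right] using h _ le_rfl
  · simpa only [cubeConn_gt hj] using
      h _ (Fin.castSucc_lt_succ.le.trans (Fin.succ_le_succ_iff.2 hj.le))

theorem mem_cubeFiltration_cubeConn_of_elementaryFrom {ψ : Vertex m → Vertex (n + 2)}
    (h : (elementaryFrom k ε k.succ).mem ψ) :
    (cubeFiltration (n + 1) (k + 1)).mem fun v => cubeConn k ε (ψ v) := by
  refine h.imp_right fun h j hj => ?_
  have hkj : k < j := hj
  simpa only [cubeConn_gt hkj] using h _ (Fin.succ_le_succ_iff.2 hkj.le)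

end Retract

theorem cubeFiltration_mono {n K L m : ℕ} (h : K ≤ L) {φ : Vertex m → Vertex n}
    (hφ : (cubeFiltration n K).mem φ) : (cubeFiltration n L).mem φ :=
  hφ.imp_right fun hφ j hj => hφ j (h.trans hj)

namespace MarkedCubicalSet

variable {A : Set Bool}

/-- The map of complexes induced by a map between cubes. -/
def sieveMap {N N' M M' : ℕ} {g : Vertex N → Vertex M}
    {g' : Vertex N' → Vertex M'} {S : CubeSieve N} {S' : CubeSieve N'}
    (u : (⟨N⟩ : CubeCat A) ⟶ ⟨N'⟩)
    (hS : ∀ {m : ℕ} {φ : Vertex m → Vertex N}, S.mem φ → S'.mem fun v => u.1 (φ v))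
    (hg : ∀ {m : ℕ} {φ : Vertex m → Vertex N}, (¬ Function.Injective fun v => g (φ v)) →
      ¬ Function.Injective fun v => g' (u.1 (φ v))) :
    (markedCube A N g).regular (sieveSub A S) ⟶ (markedCube A N' g').regular (sieveSub A S') where
  map := { app c := ↾fun φ => ⟨(show (⟨c.unop.dim⟩ : CubeCat A) ⟶ ⟨N⟩ from φ.1) ≫ u, hS φ.2⟩ }
  marked h := hg h

/-- The step from `k` to `k + 1` of the filtration as a retract, along the face `∂_{k+1,ε}` and the
connection `γ_{k,ε}`, of an inclusion of subcomplexes of the `(n + 2)`-cube. -/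
def cubeFiltrationRetract {n : ℕ} (k : Fin (n + 1)) {ε : Bool} (hε : ε ∈ A)
    (hle : sieveSub A (cubeFiltration (n + 1) k) ≤ sieveSub A (cubeFiltration (n + 1) (k + 1)))
    (hle' : sieveSub A (unitSieve k ε) ≤ sieveSub A (elementaryFrom k ε k.succ)) :
    RetractArrow ((markedCube A (n + 1) fun v => v).regularHomOfLE hle)
      ((markedCube A (n + 2) (cubeConn k ε)).regularHomOfLE hle') where
  i := Arrow.homMk
    (sieveMap (CubeCat.face k.succ ε) mem_unitSieve_cubeFace_succ
      fun h => by simpa only [CubeCat.face, cubeConn_cubeFace_succ] using h)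
    (sieveMap (CubeCat.face k.succ ε) mem_elementaryFrom_cubeFace_succ
      fun h => by simpa only [CubeCat.face, cubeConn_cubeFace_succ] using h) rfl
  r := Arrow.homMk
    (sieveMap (CubeCat.conn k ε hε) mem_cubeFiltration_cubeConn_of_unitSieve id)
    (sieveMap (CubeCat.conn k ε hε) mem_cubeFiltration_cubeConn_of_elementaryFrom id) rfl
  retract := by
    have conn_face : ∀ {c : CubeCat A} (φ : c ⟶ ⟨n + 1⟩),
        (φ ≫ CubeCat.face k.succ ε) ≫ CubeCat.conn k ε hε = φ := fun φ =>
      Subtype.ext (funext fun v => cubeConn_cubeFace_succ k ε (φ.1 v))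
    ext1
    · ext1
      ext c φ
      exact Subtype.ext (conn_face _)
    · ext1
      ext c φ
      exact Subtype.ext (conn_face _)

theorem sieveSub_cubeFiltration_mono (A : Set Bool) (n : ℕ) :
    Monotone fun K => sieveSub A (cubeFiltration n K) := fun _ _ h =>
  sieveSub_mono A fun _ _ => cubeFiltration_mono h

section Saturated

variable {W : MorphismProperty (MarkedCubicalSet ∅)}

theorem regularHomOfLE_mem_of_eq [W.ContainsIdentities] {X : MarkedCubicalSet ∅}
    {S T : Subfunctor X.cubes} (h : S = T) : W (X.regularHomOfLE h.le) := by
  subst h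
  exact W.id_mem _

variable [W.IsStableUnderCobaseChange] [MorphismProperty.IsStableUnderTransfiniteComposition.{0} W]
  [W.IsStableUnderRetracts]

theorem regularHomOfLE_cubeFiltration_succ_mem (hW : comicalGenerators ∅ ≤ W) {n : ℕ}
    (k : Fin (n + 1)) {ε : Bool} (hε : ε ∈ A) :
    W ((markedCube A (n + 1) fun v => v).regularHomOfLE
      (sieveSub_cubeFiltration_mono A (n + 1) k.val.le_succ)) := by
  have hU : IsInsertionPair A (cubeConn k ε) (unitSieve k ε) _ _ _ := isInsertionPair_unitSieve
  have hE : IsInsertionPair A (cubeConn k ε) (elementaryFrom k ε k.castSucc) _ _ _ :=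
    isInsertionPair_elementaryFrom
  have hle := sieveSub_mono A fun _ => hU.le
  have hle' := sieveSub_mono A fun _ => hE.le
  exact MorphismProperty.of_retract (cubeFiltrationRetract k hε _ (hle.trans hle'))
    (W.comp_mem _ _ (hU.regularHomOfLE_mem hW hle) (hE.regularHomOfLE_mem hW hle'))

theorem regularHomOfLE_cubeFiltration_mem (hW : comicalGenerators ∅ ≤ W) (hA : A.Nonempty)
    (n : ℕ) : ∀ K ≤ n, W ((markedCube A n fun v => v).regularHomOfLE
      (sieveSub_cubeFiltration_mono A n K.zero_le)) := by
  obtain ⟨ε, hε⟩ := hA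
  intro K
  induction K with
  | zero => exact fun _ => W.id_mem _
  | succ K ih =>
    intro hK
    obtain _ | n := n
    · exact absurd hK K.not_succ_le_zero
    · exact W.comp_mem _ _ (ih (K.le_succ.trans hK))
        (regularHomOfLE_cubeFiltration_succ_mem hW ⟨K, hK⟩ hε)

theorem regularHomOfLE_cubeFiltration_top_mem (hW : comicalGenerators ∅ ≤ W) (n : ℕ) :
    W ((markedCube A n fun v => v).regularHomOfLE
      (le_top : sieveSub A (cubeFiltration n 0) ≤ ⊤)) := by
  obtain rfl | hA := A.eq_empty_or_nonempty
  · refine regularHomOfLE_mem_of_eq (top_le_iff.1 fun c φ _ => Or.inr fun j _ => ?_)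
    exact (Subtype.property (p := IsCubeMap ∅) φ).isElementary j
  · have htop : sieveSub A (cubeFiltration n n) = ⊤ :=
      top_le_iff.1 fun c φ _ => Or.inr fun j hj => (hj.not_gt j.2).elim
    exact W.comp_mem _ _ (regularHomOfLE_cubeFiltration_mem hW hA n n le_rfl)
      (regularHomOfLE_mem_of_eq htop)

end Saturated

/-! ### The corner inclusion -/

theorem mem_marked_stdCube_iff {n : ℕ} {c : CubeCat A} (φ : c ⟶ (⟨n⟩ : CubeCat A)) :
    φ ∈ (stdCube A n).marked c ↔ ¬ Function.Injective φ.1 := by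
  rw [← φ.2.isDegenerateMap_iff, ← isDegenerate_iff_isDegenerateMap]
  exact ⟨fun h => h.resolve_right fun h => h.2, Or.inl⟩

/-- The standard cube of `□_∅` in the bottom of the filtration. -/
def stdCubeToFiltration (A : Set Bool) (n : ℕ) :
    stdCube ∅ n ⟶ (markedCube A n fun v => v).regular (sieveSub A (cubeFiltration n 0)) where
  map := { app c := ↾fun φ => ⟨(CubeCat.incl (Set.empty_subset A)).map φ,
    Or.inr fun j _ => (Subtype.property (p := IsCubeMap ∅) φ).isElementary j⟩ }
  marked {_ φ} h := (mem_marked_stdCube_iff φ).1 h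

/-- The boundary of the cube of `□_A` in the bottom of the filtration. -/
def boundaryToFiltration (A : Set Bool) (n : ℕ) :
    (iStar (Set.empty_subset A)).obj (boundary A n) ⟶
      (markedCube A n fun v => v).regular (sieveSub A (cubeFiltration n 0)) where
  map := { app c := ↾fun φ => ⟨φ.1, Or.inl (by
    obtain ⟨j, ε, -, h⟩ := mem_faceUnion_iff.1 φ.2
    exact ⟨j, ε, h⟩)⟩ }
  marked {_ φ} h := (mem_marked_stdCube_iff φ.1).1 h

theorem exists_stdCubeToFiltration_or_boundaryToFiltration_eq {n : ℕ} {c : CubeCat ∅}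
    (x : ((markedCube A n fun v => v).regular (sieveSub A (cubeFiltration n 0))).cubes.obj (op c)) :
    (∃ y, (stdCubeToFiltration A n).map.app (op c) y = x) ∨
      ∃ y, (boundaryToFiltration A n).map.app (op c) y = x := by
  obtain ⟨φ, ⟨j, b, h⟩ | h⟩ := x
  · exact Or.inr ⟨⟨φ, mem_faceUnion_iff.2 ⟨j, b, trivial, h⟩⟩, rfl⟩
  · exact Or.inl ⟨⟨_, isCubeMap_of_isElementary (fun j => h j (Nat.zero_le _))
      (Subtype.property (p := IsCubeMap A) φ).isOrdered⟩, rfl⟩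

theorem isPushout_cubeFiltration (n : ℕ) :
    IsPushout (boundaryι ∅ n) (boundaryToIStar (Set.empty_subset A) n) (stdCubeToFiltration A n)
      (boundaryToFiltration A n) := by
  refine isPushout_of_cover rfl ?_ ?_
    (fun c => exists_stdCubeToFiltration_or_boundaryToFiltration_eq) ?_ ?_ ?_
  · intro c φ ψ h
    exact Subtype.ext (Subtype.ext (congrArg (fun x => x.1.1) h))
  · intro c φ ψ h
    exact Subtype.ext (congrArg (fun x => x.1.1) h)
  · intro c φ ψ h
    obtain ⟨j, ε, -, hj⟩ := mem_faceUnion_iff.1 ψ.2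
    have e : φ.1 = ψ.1.1 := congrArg (fun x => x.1.1) h
    refine ⟨⟨φ, mem_faceUnion_iff.2 ⟨j, ε, trivial, fun v => ?_⟩⟩, Subtype.ext (Subtype.ext e)⟩
    exact (congrFun (congrFun e v) j).trans (hj v)
  · intro c φ ψ _ _ h
    exact Subtype.ext (congrArg (fun x => x.1) h)
  · intro c x hx
    rcases exists_stdCubeToFiltration_or_boundaryToFiltration_eq x with ⟨y, rfl⟩ | ⟨y, rfl⟩
    · exact Or.inr (Or.inl ⟨y, (mem_marked_stdCube_iff y).2 hx, rfl⟩)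
    · exact Or.inr (Or.inr ⟨y, (mem_marked_stdCube_iff y.1).2 hx, rfl⟩)

/-- The top of the filtration is `i^* □_A^n`. -/
def filtrationIso (A : Set Bool) (n : ℕ) :
    (markedCube A n fun v => v).regular ⊤ ≅ (iStar (Set.empty_subset A)).obj (stdCube A n) where
  hom :=
    { map := { app c := ↾fun φ => φ.1 }
      marked {_ φ} h := (mem_marked_stdCube_iff φ.1).2 h }
  inv :=
    { map := { app c := ↾fun φ => ⟨φ, trivial⟩ }
      marked {_ φ} h := (mem_marked_stdCube_iff φ).1 h }

theorem comical_cornerInclusion (A : Set Bool) (n : ℕ) :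
    comical ∅ (cornerInclusion (Set.empty_subset A) n) := by
  intro W hW _ _ _
  have h := isPushout_cubeFiltration (A := A) n
  have e : cornerInclusion (Set.empty_subset A) n = h.isoPushout.inv ≫
      (markedCube A n fun v => v).regularHomOfLE le_top ≫ (filtrationIso A n).hom := by
    apply pushout.hom_ext
    · rw [cornerInclusion, pushout.inl_desc, h.inl_isoPushout_inv_assoc]
      rfl
    · rw [cornerInclusion, pushout.inr_desc, h.inr_isoPushout_inv_assoc]
      rfl
  rw [e]
  exact (W.cancel_left_of_respectsIso _ _).2
    ((W.cancel_right_of_respectsIso _ _).2 (regularHomOfLE_cubeFiltration_top_mem hW n))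

end MarkedCubicalSet
/-! ### The left adjoint on cubes and their boundaries -/

namespace CubeCat

/-- The idempotent of the cube which sets the coordinate `j` to `ε`. -/
def setCoord (A : Set Bool) {n : ℕ} (j : Fin n) (ε : Bool) : (⟨n⟩ : CubeCat A) ⟶ ⟨n⟩ :=
  ⟨fun v => Function.update v j ε, by
    obtain _ | n := n
    · exact j.elim0
    · simp only [← cubeFace_cubeDegen]
      exact (IsCubeMap.degen j).comp (.face j ε)⟩

theorem setCoord_comm {A : Set Bool} {n : ℕ} {j j' : Fin n} (h : j ≠ j') (ε ε' : Bool) :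
    setCoord A j ε ≫ setCoord A j' ε' = setCoord A j' ε' ≫ setCoord A j ε :=
  Subtype.ext (funext fun _ => Function.update_comm h _ _ _)

theorem comp_setCoord {A : Set Bool} {n : ℕ} {c : CubeCat A} {φ : c ⟶ ⟨n⟩} {j : Fin n} {ε : Bool}
    (h : ∀ v, φ.1 v j = ε) : φ ≫ setCoord A j ε = φ :=
  Subtype.ext (funext fun v => by
    change Function.update (φ.1 v) j ε = φ.1 v
    rw [← h v, Function.update_eq_self])

end CubeCat

namespace MarkedCubicalSet

open CubeCat

variable {A B : Set Bool} {h : A ⊆ B} {n : ℕ}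

/-- The map `k : X ⟶ i^* T` exhibits `T` as `i_! X`: every map from `X` to some `i^* Z` factors
uniquely through it. -/
def IsUniversalArrow (h : A ⊆ B) {X : MarkedCubicalSet A} {T : MarkedCubicalSet B}
    (k : X ⟶ (iStar h).obj T) : Prop :=
  ∀ Z, Function.Bijective fun u : T ⟶ Z => k ≫ (iStar h).map u

theorem isUniversalArrow_cubeToIStar : IsUniversalArrow h (cubeToIStar h n) := by
  refine fun Z => ⟨fun u u' e => ?_, fun g => ?_⟩
  · ext1
    refine yonedaEquiv.injective ?_
    exact ConcreteCategory.congr_hom (congr_app (congrArg Hom.map e) (op ⟨n⟩))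
      (𝟙 (⟨n⟩ : CubeCat A))
  · let u : stdCube B n ⟶ Z :=
      { map := yonedaEquiv.symm (g.map.app (op ⟨n⟩) (𝟙 (⟨n⟩ : CubeCat A)))
        marked {c φ} hφ := Z.degenerate ((hφ.resolve_right fun hφ => hφ.2).app _) }
    refine ⟨u, ?_⟩
    ext1
    refine yonedaEquiv.injective ?_
    exact ConcreteCategory.congr_hom (Z.cubes.map_id (op ⟨n⟩)) _

/-- The map `setCoord A j ε` as an `n`-cube of the boundary. -/
def boundarySetCoord (A : Set Bool) (j : Fin n) (ε : Bool) : (boundary A n).cubes.obj (op ⟨n⟩) :=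
  ⟨setCoord A j ε, mem_faceUnion_iff.2 ⟨j, ε, trivial, fun _ => Function.update_self ..⟩⟩

theorem map_boundarySetCoord {c : CubeCat A} {φ : c ⟶ ⟨n⟩}
    (hφ : φ ∈ (faceUnion A n fun _ _ => True).obj (op c)) {j : Fin n} {ε : Bool}
    (hj : ∀ v, φ.1 v j = ε) :
    (boundary A n).cubes.map φ.op (boundarySetCoord A j ε) = ⟨φ, hφ⟩ :=
  Subtype.ext (comp_setCoord hj)

theorem boundary_hom_ext {Z : MarkedCubicalSet A} {u u' : boundary A n ⟶ Z}
    (e : ∀ j ε, u.map.app (op ⟨n⟩) (boundarySetCoord A j ε) =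
      u'.map.app (op ⟨n⟩) (boundarySetCoord A j ε)) : u = u' := by
  ext1
  ext ⟨c⟩ ⟨φ, hφ⟩
  obtain ⟨j, ε, -, hj⟩ := mem_faceUnion_iff.1 hφ
  have app_eq (v : boundary A n ⟶ Z) : v.map.app (op c) ⟨φ, hφ⟩ =
      Z.cubes.map (Quiver.Hom.op (X := c) (Y := ⟨n⟩) φ)
        (v.map.app (op ⟨n⟩) (boundarySetCoord A j ε)) :=
    (congrArg (v.map.app (op c)) (map_boundarySetCoord hφ hj).symm).trans
      (NatTrans.naturality_apply v.map _ _)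
  exact (app_eq u).trans ((congrArg _ (e j ε)).trans (app_eq u').symm)

section BoundaryExtend

variable {X : MarkedCubicalSet A} {Z : MarkedCubicalSet B} {c : CubeCat B}

theorem map_app_map_setCoord (g : X ⟶ (iStar h).obj Z) {φ : c ⟶ ⟨n⟩} {j : Fin n} {ε : Bool}
    (hj : ∀ v, φ.1 v j = ε) (x : X.cubes.obj (op ⟨n⟩)) :
    Z.cubes.map φ.op (g.map.app (op ⟨n⟩) (X.cubes.map (setCoord A j ε).op x)) =
      Z.cubes.map φ.op (g.map.app (op ⟨n⟩) x) := by
  conv_rhs => rw [← comp_setCoord hj]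
  rw [NatTrans.naturality_apply]
  exact (ConcreteCategory.congr_hom (Z.cubes.map_comp _ _) _).symm

theorem map_app_boundarySetCoord_eq (g : boundary A n ⟶ (iStar h).obj Z) {φ : c ⟶ ⟨n⟩}
    {j j' : Fin n} {ε ε' : Bool} (hj : ∀ v, φ.1 v j = ε) (hj' : ∀ v, φ.1 v j' = ε') :
    Z.cubes.map φ.op (g.map.app (op ⟨n⟩) (boundarySetCoord A j ε)) =
      Z.cubes.map φ.op (g.map.app (op ⟨n⟩) (boundarySetCoord A j' ε')) := by
  obtain rfl | hne := eq_or_ne j j'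
  · obtain rfl : ε = ε' := (hj fun _ => false).symm.trans (hj' _)
    rfl
  rw [← map_app_map_setCoord g hj', ← map_app_map_setCoord g hj (boundarySetCoord A j' ε')]
  refine congrArg (fun x => Z.cubes.map φ.op (g.map.app (op ⟨n⟩) x)) (Subtype.ext ?_)
  exact setCoord_comm hne.symm ε' ε

/-- The extension of `g` to a cube `φ` of `∂□_B^n`: as `φ` has a constant coordinate, it is the
restriction along `φ` of some `boundarySetCoord A j ε`. -/
noncomputable def boundaryExtendApp (g : boundary A n ⟶ (iStar h).obj Z)
    (φ : (boundary B n).cubes.obj (op c)) : Z.cubes.obj (op c) :=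
  let hφ := mem_faceUnion_iff.1 φ.2
  Z.cubes.map (Quiver.Hom.op (X := c) (Y := ⟨n⟩) φ.1)
    (g.map.app (op ⟨n⟩) (boundarySetCoord A hφ.choose hφ.choose_spec.choose))

theorem boundaryExtendApp_eq (g : boundary A n ⟶ (iStar h).obj Z) {φ : c ⟶ ⟨n⟩}
    (hφ : φ ∈ (faceUnion B n fun _ _ => True).obj (op c)) {j : Fin n} {ε : Bool}
    (hj : ∀ v, φ.1 v j = ε) : boundaryExtendApp g ⟨φ, hφ⟩ =
      Z.cubes.map φ.op (g.map.app (op ⟨n⟩) (boundarySetCoord A j ε)) :=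
  map_app_boundarySetCoord_eq g (mem_faceUnion_iff.1 hφ).choose_spec.choose_spec.2 hj

/-- The extension of a map defined on `∂□_A^n` to `∂□_B^n`. -/
noncomputable def boundaryExtend (g : boundary A n ⟶ (iStar h).obj Z) : boundary B n ⟶ Z where
  map :=
    { app c := ↾fun φ => boundaryExtendApp (c := c.unop) g φ
      naturality c d f := by
        ext ⟨φ, hφ⟩
        obtain ⟨j, ε, -, hj⟩ := mem_faceUnion_iff.1 hφ
        refine (boundaryExtendApp_eq g _ fun v => hj (f.unop.1 v)).trans ?_
        refine (ConcreteCategory.congr_hom (Z.cubes.map_comp _ f) _).trans ?_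
        exact congrArg (Z.cubes.map f) (boundaryExtendApp_eq g hφ hj).symm }
  marked {c φ} hφ := Z.degenerate (isDegenerate_map (c := c) (d := ⟨n⟩) φ.1
    ((isDegenerate_iff_isDegenerateMap _).1 (hφ.resolve_right fun hφ => hφ.2)) _)

theorem isUniversalArrow_boundaryToIStar : IsUniversalArrow h (boundaryToIStar h n) := by
  refine fun Z => ⟨fun u u' e => boundary_hom_ext fun j ε => ?_, fun g =>
    ⟨boundaryExtend g, boundary_hom_ext fun j ε => ?_⟩⟩
  · exact ConcreteCategory.congr_hom (congr_app (congrArg Hom.map e) (op ⟨n⟩))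
      (boundarySetCoord A j ε)
  · have hj : ∀ v, (setCoord A j ε).1 v j = ε := fun _ => Function.update_self ..
    refine (boundaryExtendApp_eq (φ := setCoord B j ε) g _ hj).trans ?_
    refine (NatTrans.naturality_apply g.map (setCoord A j ε).op _).symm.trans ?_
    exact congrArg _ (map_boundarySetCoord _ hj)

end BoundaryExtend

section UniversalArrow

variable {X X' : MarkedCubicalSet A} {T T' : MarkedCubicalSet B} {k : X ⟶ (iStar h).obj T}
  {k' : X' ⟶ (iStar h).obj T'}

theorem IsUniversalArrow.isIso_homEquiv_symm (hk : IsUniversalArrow h k) :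
    IsIso (((iAdj h).homEquiv X T).symm k) := by
  refine isIso_of_coyoneda_map_bijective _ fun Z => ?_
  refine (((iAdj h).homEquiv X Z).comp_bijective _).1 ?_
  convert hk Z using 1
  ext1 u
  simp only [Function.comp_apply, Adjunction.homEquiv_naturality_right, Equiv.apply_symm_apply]

/-- The comparison isomorphism `i_! X ≅ T` given by a universal map `X ⟶ i^* T`. -/
noncomputable def IsUniversalArrow.iso (hk : IsUniversalArrow h k) : (iShriek h).obj X ≅ T :=
  haveI := hk.isIso_homEquiv_symm
  asIso (((iAdj h).homEquiv X T).symm k)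

theorem IsUniversalArrow.unit_comp_map_iso_hom (hk : IsUniversalArrow h k) :
    (iAdj h).unit.app X ≫ (iStar h).map hk.iso.hom = k :=
  ((iAdj h).homEquiv_unit ..).symm.trans (Equiv.apply_symm_apply _ _)

theorem IsUniversalArrow.comp_map_iso_inv (hk : IsUniversalArrow h k) :
    k ≫ (iStar h).map hk.iso.inv = (iAdj h).unit.app X :=
  (Iso.comp_inv_eq ((iStar h).mapIso hk.iso)).2 hk.unit_comp_map_iso_hom.symm

theorem IsUniversalArrow.map_comp_iso_hom (hk : IsUniversalArrow h k)
    (hk' : IsUniversalArrow h k') {s : X ⟶ X'} {t : T ⟶ T'}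
    (w : k ≫ (iStar h).map t = s ≫ k') :
    (iShriek h).map s ≫ hk'.iso.hom = hk.iso.hom ≫ t := by
  apply ((iAdj h).homEquiv _ _).injective
  rw [Adjunction.homEquiv_naturality_left, Adjunction.homEquiv_naturality_right,
    Adjunction.homEquiv_unit, Adjunction.homEquiv_unit, hk.unit_comp_map_iso_hom,
    hk'.unit_comp_map_iso_hom, w]

attribute [ext] WeakConnectionStructure

variable {Y Y' : MarkedCubicalSet A} {f : X ⟶ Y}

/-- Along a universal arrow `k : X ⟶ i^* T`, weak connection structures on `f : X ⟶ Y` correspond to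
extensions of `f` to `i^* T`. -/
noncomputable def IsUniversalArrow.weakConnectionEquiv (hk : IsUniversalArrow h k) (f : X ⟶ Y) :
    WeakConnectionStructure h f ≃ {G : (iStar h).obj T ⟶ Y // k ≫ G = f} where
  toFun G := ⟨(iStar h).map hk.iso.inv ≫ G.Γ, by
    rw [← Category.assoc, hk.comp_map_iso_inv, G.unit_comp]⟩
  invFun G := ⟨(iStar h).map hk.iso.hom ≫ G.1, by
    rw [← Category.assoc, hk.unit_comp_map_iso_hom, G.2]⟩
  left_inv G := by
    ext1
    exact ((iStar h).mapIso hk.iso).hom_inv_id_assoc _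
  right_inv G := Subtype.ext (((iStar h).mapIso hk.iso).inv_hom_id_assoc _)

theorem IsUniversalArrow.weakConnectionEquiv_postcomp (hk : IsUniversalArrow h k)
    (G : WeakConnectionStructure h f) (g : Y ⟶ Y') :
    (hk.weakConnectionEquiv _ (G.postcomp g)).1 = (hk.weakConnectionEquiv _ G).1 ≫ g :=
  (Category.assoc _ _ _).symm

theorem IsUniversalArrow.weakConnectionEquiv_precomp (hk : IsUniversalArrow h k)
    (hk' : IsUniversalArrow h k') {f : X' ⟶ Y} (G : WeakConnectionStructure h f) {s : X ⟶ X'}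
    {t : T ⟶ T'} (w : k ≫ (iStar h).map t = s ≫ k') :
    (hk.weakConnectionEquiv _ (G.precomp s)).1 =
      (iStar h).map t ≫ (hk'.weakConnectionEquiv _ G).1 := by
  have e : hk.iso.inv ≫ (iShriek h).map s = t ≫ hk'.iso.inv := by
    rw [Iso.inv_comp_eq, ← Category.assoc, ← hk.map_comp_iso_hom hk' w, Category.assoc,
      hk'.iso.hom_inv_id, Category.comp_id]
  change (iStar h).map hk.iso.inv ≫ (iStar h).map ((iShriek h).map s) ≫ G.Γ = _
  rw [← Category.assoc, ← Functor.map_comp, e, Functor.map_comp, Category.assoc]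
  rfl

end UniversalArrow

/-! ### Lifting weak connection structures -/

theorem comical.hasLiftingProperty {P Q X Y : MarkedCubicalSet A} {k : P ⟶ Q} (hk : comical A k)
    {f : X ⟶ Y} (hf : comicalFibration A f) : HasLiftingProperty k f :=
  hk (comicalFibration A).llp ((MorphismProperty.le_llp_iff_le_rlp _ _).2 le_rfl)
    inferInstance inferInstance inferInstance f hf

theorem exists_lift_cornerInclusion {X Y : MarkedCubicalSet A} {f : X ⟶ Y}
    [HasLiftingProperty (cornerInclusion h n) f] {x : stdCube A n ⟶ X}
    {b : (iStar h).obj (boundary B n) ⟶ X} {y : (iStar h).obj (stdCube B n) ⟶ Y}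
    (hb : boundaryToIStar h n ≫ b = boundaryι A n ≫ x) (hy : cubeToIStar h n ≫ y = x ≫ f)
    (hby : (iStar h).map (boundaryι B n) ≫ y = b ≫ f) :
    ∃ G : (iStar h).obj (stdCube B n) ⟶ X,
      cubeToIStar h n ≫ G = x ∧ (iStar h).map (boundaryι B n) ≫ G = b ∧ G ≫ f = y := by
  have sq : CommSq (pushout.desc x b hb.symm) (cornerInclusion h n) f y := by
    constructor
    apply pushout.hom_ext
    · rw [pushout.inl_desc_assoc, cornerInclusion, pushout.inl_desc_assoc, hy]
    · rw [pushout.inr_desc_assoc, cornerInclusion, pushout.inr_desc_assoc, hby]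
  refine ⟨sq.lift, ?_, ?_, sq.fac_right⟩
  · have := congrArg (pushout.inl _ _ ≫ ·) sq.fac_left
    simpa only [cornerInclusion, pushout.inl_desc_assoc, pushout.inl_desc] using this
  · have := congrArg (pushout.inr _ _ ≫ ·) sq.fac_left
    simpa only [cornerInclusion, pushout.inr_desc_assoc, pushout.inr_desc] using this

theorem exists_weakConnectionStructure {X Y : MarkedCubicalSet A} {f : X ⟶ Y}
    [HasLiftingProperty (cornerInclusion h n) f] (x : stdCube A n ⟶ X)
    (Γb : WeakConnectionStructure h (boundaryι A n ≫ x)) (Γy : WeakConnectionStructure h (x ≫ f))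
    (e : (Γy.precomp (boundaryι A n)).Γ = (Γb.postcomp f).Γ) :
    ∃ Γx : WeakConnectionStructure h x, Γx.precomp (boundaryι A n) = Γb ∧ Γx.postcomp f = Γy := by
  have hc : IsUniversalArrow h (cubeToIStar h n) := isUniversalArrow_cubeToIStar
  have hb : IsUniversalArrow h (boundaryToIStar h n) := isUniversalArrow_boundaryToIStar
  let b := hb.weakConnectionEquiv _ Γb
  let y := hc.weakConnectionEquiv _ Γy
  have hby : (iStar h).map (boundaryι B n) ≫ y.1 = b.1 ≫ f := by
    rw [← hb.weakConnectionEquiv_precomp hc Γy (boundaryToIStar_comp h n),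
      ← hb.weakConnectionEquiv_postcomp]
    exact congrArg ((iStar h).map hb.iso.inv ≫ ·) e
  obtain ⟨G, hGx, hGb, hGy⟩ := exists_lift_cornerInclusion b.2 y.2 hby
  let Γx := (hc.weakConnectionEquiv x).symm ⟨G, hGx⟩
  have hΓx : (hc.weakConnectionEquiv x Γx).1 = G :=
    congrArg Subtype.val (Equiv.apply_symm_apply _ _)
  refine ⟨Γx, (hb.weakConnectionEquiv _).injective (Subtype.ext ?_),
    (hc.weakConnectionEquiv _).injective (Subtype.ext ?_)⟩
  · rw [hb.weakConnectionEquiv_precomp hc Γx (boundaryToIStar_comp h n), hΓx, hGb]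
  · rw [hc.weakConnectionEquiv_postcomp, hΓx, hGy]

end MarkedCubicalSet

theorem proposition2p15 (A : Set Bool) (n : ℕ) :
    comical ∅ (cornerInclusion (Set.empty_subset A) n) ∧
    ∀ (X Y : MarkedCubicalSet ∅) (f : X ⟶ Y), comicalFibration ∅ f →
      ∀ (x : stdCube ∅ n ⟶ X)
        (Γb : WeakConnectionStructure (Set.empty_subset A) (boundaryι ∅ n ≫ x))
        (Γy : WeakConnectionStructure (Set.empty_subset A) (x ≫ f)),
        (Γy.precomp (boundaryι ∅ n)).Γ = (Γb.postcomp f).Γ →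
        ∃ Γx : WeakConnectionStructure (Set.empty_subset A) x,
          Γx.precomp (boundaryι ∅ n) = Γb ∧ Γx.postcomp f = Γy :=
  ⟨comical_cornerInclusion A n, fun _ _ _ hf x Γb Γy e =>
    have := (comical_cornerInclusion A n).hasLiftingProperty hf
    exists_weakConnectionStructure x Γb Γy e⟩
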